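/- Let $\mathcal L=\mathbb Z\lambda_1+\mathbb Z\lambda_2\subset\mathbb R^2$ be the lattice generated by a basis $(\lambda_1,\lambda_2)$ of $\mathbb R^2$, with fundamental domain $\mathcal D=\{t_1\lambda_1+t_2\lambda_2:\ t_1,t_2\in[0,1)\}$ of area $1$. Let $U$ be a random vector uniformly distributed on $\mathcal D$, and let $(\mathrm p_x)_{x\in\mathcal L}$ be a family of $\mathbb R^2$-valued random variables, possibly dependent on each other, independent of $U$, whose joint distribution is $\mathcal L$-invariant: for every $y\in\mathcal L$, $(\mathrm p_{x+y})_{x\in\mathcal L}$ has the same distribution as $(\mathrm p_x)_{x\in\mathcal L}$. Consider the perturbed lattice $$\mathbf{PL}:=\{x+U+\mathrm p_x:\ x\in\mathcal L\}$$ (points counted with multiplicity, i.e. $\mathbf{PL}=\sum_{x\in\mathcal L}\delta_{x+U+\mathrm p_x}$). Suppose that $\mathbb E\big[|\mathrm p_0|^{2+\alpha}\big]<\infty$ for some $\alpha>0$. Then: 1. $\mathbf{PL}$ is a point process, i.e. almost surely a locally finite configuration of points. 2. $\mathbf{PL}$ is $\star$-hyperuniform: writing $B_r$ for the closed disk of radius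 $r$ centred at $0$, the rescaled number variance $\sigma(r):=\mathrm{Var}\big[|\mathbf{PL}\cap B_r|\big]/|B_r|$ satisfies $$\sigma(r)\to0\ \text{ as } r\to\infty\qquad\text{and}\qquad\sum_{n\ge0}\sigma(2^n)<\infty .$$ 3. $\mathbf{PL}$ has finite regularized Coulomb energy, at every regularization scale $\eta>0$. Here, for a point process $\mathbf X$, the Coulomb energy (per unit area) regularized at scale $\eta$ is the infimum of $\mathbb E\int_{[0,1]^2}|E(z)|^2\,dz$ over all pairs $(\mathbf X',E)$, defined on some probability space, where $\mathbf X'$ is a point process with the same law as $\mathbf X$, $E$ is a random vector field on $\mathbb R^2$ (measurable jointly in the randomness and the space variable), the joint law of $(\mathbf X',E)$ is invariant under translations of $\mathbb R^2$, and almost surely $E$ is locally integrable and satisfies, in the sense of distributions, $$\operatorname{curl}E=0,\qquad \operatorname{div}E=2\pi\Big(\sum_{x\in\mathbf X'}\delta^{(\eta)}_x-\mathrm{Leb}\Big),$$ with $\delta^{(\eta)}_x$ the uniform probability measure on the circle of centre $x$ and radius $\eta$ (and $\inf\emptyset=+\infty$). -/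

import Mathlib

open MeasureTheory ProbabilityTheory Filter Topology
open scoped ENNReal

/-- The Euclidean plane. -/
abbrev Plane : Type := EuclideanSpace ℝ (Fin 2)

/-! ### Point processes -/

/-- A point configuration: a locally finite, integer-valued Borel measure on the plane
(equivalently, a locally finite sum of Dirac masses, multiplicities being allowed). -/
def IsPointConfiguration (ξ : Measure Plane) : Prop :=
  IsLocallyFiniteMeasure ξ ∧
    ∀ B : Set Plane, MeasurableSet B → Bornology.IsBounded B → ∃ n : ℕ, ξ B = n

/-- A point process: a random point configuration. The space of measures carries the
sigma-algebra generated by the evaluations `ξ ↦ ξ B` for `B` Borel. -/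
def IsPointProcess {Ω : Type*} [MeasurableSpace Ω] (X : Ω → Measure Plane) (P : Measure Ω) :
    Prop :=
  Measurable X ∧ ∀ᵐ ω ∂P, IsPointConfiguration (X ω)

/-- The rescaled number variance `σ(r) = Var[|X ∩ B_r|] / |B_r|`, with `B_r` the closed disk of
radius `r` centred at the origin. It takes the value `∞` when the variance is infinite. -/
noncomputable def rescaledNumberVariance {Ω : Type*} [MeasurableSpace Ω]
    (X : Ω → Measure Plane) (P : Measure Ω) (r : ℝ) : ℝ≥0∞ :=
  evariance (fun ω => (X ω (Metric.closedBall 0 r)).toReal) P /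
    volume (Metric.closedBall (0 : Plane) r)

/-- Hyperuniformity: `σ(r) → 0` as `r → ∞`. -/
def IsHyperuniform {Ω : Type*} [MeasurableSpace Ω]
    (X : Ω → Measure Plane) (P : Measure Ω) : Prop :=
  Tendsto (rescaledNumberVariance X P) atTop (𝓝 0)

/-- `⋆`-hyperuniformity: hyperuniformity together with `∑_{n ≥ 0} σ(2^n) < ∞`. -/
def IsStarHyperuniform {Ω : Type*} [MeasurableSpace Ω]
    (X : Ω → Measure Plane) (P : Measure Ω) : Prop :=
  IsHyperuniform X P ∧ ∑' n : ℕ, rescaledNumberVariance X P (2 ^ n) < ∞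

/-! ### Perturbed lattices -/

/-- The lattice generated by a basis of the plane. -/
abbrev latticeOf (b : Module.Basis (Fin 2) ℝ Plane) : Submodule ℤ Plane :=
  Submodule.span ℤ (Set.range b)

/-- The perturbed lattice `{x + U + p_x, x ∈ L}`, as a random sum of Dirac masses. -/
noncomputable def perturbedLattice {Ω : Type*} (b : Module.Basis (Fin 2) ℝ Plane)
    (U : Ω → Plane) (p : latticeOf b → Ω → Plane) (ω : Ω) : Measure Plane :=
  Measure.sum fun x : latticeOf b => Measure.dirac ((x : Plane) + U ω + p x ω)

/-- Invariance of the joint distribution of the perturbations under the lattice translations. -/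
def IsLatticeInvariant {Ω : Type*} [MeasurableSpace Ω] (b : Module.Basis (Fin 2) ℝ Plane)
    (p : latticeOf b → Ω → Plane) (P : Measure Ω) : Prop :=
  ∀ y : latticeOf b, IdentDistrib (fun ω x => p (x + y) ω) (fun ω x => p x ω) P P

/-! ### Regularized Coulomb energy -/

/-- The average of `φ` over the circle of centre `z` and radius `η`, i.e. the integral of `φ`
against a unit charge placed at `z` and smeared out uniformly over that circle. -/
noncomputable def smearedCharge (η : ℝ) (φ : Plane → ℝ) (z : Plane) : ℝ :=
  (2 * Real.pi)⁻¹ *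
    ∫ θ in (0 : ℝ)..(2 * Real.pi), φ (z + η • !₂[Real.cos θ, Real.sin θ])

/-- The rotation by a quarter turn. -/
noncomputable def quarterTurn (v : Plane) : Plane := !₂[-v 1, v 0]

/-- `E` is an electric field compatible with the configuration `ξ` regularized at scale `η`:
in the sense of distributions, `curl E = 0` and `div E = 2π (ξ ⋆ δ^η - Leb)`, where `δ^η` is the
uniform probability measure on the circle of radius `η`. In other words `E = -∇V` where `V` solves
`-ΔV = 2π (ξ ⋆ δ^η - Leb)`, the Coulomb kernel in dimension two being `-log |x|`. -/
def IsElectricField (η : ℝ) (ξ : Measure Plane) (E : Plane → Plane) : Prop :=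
  LocallyIntegrable E volume ∧
    ∀ φ : Plane → ℝ, ContDiff ℝ (⊤ : ℕ∞) φ → HasCompactSupport φ →
      (∫ x, fderiv ℝ φ x (quarterTurn (E x))) = 0 ∧
      -(∫ x, fderiv ℝ φ x (E x)) =
        2 * Real.pi * ((∫ z, smearedCharge η φ z ∂ξ) - ∫ x, φ x)

/-- Joint stationarity of a random configuration and a random vector field: their joint law
(finite-dimensional distributions, for the field) is invariant under translations. -/
def IsJointlyStationary {Ω : Type*} [MeasurableSpace Ω] (X : Ω → Measure Plane)
    (E : Ω → Plane → Plane) (P : Measure Ω) : Prop :=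
  ∀ u : Plane, IdentDistrib
    (fun ω => ((X ω).map (fun z => z - u), fun x => E ω (x + u)))
    (fun ω => (X ω, E ω)) P P

/-- The Coulomb energy per unit area, regularized at scale `η`, of the law `μ` of a point process:
the infimum of `𝔼 ∫_{[0,1]²} |E|²` over all stationary couplings of a point process of law `μ`
with an electric field `E` compatible with this process regularized at scale `η`. It is `∞` when
there is no such field. -/
noncomputable def regularizedCoulombEnergy (η : ℝ) (μ : Measure (Measure Plane)) : ℝ≥0∞ :=
  sInf {e : ℝ≥0∞ | ∃ (Ω : Type) (_ : MeasurableSpace Ω) (P : Measure Ω)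
    (X : Ω → Measure Plane) (E : Ω → Plane → Plane),
      IsProbabilityMeasure P ∧ IsPointProcess X P ∧ P.map X = μ ∧
      Measurable (Function.uncurry E) ∧ IsJointlyStationary X E P ∧
      (∀ᵐ ω ∂P, IsElectricField η (X ω) (E ω)) ∧
      e = ∫⁻ ω, (∫⁻ x in {x : Plane | ∀ i, x i ∈ Set.Icc (0 : ℝ) 1}, ‖E ω x‖ₑ ^ 2) ∂P}

/-!
The perturbed lattice is first rewritten as a transport of Lebesgue measure. Translations of the
plane act on the pairs formed by the shift `U`, seen as a position modulo the lattice, and the field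
of perturbations, whose labels are shifted when a cell boundary is crossed (`latticeFlow`). The
uniform law of `U` and the lattice invariance of the perturbations make this action measure
preserving. As the cells have area one, the perturbed lattice is the image of Lebesgue measure under
the map sending each `y` to the point attached to its cell, and this map is `y ↦ y + τ (θ y ω)` for
the single random vector `τ = U + p 0` (`perturbedLattice_eq_displacedLebesgue`). Only the flow `θ`,
the displacement `τ` and its moment of order `2 + α` are used afterwards.

**Electric field.** Transporting one unit of charge from the origin to `τ` changes its potential
energy in a smooth potential `ψ` by the difference of the averages of `ψ` over the circles of radius
`η` around `τ` and `0`. A logarithmic Poincaré inequality bounds this difference by the Dirichlet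
energy of `ψ` in a disk of radius comparable to `1 + ‖τ‖`, and the moment assumption absorbs the
area of the disk and the logarithm. Averaging over the environment, the mean potential difference
is bounded by the `L²` norm of the gradient
(`IsSmoothObservable.sq_lintegral_potential_difference_le`). The Riesz representation theorem, in
the closure of the gradients, provides a square-integrable vector whose translates along the flow
form a stationary field; the representation identity is its divergence equation, and being a limit
of gradients it is curl free (`IsStationaryFlow.exists_field`). A countable dense family of test
functions then gives the equations almost surely for all test functions simultaneously.

**Hyperuniformity.** The number of points in a disk of radius `r` lies between averages, over
translations of length at most `δ`, of the numbers of points in the disks of radii `r - δ` and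
`r + δ`. Such an average differs from the area by a linear statistic of a disk mollified at unit
scale, which equals the integral of the stationary field against a gradient, and by a boundary term,
which is an average of `L²` random variables against the difference of a disk and its mollification.
By transference and Plancherel's theorem (`IsStationaryFlow.sum_lintegral_average_sq_le`), the `L²`
norms of both are controlled by Fourier multipliers. Thanks to the decay of the Fourier transform of
a disk, the boundary term has variance of the order of the perimeter, and the squares of the
normalized multipliers of the first term have a bounded sum over any lacunary sequence of radii.
Hence the rescaled number variances are summable along every lacunary sequence of radii
(`IsStationaryFlow.tsum_rescaledNumberVariance_lt_top`). This contains the summability over the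
powers of two, and it forces the convergence to zero, since otherwise some lacunary sequence would
violate it.
-/

/-! ### Plancherel's theorem and families of Fourier multipliers -/

theorem MeasureTheory.Integrable.memLp_two_of_bound {α E : Type*} [MeasurableSpace α]
    [NormedAddCommGroup E] {μ : Measure α} {f : α → E} (hf : Integrable f μ) {C : ℝ}
    (hC : ∀ x, ‖f x‖ ≤ C) : MemLp f 2 μ := by
  refine (memLp_two_iff_integrable_sq_norm hf.aestronglyMeasurable).2 ?_
  refine (hf.norm.const_mul C).mono' (hf.aestronglyMeasurable.norm.pow 2) ?_
  filter_upwards with x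
  rw [Real.norm_eq_abs, abs_of_nonneg (sq_nonneg _), sq]
  exact mul_le_mul_of_nonneg_right (hC x) (norm_nonneg _)

open FourierTransform in
/-- Plancherel's theorem for an integrable and square-integrable function, with the Fourier
transform given by its integral formula. -/
theorem lintegral_fourier_sq {g : Plane → ℂ} (hg : Integrable g) (hg2 : MemLp g 2) :
    ∫⁻ k, ‖𝓕 g k‖ₑ ^ 2 = ∫⁻ x, ‖g x‖ₑ ^ 2 := by
  have hcont : Continuous (𝓕 g) := by
    exact VectorFourier.fourierIntegral_continuous Real.continuous_fourierChar
      (by exact continuous_inner) hg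
  have key : (𝓕 (hg2.toLp g) : Lp ℂ 2 (volume : Measure Plane)) =ᵐ[volume] 𝓕 g := by
    refine ae_eq_of_integral_contDiff_smul_eq ?_ hcont.locallyIntegrable ?_
    · exact (Lp.memLp _).locallyIntegrable (by norm_num)
    intro φ hφ hφc
    have hφ' : ContDiff ℝ (⊤ : ℕ∞) (fun x => (φ x : ℂ)) :=
      Complex.ofRealCLM.contDiff.comp hφ
    have hφc' : HasCompactSupport (fun x => (φ x : ℂ)) :=
      hφc.comp_left (g := fun t : ℝ => (t : ℂ)) (by simp)
    set S : SchwartzMap Plane ℂ := hφc'.toSchwartzMap hφ' with hS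
    have h1 := congrArg (fun T => T S) (Lp.fourier_toTemperedDistribution_eq (hg2.toLp g))
    simp only [TemperedDistribution.fourier_apply, Lp.toTemperedDistribution_apply] at h1
    have h2 : ∫ x, (𝓕 S) x • (hg2.toLp g) x = ∫ x, (𝓕 S) x • g x := by
      refine integral_congr_ae ?_
      filter_upwards [hg2.coeFn_toLp] with x hx
      rw [hx]
    have h3 : ∫ x, (𝓕 S) x • g x = ∫ x, S x • 𝓕 g x := by
      have := VectorFourier.integral_fourierIntegral_smul_eq_flip (L := innerₗ Plane)
        Real.continuous_fourierChar continuous_inner (S.integrable (μ := volume)) hg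
      simpa using! this
    rw [h2, h3] at h1
    simp only [hS] at h1
    simpa using h1.symm
  have h := Lp.norm_fourier_eq (hg2.toLp g)
  rw [Lp.norm_def, Lp.norm_def, ENNReal.toReal_eq_toReal_iff' (Lp.eLpNorm_ne_top _)
    (Lp.eLpNorm_ne_top _), eLpNorm_congr_ae key, eLpNorm_congr_ae hg2.coeFn_toLp,
    eLpNorm_eq_lintegral_rpow_enorm_toReal (by norm_num) (by norm_num),
    eLpNorm_eq_lintegral_rpow_enorm_toReal (by norm_num) (by norm_num)] at h
  have h' := congrArg (fun t : ℝ≥0∞ => t ^ (2 : ℝ)) h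
  simp only [← ENNReal.rpow_mul, ENNReal.toReal_ofNat] at h'
  norm_num at h'
  exact h'

open FourierTransform in
theorem fourier_comp_neg (f : Plane → ℂ) (k : Plane) :
    𝓕 (fun x => f (-x)) k = 𝓕 f (-k) := by
  rw [Real.fourier_eq, Real.fourier_eq, ← integral_neg_eq_self]
  simp

/-- A finite family of convolution operators is bounded on `L²` by the supremum of the square
function of the multipliers. -/
theorem sum_lintegral_correlation_sq_le {ι : Type*} (s : Finset ι) (K : ι → Plane → ℝ)
    (hK : ∀ j ∈ s, Integrable (K j)) (hKb : ∀ j ∈ s, ∃ C, ∀ x, |K j x| ≤ C) (M : ℝ≥0∞)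
    (hM : ∀ k, ∑ j ∈ s, ‖FourierTransform.fourier (fun x => (K j x : ℂ)) k‖ₑ ^ 2 ≤ M)
    {g : Plane → ℝ} (hg : Integrable g) (hg2 : MemLp g 2) :
    ∑ j ∈ s, ∫⁻ x, ‖∫ z, K j z * g (x + z)‖ₑ ^ 2 ≤ M * ∫⁻ x, ‖g x‖ₑ ^ 2 := by
  have hgc : Integrable (fun x => (g x : ℂ)) := hg.ofReal
  have hgc2 : MemLp (fun x => (g x : ℂ)) 2 := hg2.ofReal
  have hFg := lintegral_fourier_sq hgc hgc2
  have hmeas : AEMeasurable (fun k => ‖FourierTransform.fourier (fun x => (g x : ℂ)) k‖ₑ ^ 2)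
      volume := by
    have hcont : Continuous (FourierTransform.fourier (fun x => (g x : ℂ))) :=
      VectorFourier.fourierIntegral_continuous Real.continuous_fourierChar
        (by exact continuous_inner) hgc
    exact (hcont.enorm.measurable.pow_const 2).aemeasurable
  have hj : ∀ j ∈ s, ∫⁻ x, ‖∫ z, K j z * g (x + z)‖ₑ ^ 2 =
      ∫⁻ k, ‖FourierTransform.fourier (fun x => (K j x : ℂ)) (-k)‖ₑ ^ 2 *
        ‖FourierTransform.fourier (fun x => (g x : ℂ)) k‖ₑ ^ 2 := by
    intro j hjs
    obtain ⟨C, hC⟩ := hKb j hjs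
    have hKn : Integrable (fun x => (K j (-x) : ℂ)) := ((hK j hjs).comp_neg).ofReal
    set c : Plane → ℂ := MeasureTheory.convolution (fun x => (K j (-x) : ℂ)) (fun x => (g x : ℂ))
      (ContinuousLinearMap.mul ℂ ℂ) volume with hc
    have hcint : Integrable c := hKn.integrable_convolution _ hgc
    have hceq : ∀ x, c x = ((∫ z, K j z * g (x + z) : ℝ) : ℂ) := by
      intro x
      rw [hc, MeasureTheory.convolution_def, ← integral_neg_eq_self, ← integral_complex_ofReal]
      simp
    have hcbd : ∀ x, ‖c x‖ ≤ C * ∫ y, |g y| := by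
      intro x
      rw [hceq, Complex.norm_real, ← integral_const_mul]
      calc ‖∫ z, K j z * g (x + z)‖ ≤ ∫ z, C * |g (x + z)| := by
            refine norm_integral_le_of_norm_le ((hg.comp_add_left x).abs.const_mul C) ?_
            filter_upwards with z
            rw [norm_mul, Real.norm_eq_abs, Real.norm_eq_abs]
            exact mul_le_mul_of_nonneg_right (hC z) (abs_nonneg _)
        _ = _ := integral_add_left_eq_self (fun y => C * |g y|) x
    have hc2 : MemLp c 2 := hcint.memLp_two_of_bound hcbd
    have := lintegral_fourier_sq hcint hc2
    calc ∫⁻ x, ‖∫ z, K j z * g (x + z)‖ₑ ^ 2 = ∫⁻ x, ‖c x‖ₑ ^ 2 := by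
          refine lintegral_congr fun x => ?_
          rw [hceq, ← ofReal_norm, ← ofReal_norm, Complex.norm_real]
      _ = ∫⁻ k, ‖FourierTransform.fourier c k‖ₑ ^ 2 := this.symm
      _ = _ := by
          refine lintegral_congr fun k => ?_
          rw [hc, Real.fourier_mul_convolution_eq hKn hgc,
            fourier_comp_neg (fun x => (K j x : ℂ)), enorm_mul, mul_pow]
  rw [Finset.sum_congr rfl hj, ← lintegral_finsetSum']
  · have hg' : ∫⁻ x, ‖g x‖ₑ ^ 2 = ∫⁻ x, ‖(g x : ℂ)‖ₑ ^ 2 := by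
      refine lintegral_congr fun x => ?_
      rw [← ofReal_norm, ← ofReal_norm, Complex.norm_real]
    rw [hg', ← hFg, ← lintegral_const_mul'' _ hmeas]
    refine lintegral_mono fun k => ?_
    rw [← Finset.sum_mul]
    exact mul_le_mul_left (hM (-k)) _
  · intro j hjs
    refine AEMeasurable.mul ?_ hmeas
    have hcont : Continuous (FourierTransform.fourier (fun x => (K j x : ℂ))) :=
      VectorFourier.fourierIntegral_continuous Real.continuous_fourierChar
        (by exact continuous_inner) (hK j hjs).ofReal
    exact ((hcont.comp continuous_neg).enorm.measurable.pow_const 2).aemeasurable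

/-! ### The Fourier transform of a disk -/

theorem hasDerivAt_sqrt_one_sub_sq {u : ℝ} (hu : 0 < 1 - u ^ 2) :
    HasDerivAt (fun u : ℝ => √(1 - u ^ 2)) (-u / √(1 - u ^ 2)) u := by
  have h : HasDerivAt (fun u : ℝ => 1 - u ^ 2) (-(2 * u)) u := by
    simpa using (hasDerivAt_pow 2 u).const_sub 1
  have := h.sqrt hu.ne'
  convert! this using 1
  field_simp

theorem hasDerivAt_neg_div_sqrt_one_sub_sq {u : ℝ} (hu : 0 < 1 - u ^ 2) :
    HasDerivAt (fun u : ℝ => -u / √(1 - u ^ 2)) (-(1 / ((1 - u ^ 2) * √(1 - u ^ 2)))) u := by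
  have hs : 0 < √(1 - u ^ 2) := Real.sqrt_pos.2 hu
  have hss : √(1 - u ^ 2) ^ 2 = 1 - u ^ 2 := Real.sq_sqrt hu.le
  have := (hasDerivAt_id u).neg.div (hasDerivAt_sqrt_one_sub_sq hu) hs.ne'
  convert! this using 1
  simp only [id_eq, Pi.neg_apply]
  rw [hss]
  field_simp
  rw [hss]
  ring

/-- Decay of the Fourier transform of the density `√(1 - u²)` of the one-dimensional projection
of the uniform measure on the unit disk. -/
theorem norm_integral_sqrt_one_sub_sq_mul_exp_le {t : ℝ} (ht : 2 ≤ t) :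
    ‖∫ u in (-1 : ℝ)..1, (√(1 - u ^ 2) : ℂ) * Complex.exp (-(t * u : ℝ) * Complex.I)‖ ≤
      12 * (√t / t ^ 2) := by
  have ht0 : 0 < t := by linarith
  have hst : 0 < √t := Real.sqrt_pos.2 ht0
  have hstt : √t ^ 2 = t := Real.sq_sqrt ht0.le
  set a : ℝ := 1 - 1 / t with ha
  have hinv : 1 / t ≤ 1 / 2 := one_div_le_one_div_of_le (by norm_num) ht
  have hinv0 : 0 < 1 / t := by positivity
  have ha0 : 0 ≤ a := by linarith
  have ha1 : a < 1 := by linarith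
  have hpos : ∀ u ∈ Set.Icc (-a) a, 1 / t ≤ 1 - u ^ 2 := by
    rintro u ⟨h1, h2⟩
    nlinarith
  set E : ℝ → ℂ := fun u => Complex.exp (-(t * u : ℝ) * Complex.I) with hE
  have hEn : ∀ u, ‖E u‖ = 1 := by
    intro u
    have := Complex.norm_exp_ofReal_mul_I (-(t * u))
    rw [hE]; simpa using this
  have hEc : Continuous E := by rw [hE]; fun_prop
  have hwc : Continuous fun u : ℝ => ((√(1 - u ^ 2) : ℝ) : ℂ) := by fun_prop
  have hint : ∀ x y, IntervalIntegrable (fun u : ℝ => ((√(1 - u ^ 2) : ℝ) : ℂ) * E u) volume x y :=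
    fun x y => (hwc.mul hEc).intervalIntegrable x y
  -- The two ends, where the density is small.
  have hsm : ∀ u : ℝ, a ≤ |u| → |u| ≤ 1 → √(1 - u ^ 2) ≤ 2 * (√t / t) := by
    intro u h1 h2
    rw [Real.sqrt_le_left (by positivity), mul_pow, div_pow, hstt, ← sq_abs u]
    have : t / t ^ 2 = 1 / t := by field_simp
    rw [this]
    nlinarith [abs_nonneg u]
  have hend1 : ‖∫ u in (-1 : ℝ)..(-a), ((√(1 - u ^ 2) : ℝ) : ℂ) * E u‖ ≤ 2 * (√t / t ^ 2) := by
    refine (intervalIntegral.norm_integral_le_of_norm_le_const (C := 2 * (√t / t)) ?_).trans ?_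
    · intro u hu
      rw [Set.uIoc_of_le (by linarith)] at hu
      rw [norm_mul, hEn, mul_one, Complex.norm_real, Real.norm_eq_abs,
        abs_of_nonneg (by positivity)]
      have : |u| = -u := abs_of_nonpos (by linarith [hu.2])
      exact hsm u (by linarith [hu.2]) (by linarith [hu.1])
    · rw [abs_of_nonneg (by linarith), ha]
      apply le_of_eq; field_simp; ring
  have hend2 : ‖∫ u in a..(1 : ℝ), ((√(1 - u ^ 2) : ℝ) : ℂ) * E u‖ ≤ 2 * (√t / t ^ 2) := by
    refine (intervalIntegral.norm_integral_le_of_norm_le_const (C := 2 * (√t / t)) ?_).trans ?_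
    · intro u hu
      rw [Set.uIoc_of_le (by linarith)] at hu
      rw [norm_mul, hEn, mul_one, Complex.norm_real, Real.norm_eq_abs,
        abs_of_nonneg (by positivity)]
      have : |u| = u := abs_of_nonneg (by linarith [hu.1])
      exact hsm u (by linarith [hu.1]) (by linarith [hu.2])
    · rw [abs_of_nonneg (by linarith), ha]
      apply le_of_eq; field_simp; ring
  -- The bulk `|u| ≤ 1 - 1 / t`, where two integrations by parts are possible.
  set w' : ℝ → ℝ := fun u => -u / √(1 - u ^ 2) with hw'
  set w'' : ℝ → ℝ := fun u => -(1 / ((1 - u ^ 2) * √(1 - u ^ 2))) with hw''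
  have hw'b : ∀ u ∈ Set.Icc (-a) a, |w' u| ≤ √t := by
    intro u hu
    have h1 := hpos u hu
    have h2 : 1 / √t ≤ √(1 - u ^ 2) := by
      apply Real.le_sqrt_of_sq_le
      rw [div_pow, hstt, one_pow]; exact h1
    have h3 : |u| ≤ 1 := by rw [abs_le]; constructor <;> linarith [hu.1, hu.2]
    rw [hw']
    simp only [abs_div, abs_neg, abs_of_nonneg (Real.sqrt_nonneg (1 - u ^ 2))]
    rw [div_le_iff₀ (lt_of_lt_of_le (by positivity) h2)]
    calc |u| ≤ 1 := h3
      _ = √t * (1 / √t) := by field_simp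
      _ ≤ _ := by gcongr
  have hw''c : ContinuousOn w'' (Set.Icc (-a) a) := by
    have : ∀ u ∈ Set.Icc (-a) a, (1 - u ^ 2) * √(1 - u ^ 2) ≠ 0 := by
      intro u hu
      have := hinv0.trans_le (hpos u hu)
      positivity
    exact (continuousOn_const.div (by fun_prop) this).neg
  have huIcc : Set.uIcc (-a) a = Set.Icc (-a) a := Set.uIcc_of_le (by linarith)
  have hI2 : ∫ u in (-a)..a, w'' u = w' a - w' (-a) := by
    refine intervalIntegral.integral_eq_sub_of_hasDerivAt ?_ ?_
    · intro u hu
      rw [huIcc] at hu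
      exact hasDerivAt_neg_div_sqrt_one_sub_sq (hinv0.trans_le (hpos u hu))
    · exact ContinuousOn.intervalIntegrable (by rwa [huIcc])
  have hamem : a ∈ Set.Icc (-a) a := ⟨by linarith, le_rfl⟩
  have hnamem : -a ∈ Set.Icc (-a) a := ⟨le_rfl, by linarith⟩
  have hw''E : ‖∫ u in (-a)..a, (w'' u : ℂ) * E u‖ ≤ 2 * √t := by
    calc ‖∫ u in (-a)..a, (w'' u : ℂ) * E u‖ ≤ ∫ u in (-a)..a, -w'' u := by
          refine intervalIntegral.norm_integral_le_of_norm_le (by linarith) ?_ ?_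
          · refine Eventually.of_forall fun u hu => ?_
            have h1 := hinv0.trans_le (hpos u ⟨hu.1.le, hu.2⟩)
            rw [norm_mul, hEn, mul_one, Complex.norm_real, Real.norm_eq_abs, hw'']
            simp only [abs_neg, neg_neg]
            exact (abs_of_nonneg (by positivity)).le
          · exact ContinuousOn.intervalIntegrable (by rw [huIcc]; exact hw''c.neg)
      _ = w' (-a) - w' a := by rw [intervalIntegral.integral_neg, hI2]; ring
      _ ≤ 2 * √t := by
          have h1 := abs_le.1 (hw'b _ hamem)
          have h2 := abs_le.1 (hw'b _ hnamem)
          linarith [h1.1, h2.2]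
  set F : ℝ → ℂ := fun u => ((√(1 - u ^ 2) : ℝ) : ℂ) * E u * (Complex.I / t) +
    (w' u : ℂ) * E u / t ^ 2 with hF
  have htC : (t : ℂ) ≠ 0 := by exact_mod_cast ht0.ne'
  have hFd : ∀ u ∈ Set.uIcc (-a) a, HasDerivAt F
      (((√(1 - u ^ 2) : ℝ) : ℂ) * E u + (w'' u : ℂ) * E u / t ^ 2) u := by
    intro u hu
    rw [huIcc] at hu
    have hu' := hinv0.trans_le (hpos u hu)
    have hEd : HasDerivAt E (E u * (-t * Complex.I)) u := by
      have h1 : HasDerivAt (fun u : ℝ => -((t * u : ℝ) : ℂ) * Complex.I) (-t * Complex.I) u := by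
        have h2 : HasDerivAt (fun u : ℝ => ((t * u : ℝ) : ℂ)) (t : ℂ) u := by
          have := ((hasDerivAt_id u).const_mul t).ofReal_comp
          simpa using this
        exact h2.neg.mul_const _
      exact h1.cexp
    have h1 := (hasDerivAt_sqrt_one_sub_sq hu').ofReal_comp
    have h2 := (hasDerivAt_neg_div_sqrt_one_sub_sq hu').ofReal_comp
    have := ((h1.mul hEd).mul_const (Complex.I / t)).add ((h2.mul hEd).div_const ((t : ℂ) ^ 2))
    convert! this using 1
    simp only [hw'']
    have hI : Complex.I ^ 2 = -1 := Complex.I_sq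
    field_simp
    ring_nf
    rw [hI]
    ring
  have hcw'' : ContinuousOn (fun u => (w'' u : ℂ) * E u / t ^ 2) (Set.uIcc (-a) a) := by
    rw [huIcc]
    exact ((Complex.continuous_ofReal.comp_continuousOn hw''c).mul hEc.continuousOn).div_const _
  have hii := hcw''.intervalIntegrable (μ := volume)
  have hmid : ∫ u in (-a)..a, ((√(1 - u ^ 2) : ℝ) : ℂ) * E u =
      F a - F (-a) - (∫ u in (-a)..a, (w'' u : ℂ) * E u) / t ^ 2 := by
    rw [← intervalIntegral.integral_eq_sub_of_hasDerivAt hFd ((hint _ _).add hii),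
      intervalIntegral.integral_add (hint _ _) hii, intervalIntegral.integral_div]
    ring
  have hFb : ∀ u, u ∈ Set.Icc (-a) a → |u| = a → ‖F u‖ ≤ 3 * (√t / t ^ 2) := by
    intro u hu hua
    have h1 := hsm u hua.ge (by linarith)
    have h2 := hw'b u hu
    refine (norm_add_le _ _).trans ?_
    have hnt : ‖(t : ℂ)‖ = t := by rw [Complex.norm_real, Real.norm_eq_abs, abs_of_pos ht0]
    simp only [norm_mul, norm_div, hEn, mul_one, Complex.norm_real, Complex.norm_I, norm_pow,
      hnt, Real.norm_eq_abs, abs_of_nonneg (Real.sqrt_nonneg (1 - u ^ 2))]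
    calc √(1 - u ^ 2) * (1 / t) + |w' u| / t ^ 2 ≤ 2 * (√t / t) * (1 / t) + √t / t ^ 2 := by gcongr
      _ = _ := by field_simp; ring
  have hmidb : ‖∫ u in (-a)..a, ((√(1 - u ^ 2) : ℝ) : ℂ) * E u‖ ≤ 8 * (√t / t ^ 2) := by
    rw [hmid]
    have h1 := hFb a hamem (abs_of_nonneg ha0)
    have h2 := hFb (-a) hnamem (by rw [abs_neg, abs_of_nonneg ha0])
    have h3 : ‖(∫ u in (-a)..a, (w'' u : ℂ) * E u) / (t : ℂ) ^ 2‖ ≤ 2 * (√t / t ^ 2) := by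
      rw [norm_div, norm_pow, Complex.norm_real, Real.norm_eq_abs, abs_of_pos ht0, ← mul_div_assoc]
      gcongr
    refine (norm_sub_le _ _).trans ?_
    have := norm_sub_le (F a) (F (-a))
    linarith
  rw [← intervalIntegral.integral_add_adjacent_intervals (hint (-1) (-a)) (hint (-a) 1),
    ← intervalIntegral.integral_add_adjacent_intervals (hint (-a) a) (hint a 1)]
  refine (norm_add_le _ _).trans ?_
  have := norm_add_le (∫ u in (-a)..a, ((√(1 - u ^ 2) : ℝ) : ℂ) * E u)
    (∫ u in a..1, ((√(1 - u ^ 2) : ℝ) : ℂ) * E u)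
  linarith

/-- The identification of `ℝ × ℝ` with the plane. -/
noncomputable def prodEquivPlane : ℝ × ℝ ≃ᵐ Plane :=
  MeasurableEquiv.finTwoArrow.symm.trans (MeasurableEquiv.toLp 2 (Fin 2 → ℝ))

theorem prodEquivPlane_apply (p : ℝ × ℝ) : prodEquivPlane p = !₂[p.1, p.2] := by
  ext i
  fin_cases i <;> rfl

theorem measurePreserving_prodEquivPlane :
    MeasurePreserving prodEquivPlane volume volume :=
  ((EuclideanSpace.volume_preserving_symm_measurableEquiv_toLp (Fin 2)).symm).comp
    ((volume_preserving_finTwoArrow ℝ).symm)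

theorem integral_plane {F : Type*} [NormedAddCommGroup F] [NormedSpace ℝ F] (f : Plane → F) :
    ∫ x, f x = ∫ p : ℝ × ℝ, f !₂[p.1, p.2] := by
  rw [← measurePreserving_prodEquivPlane.integral_comp prodEquivPlane.measurableEmbedding]
  simp [prodEquivPlane_apply]

theorem norm_sq_plane (x : Plane) : ‖x‖ ^ 2 = x 0 ^ 2 + x 1 ^ 2 := by
  rw [EuclideanSpace.norm_sq_eq, Fin.sum_univ_two]
  simp

/-- Integration over a disk of a function of the first coordinate. -/
theorem setIntegral_closedBall_fst {s : ℝ} (hs : 0 < s) {f : ℝ → ℂ} (hf : Continuous f) :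
    ∫ x in Metric.closedBall (0 : Plane) s, f (x 0) =
      2 * s ^ 2 * ∫ u in (-1 : ℝ)..1, (√(1 - u ^ 2) : ℂ) * f (s * u) := by
  rw [← integral_indicator measurableSet_closedBall, integral_plane]
  set g : ℝ × ℝ → ℂ := fun p => Set.indicator (Metric.closedBall (0 : Plane) s)
    (fun x => f (x 0)) !₂[p.1, p.2] with hg
  have hgint : Integrable g := by
    have h1 : Integrable (Set.indicator (Metric.closedBall (0 : Plane) s)
        (fun x => f (x 0))) := by
      rw [integrable_indicator_iff measurableSet_closedBall]
      exact (Continuous.continuousOn (by fun_prop)).integrableOn_compact (isCompact_closedBall _ _)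
    have h2 := (measurePreserving_prodEquivPlane.integrable_comp_emb
      prodEquivPlane.measurableEmbedding).2 h1
    refine h2.congr (Eventually.of_forall fun p => ?_)
    simp only [Function.comp, prodEquivPlane_apply, hg]
  have hval : ∀ x y, g (x, y) = Set.indicator (Set.Icc (-√(s ^ 2 - x ^ 2)) √(s ^ 2 - x ^ 2))
      (fun _ => Set.indicator (Set.Icc (-s) s) f x) y := by
    intro x y
    have hb : !₂[x, y] ∈ Metric.closedBall (0 : Plane) s ↔ x ^ 2 + y ^ 2 ≤ s ^ 2 := by
      rw [mem_closedBall_zero_iff, ← sq_le_sq₀ (norm_nonneg _) hs.le, norm_sq_plane]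
      simp
    have hb2 : x ^ 2 + y ^ 2 ≤ s ^ 2 ↔ y ∈ Set.Icc (-√(s ^ 2 - x ^ 2)) √(s ^ 2 - x ^ 2) ∧
        x ∈ Set.Icc (-s) s := by
      constructor
      · intro h
        exact ⟨abs_le.1 (Real.abs_le_sqrt (by linarith)),
          abs_le.1 (abs_le_of_sq_le_sq (by nlinarith [sq_nonneg y]) hs.le)⟩
      · rintro ⟨h1, h2⟩
        have h3 : x ^ 2 ≤ s ^ 2 := sq_le_sq' h2.1 h2.2
        have h4 := sq_le_sq' h1.1 h1.2
        rw [Real.sq_sqrt (by linarith)] at h4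
        linarith
    by_cases h : x ^ 2 + y ^ 2 ≤ s ^ 2
    · rw [hg]
      simp only
      rw [Set.indicator_of_mem (hb.2 h), Set.indicator_of_mem (hb2.1 h).1,
        Set.indicator_of_mem (hb2.1 h).2]
      simp
    · rw [hg]
      simp only
      rw [Set.indicator_of_notMem (fun hh => h (hb.1 hh))]
      by_cases hy : y ∈ Set.Icc (-√(s ^ 2 - x ^ 2)) √(s ^ 2 - x ^ 2)
      · rw [Set.indicator_of_mem hy, Set.indicator_of_notMem (fun hh => h (hb2.2 ⟨hy, hh⟩))]
      · rw [Set.indicator_of_notMem hy]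
  change ∫ p, g p = _
  rw [Measure.volume_eq_prod, integral_prod _ (by rwa [← Measure.volume_eq_prod])]
  have hin : ∀ x, ∫ y, g (x, y) = Set.indicator (Set.Icc (-s) s)
      (fun x => (2 * √(s ^ 2 - x ^ 2) : ℝ) * f x) x := by
    intro x
    simp_rw [hval]
    rw [integral_indicator measurableSet_Icc, setIntegral_const, Real.volume_real_Icc_of_le
      (by linarith [Real.sqrt_nonneg (s ^ 2 - x ^ 2)])]
    by_cases hx : x ∈ Set.Icc (-s) s
    · rw [Set.indicator_of_mem hx, Set.indicator_of_mem hx, Complex.real_smul]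
      congr 2
      ring
    · rw [Set.indicator_of_notMem hx, Set.indicator_of_notMem hx, smul_zero]
  simp_rw [hin]
  rw [integral_indicator measurableSet_Icc, integral_Icc_eq_integral_Ioc,
    ← intervalIntegral.integral_of_le (by linarith)]
  have hsub := intervalIntegral.smul_integral_comp_mul_left (a := -1) (b := 1)
    (fun x : ℝ => ((2 * √(s ^ 2 - x ^ 2) : ℝ) : ℂ) * f x) s
  rw [mul_one, mul_neg, mul_one] at hsub
  rw [← hsub, Complex.real_smul, ← intervalIntegral.integral_const_mul,
    ← intervalIntegral.integral_const_mul]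
  refine intervalIntegral.integral_congr fun u _ => ?_
  have : √(s ^ 2 - (s * u) ^ 2) = s * √(1 - u ^ 2) := by
    rw [show s ^ 2 - (s * u) ^ 2 = s ^ 2 * (1 - u ^ 2) by ring, Real.sqrt_mul (sq_nonneg _),
      Real.sqrt_sq hs.le]
  simp only [this]
  push_cast
  ring

open FourierTransform in
theorem fourier_disk {s : ℝ} (hs : 0 < s) (k : Plane) :
    𝓕 (Set.indicator (Metric.closedBall (0 : Plane) s) (fun _ => (1 : ℂ))) k =
      2 * s ^ 2 * ∫ u in (-1 : ℝ)..1, (√(1 - u ^ 2) : ℂ) *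
        Complex.exp (-((2 * Real.pi * s * ‖k‖) * u : ℝ) * Complex.I) := by
  set v : Plane := !₂[‖k‖, 0] with hv
  have hvk : ‖v‖ = ‖k‖ := by
    rw [← sq_eq_sq₀ (norm_nonneg _) (norm_nonneg _), norm_sq_plane]
    simp [hv]
  set T := (Submodule.span ℝ {v - k})ᗮ.reflection with hT
  have hTv : T v = k := Submodule.reflection_sub hvk
  have h1 : ∀ x : Plane, Complex.exp (↑(-2 * Real.pi * inner ℝ x k) * Complex.I) •
      Set.indicator (Metric.closedBall (0 : Plane) s) (fun _ => (1 : ℂ)) x =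
      Set.indicator (Metric.closedBall (0 : Plane) s)
        (fun x => Complex.exp (↑(-2 * Real.pi * inner ℝ x k) * Complex.I)) x := by
    intro x
    by_cases hx : x ∈ Metric.closedBall (0 : Plane) s
    · rw [Set.indicator_of_mem hx, Set.indicator_of_mem hx, smul_eq_mul, mul_one]
    · rw [Set.indicator_of_notMem hx, Set.indicator_of_notMem hx, smul_zero]
  have h2 : ∀ x : Plane, Set.indicator (Metric.closedBall (0 : Plane) s)
        (fun x => Complex.exp (↑(-2 * Real.pi * inner ℝ x k) * Complex.I)) (T x) =
      Set.indicator (Metric.closedBall (0 : Plane) s)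
        (fun x => Complex.exp (-((2 * Real.pi * ‖k‖) * x 0 : ℝ) * Complex.I)) x := by
    intro x
    have hm : T x ∈ Metric.closedBall (0 : Plane) s ↔ x ∈ Metric.closedBall (0 : Plane) s := by
      rw [mem_closedBall_zero_iff, mem_closedBall_zero_iff, T.norm_map]
    by_cases hx : x ∈ Metric.closedBall (0 : Plane) s
    · rw [Set.indicator_of_mem (hm.2 hx), Set.indicator_of_mem hx]
      congr 2
      have : inner ℝ (T x) k = ‖k‖ * x 0 := by
        rw [← hTv, T.inner_map_map, hTv]
        simp [PiLp.inner_apply, hv]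
      rw [this]
      push_cast
      ring
    · rw [Set.indicator_of_notMem (fun h => hx (hm.1 h)), Set.indicator_of_notMem hx]
  rw [Real.fourier_eq', integral_congr_ae (Eventually.of_forall h1),
    ← T.measurePreserving.integral_comp T.toMeasurableEquiv.measurableEmbedding
    (Set.indicator (Metric.closedBall (0 : Plane) s)
        (fun x => Complex.exp (↑(-2 * Real.pi * inner ℝ x k) * Complex.I))),
    integral_congr_ae (Eventually.of_forall h2), integral_indicator measurableSet_closedBall,
    setIntegral_closedBall_fst hs (f := fun u => Complex.exp (-((2 * Real.pi * ‖k‖) * u : ℝ) *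
      Complex.I)) (by fun_prop)]
  congr 1
  refine intervalIntegral.integral_congr fun u _ => ?_
  congr 3
  push_cast
  ring

open FourierTransform in
/-- The Fourier transform of the disk of radius `s` is `O(s² (s|k|)^{-3/2})`. This decay, due to
the curvature of the circle, is what makes number variances in disks behave well. -/
theorem norm_fourier_disk_sq_le {s : ℝ} (hs : 0 < s) (k : Plane) :
    ‖𝓕 (Set.indicator (Metric.closedBall (0 : Plane) s) (fun _ => (1 : ℂ))) k‖ ^ 2 * ‖k‖ ^ 3 ≤
      600 * s := by
  rw [fourier_disk hs k, norm_mul]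
  have hpi := Real.pi_gt_three
  set t : ℝ := 2 * Real.pi * s * ‖k‖ with ht
  have ht0 : 0 ≤ t := by positivity
  have hks : t ^ 3 = 8 * Real.pi ^ 3 * s ^ 3 * ‖k‖ ^ 3 := by rw [ht]; ring
  have hn : ‖(2 * (s : ℂ) ^ 2)‖ = 2 * s ^ 2 := by
    rw [norm_mul, norm_pow, Complex.norm_real, Real.norm_eq_abs, abs_of_pos hs]; simp
  rw [hn, mul_pow]
  set I := ‖∫ u in (-1 : ℝ)..1, (√(1 - u ^ 2) : ℂ) * Complex.exp (-(t * u : ℝ) * Complex.I)‖ with hI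
  have hmain : I ^ 2 * t ^ 3 ≤ 144 := by
    rcases le_total 2 t with h | h
    · have h1 := norm_integral_sqrt_one_sub_sq_mul_exp_le h
      have ht' : 0 < t := by linarith
      calc I ^ 2 * t ^ 3 ≤ (12 * (√t / t ^ 2)) ^ 2 * t ^ 3 := by gcongr
        _ = 144 := by
          rw [mul_pow, div_pow, Real.sq_sqrt ht0]; field_simp; norm_num
    · have h1 : I ≤ 1 * |1 - (-1)| := by
        refine intervalIntegral.norm_integral_le_of_norm_le_const fun u _ => ?_
        have h2 : ‖Complex.exp (-(t * u : ℝ) * Complex.I)‖ = 1 := by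
          have := Complex.norm_exp_ofReal_mul_I (-(t * u)); simpa using this
        rw [norm_mul, h2, mul_one, Complex.norm_real, Real.norm_eq_abs,
          abs_of_nonneg (Real.sqrt_nonneg _), Real.sqrt_le_one]
        nlinarith [sq_nonneg u]
      norm_num at h1
      have h0 : 0 ≤ I := norm_nonneg _
      calc I ^ 2 * t ^ 3 ≤ 2 ^ 2 * 2 ^ 3 := by gcongr
        _ ≤ 144 := by norm_num
  have hpi3 : (1 : ℝ) ≤ Real.pi ^ 3 := one_le_pow₀ (by linarith)
  rw [hks] at hmain
  have h3 : I ^ 2 * (s ^ 3 * ‖k‖ ^ 3) ≤ 18 := by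
    have h0 : 0 ≤ I ^ 2 * (s ^ 3 * ‖k‖ ^ 3) := by positivity
    nlinarith
  calc (2 * s ^ 2) ^ 2 * I ^ 2 * ‖k‖ ^ 3 = 4 * s * (I ^ 2 * (s ^ 3 * ‖k‖ ^ 3)) := by ring
    _ ≤ 4 * s * 18 := by gcongr
    _ ≤ 600 * s := by linarith

/-! ### The Cauchy-Schwarz inequality for lower integrals -/

/-- The weighted Cauchy-Schwarz inequality. -/
theorem sq_lintegral_le_weighted {α : Type*} [MeasurableSpace α] {μ : Measure α}
    {w f : α → ℝ≥0∞} (hw : AEMeasurable w μ) (hf : AEMeasurable f μ) (h0 : ∀ x, w x ≠ 0)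
    (ht : ∀ x, w x ≠ ∞) :
    (∫⁻ x, f x ∂μ) ^ 2 ≤ (∫⁻ x, (w x)⁻¹ ∂μ) * ∫⁻ x, w x * f x ^ 2 ∂μ := by
  have h := ENNReal.lintegral_mul_le_Lp_mul_Lq μ Real.HolderConjugate.two_two
    (f := fun x => (w x) ^ (-(1 / 2) : ℝ)) (g := fun x => (w x) ^ (1 / 2 : ℝ) * f x)
    (hw.pow_const _) ((hw.pow_const _).mul hf)
  have e1 : ∀ x, ((fun x => (w x) ^ (-(1 / 2) : ℝ)) *
      fun x => (w x) ^ (1 / 2 : ℝ) * f x) x = f x := by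
    intro x
    simp only [Pi.mul_apply]
    rw [← mul_assoc, ← ENNReal.rpow_add _ _ (h0 x) (ht x)]
    simp
  have e2 : ∀ x, ((w x) ^ (-(1 / 2) : ℝ)) ^ (2 : ℝ) = (w x)⁻¹ := by
    intro x
    rw [← ENNReal.rpow_mul, ← ENNReal.rpow_neg_one]; norm_num
  have e3 : ∀ x, ((w x) ^ (1 / 2 : ℝ) * f x) ^ (2 : ℝ) = w x * f x ^ 2 := by
    intro x
    rw [ENNReal.mul_rpow_of_nonneg _ _ (by norm_num), ← ENNReal.rpow_mul]
    norm_num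
  simp only [e1, e2, e3] at h
  calc (∫⁻ x, f x ∂μ) ^ 2
      ≤ ((∫⁻ x, (w x)⁻¹ ∂μ) ^ (1 / 2 : ℝ) * (∫⁻ x, w x * f x ^ 2 ∂μ) ^ (1 / 2 : ℝ)) ^ 2 := by gcongr
    _ = _ := by
      rw [← ENNReal.mul_rpow_of_nonneg _ _ (by norm_num), ← ENNReal.rpow_ofNat, ← ENNReal.rpow_mul]
      norm_num

theorem sq_lintegral_le {α : Type*} [MeasurableSpace α] {μ : Measure α}
    {f : α → ℝ≥0∞} (hf : AEMeasurable f μ) :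
    (∫⁻ x, f x ∂μ) ^ 2 ≤ μ Set.univ * ∫⁻ x, f x ^ 2 ∂μ := by
  simpa using sq_lintegral_le_weighted (w := fun _ => 1) aemeasurable_const hf
    (by simp) (by simp)

theorem volume_closedBall_plane (x : Plane) {r : ℝ} (hr : 0 ≤ r) :
    volume (Metric.closedBall x r) = ENNReal.ofReal (Real.pi * r ^ 2) := by
  rw [EuclideanSpace.volume_closedBall_fin_two, ← ENNReal.ofReal_pow hr, mul_comm,
    ENNReal.ofReal_mul Real.pi_pos.le]

theorem sq_add_add_le (x y z : ℝ≥0∞) : (x + y + z) ^ 2 ≤ 3 * (x ^ 2 + y ^ 2 + z ^ 2) := by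
  rcases eq_or_ne x ∞ with rfl | hx
  · simp
  rcases eq_or_ne y ∞ with rfl | hy
  · simp
  rcases eq_or_ne z ∞ with rfl | hz
  · simp
  lift x to NNReal using hx
  lift y to NNReal using hy
  lift z to NNReal using hz
  norm_cast
  rw [← NNReal.coe_le_coe]
  push_cast
  nlinarith [sq_nonneg ((x : ℝ) - y), sq_nonneg ((x : ℝ) - z), sq_nonneg ((y : ℝ) - z)]

theorem sq_add_le (x y : ℝ≥0∞) : (x + y) ^ 2 ≤ 2 * (x ^ 2 + y ^ 2) := by
  rcases eq_or_ne x ∞ with rfl | hx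
  · simp
  rcases eq_or_ne y ∞ with rfl | hy
  · simp
  lift x to NNReal using hx
  lift y to NNReal using hy
  norm_cast
  rw [← NNReal.coe_le_coe]
  push_cast
  nlinarith [sq_nonneg ((x : ℝ) - y)]

/-! ### Circle averages and the Dirichlet energy -/

/-- The annulus of radii `R` and `2R`. -/
def annulus (R : ℝ) : Set Plane := {z | R ≤ ‖z‖ ∧ ‖z‖ ≤ 2 * R}

theorem measurableSet_annulus (R : ℝ) : MeasurableSet (annulus R) :=
  (measurableSet_le measurable_const measurable_norm).inter
    (measurableSet_le measurable_norm measurable_const)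

/-- A circle average as the average over an annulus of a function of the direction. -/
theorem setIntegral_annulus_direction {R : ℝ} (hR : 0 < R) (η : ℝ) {F : Plane → ℝ} (x : Plane) :
    ∫ z in annulus R, F (x + (η / ‖z‖) • z) = 3 * Real.pi * R ^ 2 * smearedCharge η F x := by
  rw [← integral_indicator (measurableSet_annulus R), integral_plane]
  change ∫ p : ℝ × ℝ, (fun p : ℝ × ℝ => (annulus R).indicator
    (fun z => F (x + (η / ‖z‖) • z)) !₂[p.1, p.2]) p = _
  rw [← integral_comp_polarCoord_symm]
  set f : ℝ → ℝ := Set.indicator (Set.Icc R (2 * R)) (fun r => r) with hf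
  set g : ℝ → ℝ := fun θ => F (x + η • !₂[Real.cos θ, Real.sin θ]) with hg
  have hval : ∀ p ∈ polarCoord.target, p.1 • (fun p : ℝ × ℝ => (annulus R).indicator
      (fun z => F (x + (η / ‖z‖) • z)) !₂[p.1, p.2]) (polarCoord.symm p) = f p.1 * g p.2 := by
    rintro ⟨r, θ⟩ hp
    have hr : 0 < r := hp.1
    simp only [polarCoord_symm_apply]
    set z : Plane := !₂[r * Real.cos θ, r * Real.sin θ] with hz
    have hz1 : z = r • !₂[Real.cos θ, Real.sin θ] := by
      ext i; fin_cases i <;> simp [hz]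
    have hzn : ‖z‖ = r := by
      rw [← sq_eq_sq₀ (norm_nonneg _) hr.le, norm_sq_plane]
      simp only [hz, PiLp.toLp_apply, Matrix.cons_val_zero, Matrix.cons_val_one]
      nlinarith [Real.sin_sq_add_cos_sq θ]
    by_cases h : r ∈ Set.Icc R (2 * R)
    · have hm : z ∈ annulus R := by rw [annulus]; simpa [hzn] using h
      rw [Set.indicator_of_mem hm, hf, Set.indicator_of_mem h, smul_eq_mul, hzn, hz1, smul_smul,
        div_mul_cancel₀ _ hr.ne', hg]
    · have hm : z ∉ annulus R := by rw [annulus]; simpa [hzn] using h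
      rw [Set.indicator_of_notMem hm, hf, Set.indicator_of_notMem h]
      simp
  rw [setIntegral_congr_fun polarCoord.open_target.measurableSet hval, polarCoord_target,
    Measure.volume_eq_prod, setIntegral_prod_mul f g]
  have h1 : ∫ r in Set.Ioi (0 : ℝ), f r = 3 / 2 * R ^ 2 := by
    rw [hf, setIntegral_indicator measurableSet_Icc]
    have : Set.Ioi (0 : ℝ) ∩ Set.Icc R (2 * R) = Set.Icc R (2 * R) :=
      Set.inter_eq_right.2 fun r hr => hR.trans_le hr.1
    rw [this, integral_Icc_eq_integral_Ioc, ← intervalIntegral.integral_of_le (by linarith),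
      integral_id]
    ring
  have h2 : ∫ θ in Set.Ioo (-Real.pi) Real.pi, g θ = 2 * Real.pi * smearedCharge η F x := by
    rw [← integral_Ioc_eq_integral_Ioo, ← intervalIntegral.integral_of_le
      (by linarith [Real.pi_pos])]
    have hper : Function.Periodic g (2 * Real.pi) := by
      intro θ
      simp [hg]
    have := hper.intervalIntegral_add_eq (-Real.pi) 0
    rw [show -Real.pi + 2 * Real.pi = Real.pi by ring, zero_add] at this
    rw [this, smearedCharge, ← mul_assoc, mul_inv_cancel₀ (by positivity), one_mul]
  rw [h1, h2]
  ring

/-- `G` is the gradient of the continuously differentiable function `ψ`. -/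
structure IsGradientField (ψ : Plane → ℝ) (G : Plane → Plane) : Prop where
  continuous : Continuous G
  hasFDerivAt : ∀ x, HasFDerivAt ψ (innerSL ℝ (G x)) x

theorem IsGradientField.continuous_potential {ψ : Plane → ℝ} {G : Plane → Plane}
    (h : IsGradientField ψ G) : Continuous ψ :=
  continuous_iff_continuousAt.2 fun x => (h.hasFDerivAt x).continuousAt

theorem IsGradientField.enorm_sub_le {ψ : Plane → ℝ} {G : Plane → Plane}
    (h : IsGradientField ψ G) (y v : Plane) {s : ℝ} (hs : s ≤ 1) :
    ‖ψ (y + v) - ψ (y + s • v)‖ₑ ≤ ‖v‖ₑ * ∫⁻ r in Set.Icc s 1, ‖G (y + r • v)‖ₑ := by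
  have hG := h.continuous
  have hd : ∀ r ∈ Set.uIcc s 1, HasDerivAt (fun r : ℝ => ψ (y + r • v))
      (inner ℝ (G (y + r • v)) v) r := by
    intro r _
    have h1 : HasDerivAt (fun r : ℝ => y + r • v) v r := by
      simpa using ((hasDerivAt_id r).smul_const v).const_add y
    exact (h.hasFDerivAt (y + r • v)).comp_hasDerivAt r h1
  have hc : Continuous fun r : ℝ => inner ℝ (G (y + r • v)) v := by fun_prop
  have := intervalIntegral.integral_eq_sub_of_hasDerivAt hd (hc.intervalIntegrable _ _)
  rw [one_smul] at this
  rw [← this, intervalIntegral.integral_of_le hs, ← integral_Icc_eq_integral_Ioc]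
  refine (enorm_integral_le_lintegral_enorm _).trans ?_
  rw [← lintegral_const_mul _ (Continuous.measurable (by fun_prop))]
  refine lintegral_mono fun r => ?_
  rw [mul_comm, enorm_eq_nnnorm, enorm_eq_nnnorm, enorm_eq_nnnorm, ← ENNReal.coe_mul]
  exact ENNReal.coe_le_coe.2 (nnnorm_inner_le_nnnorm (𝕜 := ℝ) (G (y + r • v)) v)

theorem lintegral_comp_smul_plane {f : Plane → ℝ≥0∞} (hf : Measurable f) {s : ℝ} (hs : 0 < s) :
    ∫⁻ z, f (s • z) = ENNReal.ofReal ((s ^ 2)⁻¹) * ∫⁻ z, f z := by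
  have h := Measure.map_addHaar_smul (volume : Measure Plane) hs.ne'
  rw [finrank_euclideanSpace_fin, abs_of_pos (by positivity)] at h
  rw [← lintegral_map hf (measurable_const_smul s), h, lintegral_smul_measure, smul_eq_mul]

/-- The square of the line integral of `G` along a radial segment issued from `q`, summed over an
annulus and estimated by the Cauchy-Schwarz inequality with weight `s`. The Jacobian `s ^ (-2)` of
`z ↦ q + s • z` then leaves the factor `s⁻¹`, whose integral is the logarithm. -/
theorem lintegral_annulus_segments_le {G : Plane → Plane} (hG : Continuous G) {η R : ℝ}
    (hη : 0 < η) (hηR : η ≤ R) {q : Plane} (hq : ‖q‖ ≤ R) :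
    ∫⁻ z in annulus R, (∫⁻ s in Set.Icc (η / (2 * R)) 1, ‖G (q + s • z)‖ₑ) ^ 2 ≤
      ENNReal.ofReal (Real.log (2 * R / η)) ^ 2 *
        ∫⁻ y in Metric.closedBall 0 (3 * R), ‖G y‖ₑ ^ 2 := by
  have hR : 0 < R := hη.trans_le hηR
  set s₀ : ℝ := η / (2 * R) with hs₀
  have hs₀0 : 0 < s₀ := by positivity
  have hs₀1 : s₀ ≤ 1 := by rw [hs₀, div_le_one (by positivity)]; linarith
  set L := ENNReal.ofReal (Real.log (2 * R / η)) with hL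
  set w : ℝ → ℝ≥0∞ := fun s => ENNReal.ofReal (max s s₀) with hw
  have hwm : Measurable w := by fun_prop
  -- The truncation of the weight at `s₀` is invisible on `[s₀, 1]`; it keeps `w` positive.
  have hwinv : ∫⁻ s in Set.Icc s₀ 1, (w s)⁻¹ = L := by
    have h1 : ∫⁻ s in Set.Icc s₀ 1, (w s)⁻¹ = ∫⁻ s in Set.Icc s₀ 1, ENNReal.ofReal (1 / s) := by
      refine setLIntegral_congr_fun measurableSet_Icc fun s hs => ?_
      simp only [hw, max_eq_left hs.1]
      rw [← ENNReal.ofReal_inv_of_pos (hs₀0.trans_le hs.1), one_div]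
    rw [h1, ← ofReal_integral_eq_lintegral_ofReal, integral_Icc_eq_integral_Ioc,
      ← intervalIntegral.integral_of_le hs₀1, integral_one_div_of_pos hs₀0 one_pos, hL, hs₀]
    · congr 2
      rw [one_div_div]
    · refine (ContinuousOn.integrableOn_compact isCompact_Icc ?_)
      exact continuousOn_const.div continuousOn_id fun s hs => (hs₀0.trans_le hs.1).ne'
    · filter_upwards [ae_restrict_mem measurableSet_Icc] with s hs
      have := hs₀0.trans_le hs.1
      positivity
  calc ∫⁻ z in annulus R, (∫⁻ s in Set.Icc s₀ 1, ‖G (q + s • z)‖ₑ) ^ 2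
      ≤ ∫⁻ z in annulus R, L * ∫⁻ s in Set.Icc s₀ 1, w s * ‖G (q + s • z)‖ₑ ^ 2 := by
        refine lintegral_mono fun z => ?_
        rw [← hwinv]
        refine sq_lintegral_le_weighted hwm.aemeasurable
          (Continuous.aemeasurable (by fun_prop)) (fun s => ?_) (fun s => ENNReal.ofReal_ne_top)
        simp [hw, hs₀0]
    _ = L * ∫⁻ s in Set.Icc s₀ 1, ∫⁻ z in annulus R, w s * ‖G (q + s • z)‖ₑ ^ 2 := by
        have hm : Measurable (Function.uncurry fun (z : Plane) (s : ℝ) =>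
            w s * ‖G (q + s • z)‖ₑ ^ 2) := by
          have : Continuous fun p : Plane × ℝ => G (q + p.2 • p.1) := by fun_prop
          exact (hwm.comp measurable_snd).mul (this.enorm.measurable.pow_const 2)
        rw [lintegral_const_mul _ (Measurable.lintegral_prod_right hm),
          lintegral_lintegral_swap hm.aemeasurable]
    _ ≤ L * ∫⁻ s in Set.Icc s₀ 1, (w s)⁻¹ * ∫⁻ y in Metric.closedBall 0 (3 * R), ‖G y‖ₑ ^ 2 := by
        refine mul_le_mul_right (setLIntegral_mono' measurableSet_Icc fun s hs => ?_) _
        have hs0 : 0 < s := hs₀0.trans_le hs.1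
        rw [lintegral_const_mul _ (Continuous.measurable (by fun_prop))]
        have h1 : ∫⁻ z in annulus R, ‖G (q + s • z)‖ₑ ^ 2 ≤
            ∫⁻ z, (Metric.closedBall (0 : Plane) (3 * R)).indicator (fun y => ‖G y‖ₑ ^ 2)
              (q + s • z) := by
          rw [← lintegral_indicator (measurableSet_annulus R)]
          refine lintegral_mono fun z => ?_
          by_cases hz : z ∈ annulus R
          · rw [Set.indicator_of_mem hz, Set.indicator_of_mem]
            rw [mem_closedBall_zero_iff]
            refine (norm_add_le _ _).trans ?_
            rw [norm_smul, Real.norm_eq_abs, abs_of_pos hs0]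
            nlinarith [hz.2, hs.2, norm_nonneg z]
          · rw [Set.indicator_of_notMem hz]
            exact zero_le
        have hGm : Measurable fun y => (Metric.closedBall (0 : Plane) (3 * R)).indicator
            (fun y => ‖G y‖ₑ ^ 2) y :=
          (Continuous.measurable (by fun_prop)).indicator measurableSet_closedBall
        have h2 := lintegral_comp_smul_plane (f := fun z =>
          (Metric.closedBall (0 : Plane) (3 * R)).indicator (fun y => ‖G y‖ₑ ^ 2) (q + z))
          (hGm.comp (measurable_const_add q)) hs0
        rw [lintegral_add_left_eq_self (fun z => (Metric.closedBall (0 : Plane) (3 * R)).indicator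
          (fun y => ‖G y‖ₑ ^ 2) z) q, lintegral_indicator measurableSet_closedBall] at h2
        rw [h2] at h1
        refine (mul_le_mul_right h1 _).trans ?_
        rw [← mul_assoc]
        refine mul_le_mul_left (le_of_eq ?_) _
        simp only [hw, max_eq_left hs.1]
        rw [← ENNReal.ofReal_inv_of_pos hs0, ← ENNReal.ofReal_mul hs0.le]
        congr 1
        field_simp
    _ = _ := by
        rw [lintegral_mul_const (f := fun s => (w s)⁻¹) _ hwm.inv, hwinv, ← mul_assoc, sq]

theorem lintegral_annulus_translates_le {G : Plane → Plane} (hG : Continuous G) {R : ℝ}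
    {q : Plane} (hq : ‖q‖ ≤ R) :
    ∫⁻ z in annulus R, (∫⁻ s in Set.Icc (0 : ℝ) 1, ‖G (z + s • q)‖ₑ) ^ 2 ≤
        ∫⁻ y in Metric.closedBall 0 (3 * R), ‖G y‖ₑ ^ 2 := by
  have hGm : Measurable fun y => (Metric.closedBall (0 : Plane) (3 * R)).indicator
            (fun y => ‖G y‖ₑ ^ 2) y :=
          (Continuous.measurable (by fun_prop)).indicator measurableSet_closedBall
  calc ∫⁻ z in annulus R, (∫⁻ s in Set.Icc (0 : ℝ) 1, ‖G (z + s • q)‖ₑ) ^ 2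
      ≤ ∫⁻ z in annulus R, ∫⁻ s in Set.Icc (0 : ℝ) 1, ‖G (z + s • q)‖ₑ ^ 2 := by
        refine lintegral_mono fun z => ?_
        refine (sq_lintegral_le (Continuous.aemeasurable (by fun_prop))).trans ?_
        simp
    _ = ∫⁻ s in Set.Icc (0 : ℝ) 1, ∫⁻ z in annulus R, ‖G (z + s • q)‖ₑ ^ 2 := by
        have : Continuous fun p : Plane × ℝ => G (p.1 + p.2 • q) := by fun_prop
        rw [lintegral_lintegral_swap (this.enorm.measurable.pow_const 2).aemeasurable]
    _ ≤ ∫⁻ s in Set.Icc (0 : ℝ) 1, ∫⁻ y in Metric.closedBall 0 (3 * R), ‖G y‖ₑ ^ 2 := by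
        refine setLIntegral_mono' measurableSet_Icc fun s hs => ?_
        rw [← lintegral_indicator (measurableSet_annulus R),
          ← lintegral_indicator measurableSet_closedBall,
          ← lintegral_add_right_eq_self (fun y => (Metric.closedBall (0 : Plane) (3 * R)).indicator
            (fun y => ‖G y‖ₑ ^ 2) y) (s • q)]
        refine lintegral_mono fun z => ?_
        by_cases hz : z ∈ annulus R
        · rw [Set.indicator_of_mem hz, Set.indicator_of_mem]
          rw [mem_closedBall_zero_iff]
          refine (norm_add_le _ _).trans ?_
          rw [norm_smul, Real.norm_eq_abs, abs_of_nonneg hs.1]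
          nlinarith [hz.2, hs.2, norm_nonneg q]
        · rw [Set.indicator_of_notMem hz]
          exact zero_le
    _ = _ := by simp

/-- A logarithmic Poincaré-type inequality: circle averages of a function at two points of the
disk of radius `R` differ by at most a logarithmic factor times the Dirichlet norm in the disk
of radius `3R`. Both circle averages are compared with averages over annuli of size `R`. -/
theorem IsGradientField.enorm_smearedCharge_sub_sq_le {ψ : Plane → ℝ} {G : Plane → Plane}
    (h : IsGradientField ψ G) {η R : ℝ} (hη : 0 < η) (hηR : η ≤ R) {q : Plane} (hq : ‖q‖ ≤ R) :
    ‖smearedCharge η ψ q - smearedCharge η ψ 0‖ₑ ^ 2 ≤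
      (8 * ENNReal.ofReal (Real.log (2 * R / η)) ^ 2 + 2) *
        ∫⁻ y in Metric.closedBall 0 (3 * R), ‖G y‖ₑ ^ 2 := by
  have hG := h.continuous
  have hψ := h.continuous_potential
  have hR : 0 < R := hη.trans_le hηR
  have hs₀1 : η / (2 * R) ≤ 1 := by rw [div_le_one (by positivity)]; linarith
  set I := ∫⁻ y in Metric.closedBall 0 (3 * R), ‖G y‖ₑ ^ 2 with hI
  set L := ENNReal.ofReal (Real.log (2 * R / η)) with hL
  set a : Plane → Plane → ℝ≥0∞ := fun q z => ∫⁻ s in Set.Icc (η / (2 * R)) 1, ‖G (q + s • z)‖ₑ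
    with ha
  set c : Plane → ℝ≥0∞ := fun z => ∫⁻ s in Set.Icc (0 : ℝ) 1, ‖G (z + s • q)‖ₑ with hc
  have ham : ∀ q, Measurable (a q) := by
    intro q
    have : Continuous fun p : Plane × ℝ => G (q + p.2 • p.1) := by fun_prop
    exact Measurable.lintegral_prod_right (f := fun (z : Plane) (s : ℝ) => ‖G (q + s • z)‖ₑ)
      this.enorm.measurable
  have hcm : Measurable c := by
    have : Continuous fun p : Plane × ℝ => G (p.1 + p.2 • q) := by fun_prop
    exact Measurable.lintegral_prod_right (f := fun (z : Plane) (s : ℝ) => ‖G (z + s • q)‖ₑ)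
      this.enorm.measurable
  set r : ℝ≥0∞ := ENNReal.ofReal (2 * R) with hr
  -- The pointwise comparison along segments.
  have hseg : ∀ q, ∀ z ∈ annulus R, ‖ψ (q + z) - ψ (q + (η / ‖z‖) • z)‖ₑ ≤ r * a q z := by
    intro q z hz
    have hz0 : 0 < ‖z‖ := hR.trans_le hz.1
    refine (h.enorm_sub_le q z (s := η / ‖z‖) ?_).trans ?_
    · rw [div_le_one hz0]; linarith [hz.1]
    · refine mul_le_mul' ?_ (lintegral_mono_set (Set.Icc_subset_Icc_left ?_))
      · rw [hr, ← ofReal_norm]; exact ENNReal.ofReal_le_ofReal hz.2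
      · exact div_le_div_of_nonneg_left hη.le hz0 hz.2
  have htr : ∀ z, ‖ψ (z + q) - ψ z‖ₑ ≤ r * c z := by
    intro z
    have := h.enorm_sub_le z q (s := 0) zero_le_one
    rw [zero_smul, add_zero] at this
    refine this.trans (mul_le_mul' ?_ le_rfl)
    rw [hr, ← ofReal_norm]; exact ENNReal.ofReal_le_ofReal (by linarith)
  -- From the circle around `q` to the circle around `0`, through `q + z` and `z`.
  have hpt : ∀ z ∈ annulus R, ‖ψ (q + (η / ‖z‖) • z) - ψ (0 + (η / ‖z‖) • z)‖ₑ ≤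
      r * (a q z + c z + a 0 z) := by
    intro z hz
    have e : ψ (q + (η / ‖z‖) • z) - ψ (0 + (η / ‖z‖) • z) =
        -(ψ (q + z) - ψ (q + (η / ‖z‖) • z)) + (ψ (z + q) - ψ z) +
          (ψ (0 + z) - ψ (0 + (η / ‖z‖) • z)) := by
      rw [add_comm z q, zero_add z]; ring
    rw [e]
    refine (enorm_add_le _ _).trans ?_
    refine (add_le_add (enorm_add_le _ _) le_rfl).trans ?_
    rw [enorm_neg, mul_add, mul_add]
    exact add_le_add (add_le_add (hseg q z hz) (htr z)) (hseg 0 z hz)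
  have hfin : volume (annulus R) ≤ ENNReal.ofReal (4 * Real.pi * R ^ 2) := by
    calc volume (annulus R) ≤ volume (Metric.closedBall (0 : Plane) (2 * R)) := by
          refine measure_mono fun z hz => ?_
          rw [mem_closedBall_zero_iff]; exact hz.2
      _ = _ := by rw [volume_closedBall_plane _ (by positivity)]; congr 1; ring
  have hint : ∀ q, IntegrableOn (fun z => ψ (q + (η / ‖z‖) • z)) (annulus R) := by
    intro q
    have hb : IsCompact (annulus R) := by
      refine Metric.isCompact_of_isClosed_isBounded ?_ ?_
      · exact (isClosed_le continuous_const continuous_norm).inter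
          (isClosed_le continuous_norm continuous_const)
      · refine Metric.isBounded_closedBall.subset (t := Metric.closedBall 0 (2 * R)) fun z hz => ?_
        rw [mem_closedBall_zero_iff]; exact hz.2
    refine ContinuousOn.integrableOn_compact hb ?_
    refine hψ.comp_continuousOn (continuousOn_const.add ((continuousOn_const.div
      continuous_norm.continuousOn fun z hz => (hR.trans_le hz.1).ne').smul continuousOn_id))
  have hdiff : 3 * Real.pi * R ^ 2 * (smearedCharge η ψ q - smearedCharge η ψ 0) =
      ∫ z in annulus R, (ψ (q + (η / ‖z‖) • z) - ψ (0 + (η / ‖z‖) • z)) := by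
    rw [integral_sub (hint q) (hint 0), setIntegral_annulus_direction hR,
      setIntegral_annulus_direction hR]
    ring
  have hmain : ENNReal.ofReal (3 * Real.pi * R ^ 2) ^ 2 *
      ‖smearedCharge η ψ q - smearedCharge η ψ 0‖ₑ ^ 2 ≤
      ENNReal.ofReal (4 * Real.pi * R ^ 2) * (r ^ 2 * (3 * ((L ^ 2 * I + I) + L ^ 2 * I))) := by
    have e : ENNReal.ofReal (3 * Real.pi * R ^ 2) *
        ‖smearedCharge η ψ q - smearedCharge η ψ 0‖ₑ =
        ‖∫ z in annulus R, (ψ (q + (η / ‖z‖) • z) - ψ (0 + (η / ‖z‖) • z))‖ₑ := by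
      rw [← hdiff, enorm_mul, Real.enorm_of_nonneg (r := 3 * Real.pi * R ^ 2) (by positivity)]
    rw [← mul_pow, e]
    calc ‖∫ z in annulus R, (ψ (q + (η / ‖z‖) • z) - ψ (0 + (η / ‖z‖) • z))‖ₑ ^ 2
        ≤ (∫⁻ z in annulus R, r * (a q z + c z + a 0 z)) ^ 2 := by
          gcongr
          refine (enorm_integral_le_lintegral_enorm _).trans ?_
          exact setLIntegral_mono' (measurableSet_annulus R) hpt
      _ ≤ volume (annulus R) * ∫⁻ z in annulus R, (r * (a q z + c z + a 0 z)) ^ 2 := by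
          refine (sq_lintegral_le ?_).trans ?_
          · exact (((ham q).add hcm).add (ham 0)).const_mul r |>.aemeasurable
          · simp
      _ ≤ ENNReal.ofReal (4 * Real.pi * R ^ 2) * ∫⁻ z in annulus R,
            r ^ 2 * (3 * (a q z ^ 2 + c z ^ 2 + a 0 z ^ 2)) := by
          gcongr with z
          rw [mul_pow]
          gcongr
          exact sq_add_add_le _ _ _
      _ ≤ _ := by
          have m1 := (ham q).pow_const 2
          have m2 := hcm.pow_const 2
          have m3 := (ham 0).pow_const 2
          rw [lintegral_const_mul _ (by fun_prop), lintegral_const_mul _ (by fun_prop),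
            lintegral_add_right _ m3, lintegral_add_right _ m2]
          gcongr
          · exact lintegral_annulus_segments_le hG hη hηR hq
          · exact lintegral_annulus_translates_le hG hq
          · exact lintegral_annulus_segments_le hG hη hηR (by simpa using hR.le)
  have h3 : ENNReal.ofReal (3 * Real.pi * R ^ 2) ^ 2 ≠ 0 := by
    have : 0 < 3 * Real.pi * R ^ 2 := by positivity
    simp [this]
  rw [← ENNReal.mul_le_mul_iff_right h3 (by simp)]
  refine hmain.trans ?_
  have hk : ENNReal.ofReal (4 * Real.pi * R ^ 2) * (r ^ 2 * 3) ≤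
      ENNReal.ofReal (3 * Real.pi * R ^ 2) ^ 2 * 2 := by
    rw [hr, ← ENNReal.ofReal_pow (by positivity), ← ENNReal.ofReal_pow (by positivity),
      ← ENNReal.ofReal_ofNat, ← ENNReal.ofReal_ofNat, ← ENNReal.ofReal_mul (by positivity),
      ← ENNReal.ofReal_mul (by positivity), ← ENNReal.ofReal_mul (by positivity)]
    refine ENNReal.ofReal_le_ofReal ?_
    have h1 := Real.pi_gt_three
    have h2 : 0 ≤ Real.pi * (R ^ 4) := by positivity
    have h4 : 9 * (Real.pi * R ^ 4) ≤ 3 * Real.pi * (Real.pi * R ^ 4) := by nlinarith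
    nlinarith
  calc ENNReal.ofReal (4 * Real.pi * R ^ 2) * (r ^ 2 * (3 * ((L ^ 2 * I + I) + L ^ 2 * I)))
      = (ENNReal.ofReal (4 * Real.pi * R ^ 2) * (r ^ 2 * 3)) * ((2 * L ^ 2 + 1) * I) := by ring
    _ ≤ (ENNReal.ofReal (3 * Real.pi * R ^ 2) ^ 2 * 2) * ((2 * L ^ 2 + 1) * I) := by gcongr
    _ = ENNReal.ofReal (3 * Real.pi * R ^ 2) ^ 2 * ((4 * L ^ 2 + 2) * I) := by ring
    _ ≤ _ := by gcongr; norm_num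

/-! ### Stationary flows and transference -/

/-- A measurable and measure-preserving action `θ` of the translations of the plane on a
probability space. The identity `θ 0 ω = ω` is only required almost surely. -/
structure IsStationaryFlow {Ω : Type*} [MeasurableSpace Ω] (θ : Plane → Ω → Ω) (P : Measure Ω) :
    Prop where
  measurable : Measurable (Function.uncurry θ)
  measurePreserving : ∀ x, MeasurePreserving (θ x) P P
  add : ∀ x y ω, θ x (θ y ω) = θ (x + y) ω
  zero : ∀ᵐ ω ∂P, θ 0 ω = ω

namespace IsStationaryFlow

variable {Ω : Type*} [MeasurableSpace Ω] {θ : Plane → Ω → Ω} {P : Measure Ω}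

theorem measurable_comp {α β : Type*} [MeasurableSpace α] [MeasurableSpace β]
    (hθ : IsStationaryFlow θ P) {f : Ω → β} (hf : Measurable f) {g : α → Plane}
    {h : α → Ω} (hg : Measurable g) (hh : Measurable h) : Measurable fun a => f (θ (g a) (h a)) :=
  hf.comp (hθ.measurable.comp (hg.prodMk hh))

theorem lintegral_comp (hθ : IsStationaryFlow θ P) {f : Ω → ℝ≥0∞} (hf : Measurable f) (x : Plane) :
    ∫⁻ ω, f (θ x ω) ∂P = ∫⁻ ω, f ω ∂P :=
  (hθ.measurePreserving x).lintegral_comp hf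

theorem lintegral_lintegral_comp [SFinite P] (hθ : IsStationaryFlow θ P) {f : Ω → ℝ≥0∞}
    (hf : Measurable f) (ν : Measure Plane) [SFinite ν] :
    ∫⁻ ω, ∫⁻ y, f (θ y ω) ∂ν ∂P = ν Set.univ * ∫⁻ ω, f ω ∂P := by
  rw [lintegral_lintegral_swap]
  · simp_rw [hθ.lintegral_comp hf]
    rw [lintegral_const, mul_comm]
  · exact (hθ.measurable_comp hf measurable_snd measurable_fst).aemeasurable

theorem ae_lintegral_closedBall_lt_top [SFinite P] (hθ : IsStationaryFlow θ P) {f : Ω → ℝ≥0∞}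
    (hf : Measurable f) (hfi : ∫⁻ ω, f ω ∂P < ∞) :
    ∀ᵐ ω ∂P, ∀ r : ℝ, ∫⁻ y in Metric.closedBall 0 r, f (θ y ω) < ∞ := by
  have h : ∀ n : ℕ, ∀ᵐ ω ∂P, ∫⁻ y in Metric.closedBall 0 (n : ℝ), f (θ y ω) < ∞ := by
    intro n
    refine ae_lt_top ?_ ?_
    · exact Measurable.lintegral_prod_right' (f := fun p : Ω × Plane => f (θ p.2 p.1))
        (hθ.measurable_comp hf measurable_snd measurable_fst)
    · rw [hθ.lintegral_lintegral_comp hf]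
      refine ENNReal.mul_ne_top ?_ hfi.ne
      rw [Measure.restrict_apply_univ]
      exact (isCompact_closedBall _ _).measure_lt_top.ne
  filter_upwards [ae_all_iff.2 h] with ω hω r
  obtain ⟨n, hn⟩ := exists_nat_ge r
  exact (lintegral_mono_set (Metric.closedBall_subset_closedBall hn)).trans_lt (hω n)

/-- **Transference**: the `L²(P)` norm of an average along the orbits of the flow is controlled by
the Fourier transform of the averaging kernel, as for convolutions on the plane. Orbits are
truncated to large disks, where Plancherel's theorem applies. -/
theorem sum_lintegral_average_sq_le [IsProbabilityMeasure P] (hθ : IsStationaryFlow θ P)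
    {ι : Type*} (s : Finset ι) (K : ι → Plane → ℝ) (hK : ∀ j ∈ s, Measurable (K j))
    (hKb : ∀ j ∈ s, ∃ C, ∀ x, |K j x| ≤ C) {ρ : ℝ} (hρ : 0 ≤ ρ)
    (hKs : ∀ j ∈ s, ∀ x, ρ < ‖x‖ → K j x = 0) (M : ℝ≥0∞)
    (hM : ∀ k, ∑ j ∈ s, ‖FourierTransform.fourier (fun x => (K j x : ℂ)) k‖ₑ ^ 2 ≤ M)
    {u : Ω → ℝ} (hu : Measurable u) (hu2 : ∫⁻ ω, ‖u ω‖ₑ ^ 2 ∂P < ∞) :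
    ∑ j ∈ s, ∫⁻ ω, ‖∫ z, K j z * u (θ z ω)‖ₑ ^ 2 ∂P ≤ M * ∫⁻ ω, ‖u ω‖ₑ ^ 2 ∂P := by
  set A := ∑ j ∈ s, ∫⁻ ω, ‖∫ z, K j z * u (θ z ω)‖ₑ ^ 2 ∂P with hA
  set B := ∫⁻ ω, ‖u ω‖ₑ ^ 2 ∂P with hB
  have hum : Measurable fun ω => ‖u ω‖ₑ ^ 2 := hu.enorm.pow_const 2
  have hKi : ∀ j ∈ s, Integrable (K j) := by
    intro j hj
    obtain ⟨C, hC⟩ := hKb j hj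
    have h1 : IntegrableOn (K j) (Metric.closedBall 0 ρ) := by
      refine Measure.integrableOn_of_bounded (M := C) ?_ (hK j hj).aestronglyMeasurable ?_
      · exact (isCompact_closedBall _ _).measure_lt_top.ne
      · exact Eventually.of_forall hC
    refine (integrableOn_iff_integrable_of_support_subset ?_).1 h1
    intro x hx
    rw [mem_closedBall_zero_iff]
    by_contra h
    exact hx (hKs j hj x (not_le.1 h))
  have havm : ∀ j ∈ s, Measurable fun ω => ‖∫ z, K j z * u (θ z ω)‖ₑ ^ 2 := by
    intro j hj
    have : StronglyMeasurable fun p : Ω × Plane => K j p.2 * u (θ p.2 p.1) :=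
      (((hK j hj).comp measurable_snd).mul
        (hθ.measurable_comp hu measurable_snd measurable_fst)).stronglyMeasurable
    exact (StronglyMeasurable.integral_prod_right' this).measurable.enorm.pow_const 2
  -- Orbits restricted to the disk of radius `T + ρ` determine the averages over the disk of radius
  -- `T`; the ratio of the two areas tends to `1`.
  have key : ∀ T : ℝ, 0 < T → ENNReal.ofReal (Real.pi * T ^ 2) * A ≤
      M * (ENNReal.ofReal (Real.pi * (T + ρ) ^ 2) * B) := by
    intro T hT
    rw [← volume_closedBall_plane (0 : Plane) hT.le,
      ← volume_closedBall_plane (0 : Plane) (by positivity : 0 ≤ T + ρ)]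
    have h1 : volume (Metric.closedBall (0 : Plane) T) * A =
        ∫⁻ ω, (∑ j ∈ s, ∫⁻ x in Metric.closedBall (0 : Plane) T,
          ‖∫ z, K j z * u (θ z (θ x ω))‖ₑ ^ 2) ∂P := by
      rw [lintegral_finsetSum, hA, Finset.mul_sum]
      · refine Finset.sum_congr rfl fun j hj => ?_
        have := hθ.lintegral_lintegral_comp (havm j hj)
          (volume.restrict (Metric.closedBall (0 : Plane) T))
        rw [Measure.restrict_apply_univ] at this
        exact this.symm
      · intro j hj
        exact Measurable.lintegral_prod_right'
          (f := fun p : Ω × Plane => ‖∫ z, K j z * u (θ z (θ p.2 p.1))‖ₑ ^ 2)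
          (hθ.measurable_comp (havm j hj) measurable_snd measurable_fst)
    rw [h1]
    have h2 := hθ.lintegral_lintegral_comp hum
      (volume.restrict (Metric.closedBall (0 : Plane) (T + ρ)))
    rw [Measure.restrict_apply_univ] at h2
    rw [← h2, ← lintegral_const_mul]
    · refine lintegral_mono_ae ?_
      filter_upwards [hθ.ae_lintegral_closedBall_lt_top hum hu2] with ω hω
      set g : Plane → ℝ := (Metric.closedBall (0 : Plane) (T + ρ)).indicator fun y => u (θ y ω)
        with hg
      have hgm : Measurable g :=
        (hθ.measurable_comp hu measurable_id measurable_const).indicator measurableSet_closedBall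
      have hgsq : ∫⁻ y, ‖g y‖ₑ ^ 2 = ∫⁻ y in Metric.closedBall 0 (T + ρ), ‖u (θ y ω)‖ₑ ^ 2 := by
        rw [← lintegral_indicator measurableSet_closedBall]
        refine lintegral_congr fun y => ?_
        rw [hg]
        by_cases hy : y ∈ Metric.closedBall (0 : Plane) (T + ρ)
        · simp only [Set.indicator_of_mem hy]
        · simp only [Set.indicator_of_notMem hy]; simp
      have hg2 : MemLp g 2 := by
        refine ⟨hgm.aestronglyMeasurable, ?_⟩
        rw [eLpNorm_eq_lintegral_rpow_enorm_toReal (by norm_num) (by norm_num)]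
        simp only [ENNReal.toReal_ofNat, ENNReal.rpow_ofNat, hgsq]
        exact ENNReal.rpow_lt_top_of_nonneg (by norm_num) (hω _).ne
      have hg1 : Integrable g := by
        have h3 : MemLp g 2 (volume.restrict (Metric.closedBall (0 : Plane) (T + ρ))) :=
          hg2.restrict _
        have : IsFiniteMeasure (volume.restrict (Metric.closedBall (0 : Plane) (T + ρ))) :=
          ⟨by rw [Measure.restrict_apply_univ]; exact (isCompact_closedBall _ _).measure_lt_top⟩
        refine (integrableOn_iff_integrable_of_support_subset ?_).1 (h3.integrable (by norm_num))
        exact Set.support_indicator_subset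
      rw [← hgsq]
      refine le_trans ?_ (sum_lintegral_correlation_sq_le s K hKi hKb M hM hg1 hg2)
      refine Finset.sum_le_sum fun j hj => ?_
      rw [← lintegral_indicator measurableSet_closedBall]
      refine lintegral_mono fun x => ?_
      by_cases hx : x ∈ Metric.closedBall (0 : Plane) T
      · rw [Set.indicator_of_mem hx]
        refine le_of_eq ?_
        congr 2
        refine integral_congr_ae (Eventually.of_forall fun z => ?_)
        simp only
        by_cases hz : ρ < ‖z‖
        · rw [hKs j hj z hz, zero_mul, zero_mul]
        · rw [hg, Set.indicator_of_mem, hθ.add, add_comm x z]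
          rw [mem_closedBall_zero_iff] at hx ⊢
          exact (norm_add_le _ _).trans (add_le_add hx (not_lt.1 hz))
      · rw [Set.indicator_of_notMem hx]
        exact zero_le
    · exact Measurable.lintegral_prod_right' (f := fun p : Ω × Plane => ‖u (θ p.2 p.1)‖ₑ ^ 2)
        (hθ.measurable_comp hum measurable_snd measurable_fst)
  have key2 : ∀ T : ℝ, 0 < T → A ≤ ENNReal.ofReal ((1 + ρ / T) ^ 2) * (M * B) := by
    intro T hT
    have h0 : ENNReal.ofReal (Real.pi * T ^ 2) ≠ 0 := by
      have : 0 < Real.pi * T ^ 2 := by positivity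
      simp [this]
    rw [← ENNReal.mul_le_mul_iff_right h0 ENNReal.ofReal_ne_top]
    refine (key T hT).trans (le_of_eq ?_)
    rw [← mul_assoc, mul_comm M, mul_assoc, ← mul_assoc (ENNReal.ofReal (Real.pi * T ^ 2)),
      ← ENNReal.ofReal_mul (by positivity)]
    congr 2
    field_simp
  have hlim : Tendsto (fun T : ℝ => ENNReal.ofReal ((1 + ρ / T) ^ 2) * (M * B)) atTop
      (𝓝 (ENNReal.ofReal ((1 + 0) ^ 2) * (M * B))) := by
    refine ENNReal.Tendsto.mul_const ?_ (Or.inl (by simp))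
    refine ENNReal.tendsto_ofReal ?_
    exact (tendsto_const_nhds.add (tendsto_const_nhds.div_atTop tendsto_id)).pow 2
  simp only [add_zero, one_pow, ENNReal.ofReal_one, one_mul] at hlim
  exact ge_of_tendsto hlim ((eventually_gt_atTop 0).mono key2)

end IsStationaryFlow

/-! ### Displaced Lebesgue measure -/

/-- The image of Lebesgue measure under the random map `y ↦ y + τ (θ y ω)`, which moves the mass
at `y` by the displacement `τ` read off from the environment seen from `y`. -/
noncomputable def displacedLebesgue {Ω : Type*} (θ : Plane → Ω → Ω) (τ : Ω → Plane) (ω : Ω) :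
    Measure Plane :=
  volume.map fun y => y + τ (θ y ω)

namespace IsStationaryFlow

variable {Ω : Type*} [MeasurableSpace Ω] {θ : Plane → Ω → Ω} {P : Measure Ω} {τ : Ω → Plane}

theorem measurable_displacement (hθ : IsStationaryFlow θ P) (hτ : Measurable τ) :
    Measurable fun p : Ω × Plane => p.2 + τ (θ p.2 p.1) :=
  measurable_snd.add (hθ.measurable_comp hτ measurable_snd measurable_fst)

theorem measurable_displacement_right (hθ : IsStationaryFlow θ P) (hτ : Measurable τ) (ω : Ω) :
    Measurable fun y => y + τ (θ y ω) :=
  (hθ.measurable_displacement hτ).comp (measurable_const.prodMk measurable_id)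

theorem lintegral_displacedLebesgue (hθ : IsStationaryFlow θ P) (hτ : Measurable τ) (ω : Ω)
    {f : Plane → ℝ≥0∞} (hf : Measurable f) :
    ∫⁻ z, f z ∂displacedLebesgue θ τ ω = ∫⁻ y, f (y + τ (θ y ω)) :=
  lintegral_map hf (hθ.measurable_displacement_right hτ ω)

theorem integral_displacedLebesgue (hθ : IsStationaryFlow θ P) (hτ : Measurable τ) (ω : Ω)
    {f : Plane → ℝ} (hf : Measurable f) :
    ∫ z, f z ∂displacedLebesgue θ τ ω = ∫ y, f (y + τ (θ y ω)) :=
  integral_map (hθ.measurable_displacement_right hτ ω).aemeasurable hf.aestronglyMeasurable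

theorem measurable_displacedLebesgue (hθ : IsStationaryFlow θ P) (hτ : Measurable τ) :
    Measurable (displacedLebesgue θ τ) := by
  refine Measure.measurable_of_measurable_coe _ fun B hB => ?_
  have : ∀ ω, displacedLebesgue θ τ ω B = ∫⁻ y, B.indicator 1 (y + τ (θ y ω)) := by
    intro ω
    rw [← lintegral_indicator_one hB,
      hθ.lintegral_displacedLebesgue hτ ω (measurable_one.indicator hB)]
  simp_rw [this]
  exact Measurable.lintegral_prod_right'
    (f := fun p : Ω × Plane => B.indicator (1 : Plane → ℝ≥0∞) (p.2 + τ (θ p.2 p.1)))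
    ((measurable_one.indicator hB).comp (hθ.measurable_displacement hτ))

/-- Following the flow translates the displaced Lebesgue measure. -/
theorem displacedLebesgue_comp (hθ : IsStationaryFlow θ P) (hτ : Measurable τ) (u : Plane) (ω : Ω) :
    displacedLebesgue θ τ (θ u ω) = (displacedLebesgue θ τ ω).map fun z => z - u := by
  rw [displacedLebesgue, displacedLebesgue, Measure.map_map (measurable_sub_const u)
    (hθ.measurable_displacement_right hτ ω)]
  rw [← map_add_right_eq_self (volume : Measure Plane) (-u), Measure.map_map
    (hθ.measurable_displacement_right hτ _) (measurable_add_const _),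
    map_add_right_eq_self (volume : Measure Plane) (-u)]
  congr 1
  ext1 y
  simp only [Function.comp, hθ.add, neg_add_cancel_right]
  abel

/-- The intensity measure is Lebesgue measure. -/
theorem lintegral_lintegral_displacedLebesgue [IsProbabilityMeasure P] (hθ : IsStationaryFlow θ P)
    (hτ : Measurable τ) {f : Plane → ℝ≥0∞} (hf : Measurable f) :
    ∫⁻ ω, ∫⁻ z, f z ∂displacedLebesgue θ τ ω ∂P = ∫⁻ z, f z := by
  simp_rw [hθ.lintegral_displacedLebesgue hτ _ hf]
  rw [lintegral_lintegral_swap]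
  · have : ∀ y, ∫⁻ ω, f (y + τ (θ y ω)) ∂P = ∫⁻ ω, f (y + τ ω) ∂P := fun y =>
      hθ.lintegral_comp (f := fun ω => f (y + τ ω)) (hf.comp (measurable_const.add hτ)) y
    simp_rw [this]
    rw [lintegral_lintegral_swap]
    · simp_rw [lintegral_add_right_eq_self f]
      simp
    · exact (hf.comp (measurable_fst.add (hτ.comp measurable_snd))).aemeasurable
  · exact (hf.comp (hθ.measurable_displacement hτ)).aemeasurable

theorem lintegral_displacedLebesgue_apply [IsProbabilityMeasure P] (hθ : IsStationaryFlow θ P)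
    (hτ : Measurable τ) {B : Set Plane} (hB : MeasurableSet B) :
    ∫⁻ ω, displacedLebesgue θ τ ω B ∂P = volume B := by
  have := hθ.lintegral_lintegral_displacedLebesgue hτ (measurable_one.indicator hB)
  simpa only [lintegral_indicator_one hB] using this

theorem ae_displacedLebesgue_closedBall_lt_top [IsProbabilityMeasure P]
    (hθ : IsStationaryFlow θ P) (hτ : Measurable τ) :
    ∀ᵐ ω ∂P, ∀ r : ℝ, displacedLebesgue θ τ ω (Metric.closedBall 0 r) < ∞ := by
  have h : ∀ n : ℕ, ∀ᵐ ω ∂P, displacedLebesgue θ τ ω (Metric.closedBall 0 (n : ℝ)) < ∞ := by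
    intro n
    refine ae_lt_top ?_ ?_
    · exact (Measure.measurable_coe measurableSet_closedBall).comp
        (hθ.measurable_displacedLebesgue hτ)
    · rw [hθ.lintegral_displacedLebesgue_apply hτ measurableSet_closedBall]
      exact (isCompact_closedBall _ _).measure_lt_top.ne
  filter_upwards [ae_all_iff.2 h] with ω hω r
  obtain ⟨n, hn⟩ := exists_nat_ge r
  exact (measure_mono (Metric.closedBall_subset_closedBall hn)).trans_lt (hω n)

theorem ae_isLocallyFiniteMeasure_displacedLebesgue [IsProbabilityMeasure P]
    (hθ : IsStationaryFlow θ P) (hτ : Measurable τ) :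
    ∀ᵐ ω ∂P, IsLocallyFiniteMeasure (displacedLebesgue θ τ ω) := by
  filter_upwards [hθ.ae_displacedLebesgue_closedBall_lt_top hτ] with ω hω
  refine ⟨fun x => ⟨Metric.closedBall 0 (‖x‖ + 1), ?_, hω _⟩⟩
  refine mem_of_superset (Metric.ball_mem_nhds x one_pos) fun y hy => ?_
  rw [mem_closedBall_zero_iff]
  rw [mem_ball_iff_norm] at hy
  have := norm_sub_norm_le y x
  linarith

theorem lintegral_inv_weight_lt_top {α : ℝ} (hα : 0 < α) :
    ∫⁻ y : Plane, (ENNReal.ofReal ((1 + ‖y‖) ^ (2 + α)))⁻¹ < ∞ := by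
  have h := finite_integral_one_add_norm (E := Plane) (μ := volume) (r := 2 + α)
    (by rw [finrank_euclideanSpace_fin]; norm_num [hα])
  convert h using 3 with y
  rw [Real.rpow_neg (by positivity), ENNReal.ofReal_inv_of_pos (by positivity)]

/-- Finiteness of the second moment of the mass of the unit disk, by a Cauchy-Schwarz inequality
with weight `(1 + ‖y‖) ^ (2 + α)`: a mass starting from `y` and reaching the disk has displacement
at least `‖y‖ - 1`. -/
theorem lintegral_displacedLebesgue_sq_lt_top [IsProbabilityMeasure P] (hθ : IsStationaryFlow θ P)
    (hτ : Measurable τ) {α : ℝ} (hα : 0 < α)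
    (hm : ∫⁻ ω, ENNReal.ofReal ((1 + ‖τ ω‖) ^ (2 + α)) ∂P < ∞) :
    ∫⁻ ω, displacedLebesgue θ τ ω (Metric.closedBall 0 1) ^ 2 ∂P < ∞ := by
  set B := Metric.closedBall (0 : Plane) 1 with hB
  have hBm : MeasurableSet B := measurableSet_closedBall
  set w : Plane → ℝ≥0∞ := fun y => ENNReal.ofReal ((1 + ‖y‖) ^ (2 + α)) with hw
  have hwm : Measurable w := by fun_prop
  have hBi : Measurable (B.indicator (1 : Plane → ℝ≥0∞)) := measurable_one.indicator hBm
  set C := ∫⁻ y : Plane, (w y)⁻¹ with hC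
  have hCtop : C < ∞ := lintegral_inv_weight_lt_top hα
  have hpt : ∀ ω, displacedLebesgue θ τ ω B ^ 2 ≤
      C * ∫⁻ y, w y * B.indicator 1 (y + τ (θ y ω)) := by
    intro ω
    rw [← lintegral_indicator_one hBm, hθ.lintegral_displacedLebesgue hτ ω hBi]
    refine (sq_lintegral_le_weighted hwm.aemeasurable
      (hBi.comp (hθ.measurable_displacement_right hτ ω)).aemeasurable (fun y => ?_)
      (fun y => ENNReal.ofReal_ne_top)).trans (le_of_eq ?_)
    · have : (0 : ℝ) < (1 + ‖y‖) ^ (2 + α) := by positivity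
      simp [hw, this]
    · congr 1
      refine lintegral_congr fun y => ?_
      congr 1
      by_cases h : y + τ (θ y ω) ∈ B
      · simp only [Function.comp, Set.indicator_of_mem h, Pi.one_apply, one_pow]
      · simp only [Function.comp, Set.indicator_of_notMem h]; simp
  have hbound : ∫⁻ ω, (∫⁻ y, w y * B.indicator 1 (y + τ (θ y ω))) ∂P ≤
      ENNReal.ofReal (2 ^ (2 + α)) * volume B *
        ∫⁻ ω, ENNReal.ofReal ((1 + ‖τ ω‖) ^ (2 + α)) ∂P := by
    rw [lintegral_lintegral_swap]
    · have h1 : ∀ y, ∫⁻ ω, w y * B.indicator 1 (y + τ (θ y ω)) ∂P =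
          ∫⁻ ω, w y * B.indicator 1 (y + τ ω) ∂P := fun y =>
        hθ.lintegral_comp (f := fun ω => w y * B.indicator 1 (y + τ ω))
          ((hBi.comp (measurable_const.add hτ)).const_mul _) y
      simp_rw [h1]
      rw [lintegral_lintegral_swap, ← lintegral_const_mul]
      · refine lintegral_mono fun ω => ?_
        calc ∫⁻ y, w y * B.indicator 1 (y + τ ω)
            ≤ ∫⁻ y, ENNReal.ofReal ((2 * (1 + ‖τ ω‖)) ^ (2 + α)) * B.indicator 1 (y + τ ω) := by
              refine lintegral_mono fun y => ?_
              by_cases h : y + τ ω ∈ B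
              · refine mul_le_mul_left (ENNReal.ofReal_le_ofReal ?_) _
                rw [hB, mem_closedBall_zero_iff] at h
                refine Real.rpow_le_rpow (by positivity) ?_ (by linarith)
                have : ‖y‖ ≤ ‖y + τ ω‖ + ‖τ ω‖ := by
                  simpa using norm_sub_le (y + τ ω) (τ ω)
                linarith [norm_nonneg (τ ω)]
              · rw [Set.indicator_of_notMem h]; simp
          _ = _ := by
              rw [lintegral_const_mul' _ _ ENNReal.ofReal_ne_top,
                lintegral_add_right_eq_self (B.indicator (1 : Plane → ℝ≥0∞)),
                lintegral_indicator_one hBm, Real.mul_rpow (by norm_num) (by positivity),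
                ENNReal.ofReal_mul (by positivity)]
              ring
      · fun_prop
      · exact ((hwm.comp measurable_fst).mul
          (hBi.comp (measurable_fst.add (hτ.comp measurable_snd)))).aemeasurable
    · exact ((hwm.comp measurable_snd).mul
          (hBi.comp (hθ.measurable_displacement hτ))).aemeasurable
  calc ∫⁻ ω, displacedLebesgue θ τ ω B ^ 2 ∂P
      ≤ ∫⁻ ω, (C * ∫⁻ y, w y * B.indicator 1 (y + τ (θ y ω))) ∂P := lintegral_mono hpt
    _ = C * ∫⁻ ω, (∫⁻ y, w y * B.indicator 1 (y + τ (θ y ω))) ∂P :=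
        lintegral_const_mul' _ _ hCtop.ne
    _ ≤ C * (ENNReal.ofReal (2 ^ (2 + α)) * volume B *
        ∫⁻ ω, ENNReal.ofReal ((1 + ‖τ ω‖) ^ (2 + α)) ∂P) := by gcongr
    _ < ∞ := by
      refine ENNReal.mul_lt_top hCtop (ENNReal.mul_lt_top (ENNReal.mul_lt_top ?_ ?_) hm)
      · exact ENNReal.ofReal_lt_top
      · exact (isCompact_closedBall _ _).measure_lt_top

end IsStationaryFlow

/-! ### Smeared charges -/

theorem continuous_circle : Continuous fun t : ℝ => (!₂[Real.cos t, Real.sin t] : Plane) := by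
  refine (PiLp.continuous_toLp 2 _).comp (continuous_pi fun i => ?_)
  fin_cases i
  · exact Real.continuous_cos
  · exact Real.continuous_sin

theorem norm_circle (t : ℝ) : ‖(!₂[Real.cos t, Real.sin t] : Plane)‖ = 1 := by
  rw [← sq_eq_sq₀ (norm_nonneg _) zero_le_one, norm_sq_plane]
  simp

theorem integrable_translate_prod {β : Type*} [MeasurableSpace β] {ν : Measure β}
    [IsFiniteMeasure ν] {f : Plane → ℝ} (hf : Integrable f) (hfm : Measurable f) {c : β → Plane}
    (hc : Measurable c) :
    Integrable (fun p : Plane × β => f (p.1 + c p.2)) (volume.prod ν) := by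
  have hm : Measurable fun p : Plane × β => f (p.1 + c p.2) :=
    hfm.comp (measurable_fst.add (hc.comp measurable_snd))
  rw [integrable_prod_iff' hm.aestronglyMeasurable]
  refine ⟨Eventually.of_forall fun b => hf.comp_add_right (c b), ?_⟩
  have : ∀ b, ∫ x, ‖f (x + c b)‖ = ∫ x, ‖f x‖ := fun b =>
    integral_add_right_eq_self (fun x => ‖f x‖) (c b)
  simp_rw [this]
  exact integrable_const _

theorem smearedCharge_eq (η : ℝ) (φ : Plane → ℝ) (z : Plane) :
    smearedCharge η φ z = (2 * Real.pi)⁻¹ *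
      ∫ t in Set.Ioc (0 : ℝ) (2 * Real.pi), φ (z + η • !₂[Real.cos t, Real.sin t]) := by
  rw [smearedCharge, intervalIntegral.integral_of_le (by positivity)]

theorem continuous_smearedCharge (η : ℝ) {φ : Plane → ℝ} (hφ : Continuous φ) :
    Continuous (smearedCharge η φ) := by
  have hc := continuous_circle
  refine continuous_const.mul ?_
  exact intervalIntegral.continuous_parametric_intervalIntegral_of_continuous'
    (f := fun z t => φ (z + η • !₂[Real.cos t, Real.sin t])) (by
      simp only [Function.uncurry_def]
      fun_prop) 0 (2 * Real.pi)

theorem abs_smearedCharge_le {η C : ℝ} {φ : Plane → ℝ} {z : Plane}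
    (hC : ∀ x, ‖x - z‖ ≤ |η| → |φ x| ≤ C) : |smearedCharge η φ z| ≤ C := by
  have h : ‖∫ t in (0 : ℝ)..(2 * Real.pi), φ (z + η • !₂[Real.cos t, Real.sin t])‖ ≤
      C * |2 * Real.pi - 0| := by
    refine intervalIntegral.norm_integral_le_of_norm_le_const fun t _ => hC _ ?_
    rw [add_sub_cancel_left, norm_smul, norm_circle, mul_one, Real.norm_eq_abs]
  rw [sub_zero, abs_of_pos Real.two_pi_pos] at h
  rw [smearedCharge, abs_mul, abs_of_pos (inv_pos.2 Real.two_pi_pos)]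
  calc (2 * Real.pi)⁻¹ * _ ≤ (2 * Real.pi)⁻¹ * (C * (2 * Real.pi)) := by gcongr; exact h
    _ = C := by field_simp

theorem smearedCharge_eq_zero {η r : ℝ} {φ : Plane → ℝ} (hφ : ∀ x, r < ‖x‖ → φ x = 0) {z : Plane}
    (hz : r + |η| < ‖z‖) : smearedCharge η φ z = 0 := by
  have : |smearedCharge η φ z| ≤ 0 := by
    refine abs_smearedCharge_le fun x hx => ?_
    rw [hφ x, abs_zero]
    have := norm_sub_norm_le z x
    rw [norm_sub_rev] at this
    linarith
  exact abs_eq_zero.1 (le_antisymm this (abs_nonneg _))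

theorem exists_radius_of_hasCompactSupport {E : Type*} [Zero E] {φ : Plane → E}
    (hφ : HasCompactSupport φ) : ∃ r : ℝ, 0 ≤ r ∧ ∀ x, r < ‖x‖ → φ x = 0 := by
  obtain ⟨r, hr⟩ := hφ.isCompact.isBounded.subset_closedBall 0
  refine ⟨max r 0, le_max_right _ _, fun x hx => ?_⟩
  by_contra h
  have := mem_closedBall_zero_iff.1 (hr (subset_tsupport _ h))
  exact absurd hx (not_lt.2 (this.trans (le_max_left _ _)))

theorem hasCompactSupport_of_radius {E : Type*} [Zero E] {φ : Plane → E} {r : ℝ}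
    (h : ∀ x, r < ‖x‖ → φ x = 0) : HasCompactSupport φ :=
  HasCompactSupport.intro (isCompact_closedBall (0 : Plane) r) fun x hx => h x (by
    rwa [mem_closedBall_zero_iff, not_le] at hx)

theorem hasCompactSupport_smearedCharge (η : ℝ) {φ : Plane → ℝ} (hφ : HasCompactSupport φ) :
    HasCompactSupport (smearedCharge η φ) := by
  obtain ⟨r, -, hr⟩ := exists_radius_of_hasCompactSupport hφ
  exact hasCompactSupport_of_radius fun x hx => smearedCharge_eq_zero hr hx

/-- Smearing against a bounded kernel can be moved from one factor of a convolution to the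
other. -/
theorem smearedCharge_convolution (η : ℝ) {H φ : Plane → ℝ} (hH : Measurable H) {C : ℝ}
    (hHC : ∀ x, |H x| ≤ C) (hφ : Integrable φ) (hφm : Measurable φ) (q : Plane) :
    smearedCharge η (fun y => ∫ z, H (y - z) * φ z) q = ∫ z, H (q - z) * smearedCharge η φ z := by
  have hc := continuous_circle
  set c : ℝ → Plane := fun t => η • !₂[Real.cos t, Real.sin t] with hcd
  have hcc : Measurable c := (hc.const_smul η).measurable
  have h1 : ∀ t, ∫ z, H (q + c t - z) * φ z = ∫ z, H (q - z) * φ (z + c t) := by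
    intro t
    rw [← integral_add_right_eq_self (fun z => H (q + c t - z) * φ z) (c t)]
    refine integral_congr_ae (Eventually.of_forall fun z => ?_)
    simp only
    congr 2
    abel
  rw [smearedCharge_eq]
  change (2 * Real.pi)⁻¹ * ∫ t in Set.Ioc (0 : ℝ) (2 * Real.pi), ∫ z, H (q + c t - z) * φ z = _
  simp_rw [h1]
  rw [integral_integral_swap]
  · rw [← integral_const_mul]
    refine integral_congr_ae (Eventually.of_forall fun z => ?_)
    simp only
    rw [integral_const_mul, smearedCharge_eq]
    ring
  · have h2 := integrable_translate_prod (ν := volume.restrict (Set.Ioc (0 : ℝ) (2 * Real.pi)))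
      hφ hφm hcc
    have h3 : Integrable (fun p : Plane × ℝ => H (q - p.1) * φ (p.1 + c p.2))
        (volume.prod (volume.restrict (Set.Ioc (0 : ℝ) (2 * Real.pi)))) := by
      refine h2.bdd_mul (c := C) ?_ (Eventually.of_forall fun p => hHC _)
      exact (hH.comp (measurable_const.sub measurable_fst)).aestronglyMeasurable
    exact h3.swap

theorem integral_smearedCharge (η : ℝ) {φ : Plane → ℝ} (hφ : Integrable φ) (hφm : Measurable φ) :
    ∫ z, smearedCharge η φ z = ∫ z, φ z := by
  have := smearedCharge_convolution η (H := fun _ => 1) measurable_const (C := 1)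
    (by simp) hφ hφm 0
  simp only [one_mul] at this
  rw [← this, smearedCharge_eq]
  simp only [setIntegral_const, Real.volume_real_Ioc_of_le Real.two_pi_pos.le, sub_zero,
    smul_eq_mul]
  field_simp

theorem inner_gradient_eq_fderiv (φ : Plane → ℝ) (x v : Plane) :
    inner ℝ (gradient φ x) v = fderiv ℝ φ x v := by
  rw [← toDual_gradient, InnerProductSpace.toDual_apply_apply]

theorem continuous_gradient {φ : Plane → ℝ} (hφ : ContDiff ℝ (⊤ : ℕ∞) φ) :
    Continuous (gradient φ) :=
  (InnerProductSpace.toDual ℝ Plane).symm.continuous.comp (hφ.continuous_fderiv (by simp))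

theorem hasCompactSupport_gradient {φ : Plane → ℝ} (hφ : HasCompactSupport φ) :
    HasCompactSupport (gradient φ) :=
  (hφ.fderiv ℝ).comp_left (g := (InnerProductSpace.toDual ℝ Plane).symm) (map_zero _)

/-! ### Observables smooth along the orbits -/

namespace IsStationaryFlow

variable {Ω : Type*} [MeasurableSpace Ω] {θ : Plane → Ω → Ω} {P : Measure Ω} {τ : Ω → Plane}

theorem integrable_comp (hθ : IsStationaryFlow θ P) {E : Type*} [NormedAddCommGroup E] {u : Ω → E}
    (hu : Integrable u P) (x : Plane) : Integrable (fun ω => u (θ x ω)) P :=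
  (hθ.measurePreserving x).integrable_comp_of_integrable hu

theorem integral_comp (hθ : IsStationaryFlow θ P) {E : Type*} [NormedAddCommGroup E]
    [NormedSpace ℝ E] {u : Ω → E} (hu : AEStronglyMeasurable u P) (x : Plane) :
    ∫ ω, u (θ x ω) ∂P = ∫ ω, u ω ∂P := by
  have h := (hθ.measurePreserving x).map_eq
  conv_rhs => rw [← h]
  rw [integral_map (hθ.measurePreserving x).measurable.aemeasurable (by rwa [h])]

theorem integrable_prod_comp_mul [IsProbabilityMeasure P] (hθ : IsStationaryFlow θ P) {u : Ω → ℝ}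
    (hu : Integrable u P) (hum : Measurable u) {k : Plane → ℝ} (hk : Integrable k)
    (hkm : Measurable k) :
    Integrable (fun p : Ω × Plane => u (θ p.2 p.1) * k p.2) (P.prod volume) := by
  have hm : Measurable fun p : Ω × Plane => u (θ p.2 p.1) * k p.2 :=
    (hθ.measurable_comp hum measurable_snd measurable_fst).mul (hkm.comp measurable_snd)
  rw [integrable_prod_iff' hm.aestronglyMeasurable]
  refine ⟨Eventually.of_forall fun z => (hθ.integrable_comp hu z).mul_const (k z), ?_⟩
  have : ∀ z, ∫ ω, ‖u (θ z ω) * k z‖ ∂P = (∫ ω, ‖u ω‖ ∂P) * ‖k z‖ := by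
    intro z
    simp_rw [norm_mul]
    rw [integral_mul_const, hθ.integral_comp (u := fun ω => ‖u ω‖) hu.norm.aestronglyMeasurable]
  simp_rw [this]
  exact hk.norm.const_mul _

end IsStationaryFlow

/-- A bounded random variable `ψ`, continuously differentiable along every orbit of the flow `θ`,
with bounded gradient `G` at the origin of the orbit. -/
structure IsSmoothObservable {Ω : Type*} [MeasurableSpace Ω] (θ : Plane → Ω → Ω) (ψ : Ω → ℝ)
    (G : Ω → Plane) : Prop where
  measurable : Measurable ψ
  measurable_gradient : Measurable G
  bounded : ∃ C : ℝ, ∀ ω, |ψ ω| ≤ C ∧ ‖G ω‖ ≤ C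
  isGradientField : ∀ ω, IsGradientField (fun y => ψ (θ y ω)) (fun y => G (θ y ω))

/-- The average of `h` along the orbits of `θ`, with weight `φ`. With the sign chosen here,
`y ↦ orbitAverage θ h φ (θ y ω)` is the convolution of `y ↦ h (θ y ω)` with `φ`. -/
noncomputable def orbitAverage {Ω E : Type*} [NormedAddCommGroup E] [NormedSpace ℝ E]
    (θ : Plane → Ω → Ω) (h : Ω → ℝ) (φ : Plane → E) (ω : Ω) : E :=
  ∫ z, h (θ (-z) ω) • φ z

theorem norm_orbitAverage_le {Ω : Type*} {θ : Plane → Ω → Ω} {h : Ω → ℝ} (hh : ∀ ω, |h ω| ≤ 1)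
    {E : Type*} [NormedAddCommGroup E] [NormedSpace ℝ E] {φ : Plane → E} (hφ : Integrable φ)
    (ω : Ω) : ‖orbitAverage θ h φ ω‖ ≤ ∫ z, ‖φ z‖ := by
  refine norm_integral_le_of_norm_le hφ.norm (Eventually.of_forall fun z => ?_)
  rw [norm_smul]
  exact mul_le_of_le_one_left (norm_nonneg _) (hh _)

namespace IsStationaryFlow

variable {Ω : Type*} [MeasurableSpace Ω] {θ : Plane → Ω → Ω} {P : Measure Ω} {τ : Ω → Plane}

theorem orbitAverage_comp {E : Type*} [NormedAddCommGroup E] [NormedSpace ℝ E]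
    (hθ : IsStationaryFlow θ P) (h : Ω → ℝ) (φ : Plane → E) (y : Plane) (ω : Ω) :
    orbitAverage θ h φ (θ y ω) = ∫ z, h (θ (y - z) ω) • φ z := by
  simp only [orbitAverage, hθ.add, neg_add_eq_sub]

theorem measurable_orbitAverage (hθ : IsStationaryFlow θ P) {h : Ω → ℝ} (hh : Measurable h)
    {E : Type*} [NormedAddCommGroup E] [NormedSpace ℝ E] [MeasurableSpace E] [BorelSpace E]
    [SecondCountableTopology E] {φ : Plane → E} (hφ : Continuous φ) :
    Measurable (orbitAverage θ h φ) := by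
  have : StronglyMeasurable fun p : Ω × Plane => h (θ (-p.2) p.1) • φ p.2 :=
    ((hθ.measurable_comp hh measurable_snd.neg measurable_fst).smul
      (hφ.measurable.comp measurable_snd)).stronglyMeasurable
  exact (StronglyMeasurable.integral_prod_right' this).measurable

theorem isSmoothObservable_orbitAverage (hθ : IsStationaryFlow θ P) {h : Ω → ℝ}
    (hh : Measurable h) (hh1 : ∀ ω, |h ω| ≤ 1) {φ : Plane → ℝ} (hφ : ContDiff ℝ (⊤ : ℕ∞) φ)
    (hφc : HasCompactSupport φ) :
    IsSmoothObservable θ (orbitAverage θ h φ) (orbitAverage θ h (gradient φ)) := by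
  have hgc := continuous_gradient hφ
  have hgs := hasCompactSupport_gradient hφc
  have hφi : Integrable φ := hφ.continuous.integrable_of_hasCompactSupport hφc
  have hgi : Integrable (gradient φ) := hgc.integrable_of_hasCompactSupport hgs
  refine ⟨hθ.measurable_orbitAverage hh hφ.continuous, hθ.measurable_orbitAverage hh hgc,
    ⟨max (∫ z, ‖φ z‖) (∫ z, ‖gradient φ z‖), fun ω => ⟨?_, ?_⟩⟩, fun ω => ?_⟩
  · exact (norm_orbitAverage_le hh1 hφi ω).trans (le_max_left _ _)
  · exact (norm_orbitAverage_le hh1 hgi ω).trans (le_max_right _ _)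
  set H : Plane → ℝ := fun y => h (θ y ω) with hH
  have hHm : Measurable H := hθ.measurable_comp hh measurable_id measurable_const
  have hHl : LocallyIntegrable H := by
    refine (locallyIntegrable_const (1 : ℝ)).mono hHm.aestronglyMeasurable ?_
    exact Eventually.of_forall fun y => by simpa using hh1 _
  have e1 : (fun y => orbitAverage θ h φ (θ y ω)) =
      MeasureTheory.convolution H φ (ContinuousLinearMap.lsmul ℝ ℝ) volume := by
    ext y
    rw [hθ.orbitAverage_comp, MeasureTheory.convolution_def, ← integral_sub_left_eq_self _ _ y]
    simp [hH]
  have e2 : (fun y => orbitAverage θ h (gradient φ) (θ y ω)) =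
      MeasureTheory.convolution H (gradient φ) (ContinuousLinearMap.lsmul ℝ ℝ) volume := by
    ext1 y
    rw [hθ.orbitAverage_comp, MeasureTheory.convolution_def, ← integral_sub_left_eq_self _ _ y]
    simp [hH]
  refine ⟨?_, fun x => ?_⟩
  · rw [e2]
    exact hgs.continuous_convolution_right _ hHl hgc
  · have hd := hφc.hasFDerivAt_convolution_right (ContinuousLinearMap.lsmul ℝ ℝ) hHl
      (hφ.of_le (by simp)) x
    rw [e1]
    convert! hd using 1
    ext v
    rw [innerSL_apply_apply, MeasureTheory.convolution_precompR_apply _ hHl (hφc.fderiv ℝ)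
      (hφ.continuous_fderiv (by simp)), hθ.orbitAverage_comp, MeasureTheory.convolution_def,
      ← integral_sub_left_eq_self _ _ x, real_inner_comm, ← integral_inner]
    · refine integral_congr_ae (Eventually.of_forall fun z => ?_)
      simp only [sub_sub_cancel, ContinuousLinearMap.lsmul_apply, smul_eq_mul, hH]
      rw [inner_smul_right, real_inner_comm, inner_gradient_eq_fderiv]
    · have h1 : Integrable (gradient φ) := hgi
      have h2 : AEStronglyMeasurable (fun z => H (x - z)) volume :=
        (hHm.comp (measurable_const.sub measurable_id)).aestronglyMeasurable
      have h3 := h1.bdd_smul (φ := fun z => H (x - z)) 1 h2 (Eventually.of_forall fun z => hh1 _)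
      exact h3.comp_sub_left x

/-- Duality between averaging along the orbits and integrating against the gradient of a test
function, by invariance of `P` under the flow. -/
theorem integral_inner_orbitAverage_gradient [IsProbabilityMeasure P]
    (hθ : IsStationaryFlow θ P) {h : Ω → ℝ} (hh : Measurable h) (hh1 : ∀ ω, |h ω| ≤ 1)
    {φ : Plane → ℝ} (hφ : ContDiff ℝ (⊤ : ℕ∞) φ) (hφc : HasCompactSupport φ) {e : Ω → Plane}
    (he : Measurable e) (hei : Integrable e P) :
    Integrable (fun ω => ∫ z, fderiv ℝ φ z (e (θ z ω))) P ∧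
    ∫ ω, inner ℝ (e ω) (orbitAverage θ h (gradient φ) ω) ∂P =
      ∫ ω, (h ω * ∫ z, fderiv ℝ φ z (e (θ z ω))) ∂P := by
  have hgc := continuous_gradient hφ
  have hgs := hasCompactSupport_gradient hφc
  have hgi : Integrable (gradient φ) := hgc.integrable_of_hasCompactSupport hgs
  have hem : Measurable fun p : Ω × Plane => e (θ p.2 p.1) :=
    hθ.measurable_comp he measurable_snd measurable_fst
  have hG : Measurable fun p : Ω × Plane => gradient φ p.2 := hgc.measurable.comp measurable_snd
  have hI2 : Integrable (fun p : Ω × Plane => fderiv ℝ φ p.2 (e (θ p.2 p.1)))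
      (P.prod volume) := by
    simp_rw [← inner_gradient_eq_fderiv]
    refine (hθ.integrable_prod_comp_mul hei.norm he.norm hgi.norm hgc.measurable.norm).mono' ?_ ?_
    · exact (hG.inner hem).aestronglyMeasurable
    · refine Eventually.of_forall fun p => ?_
      rw [mul_comm]
      exact norm_inner_le_norm _ _
  refine ⟨hI2.integral_prod_left, ?_⟩
  have hI3 : Integrable (fun p : Ω × Plane => h p.1 * fderiv ℝ φ p.2 (e (θ p.2 p.1)))
      (P.prod volume) := by
    refine hI2.bdd_mul (c := 1) (hh.comp measurable_fst).aestronglyMeasurable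
      (Eventually.of_forall fun p => hh1 _)
  have hI1 : Integrable (fun p : Ω × Plane => h (θ (-p.2) p.1) * inner ℝ (e p.1) (gradient φ p.2))
      (P.prod volume) := by
    refine Integrable.bdd_mul (c := 1) ?_ ?_ (Eventually.of_forall fun p => hh1 _)
    · refine (hei.norm.mul_prod hgi.norm).mono' ?_ ?_
      · exact ((he.comp measurable_fst).inner hG).aestronglyMeasurable
      · exact Eventually.of_forall fun p => norm_inner_le_norm _ _
    · exact (hθ.measurable_comp hh measurable_snd.neg measurable_fst).aestronglyMeasurable
  calc ∫ ω, inner ℝ (e ω) (orbitAverage θ h (gradient φ) ω) ∂P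
      = ∫ ω, (∫ z, h (θ (-z) ω) * inner ℝ (e ω) (gradient φ z)) ∂P := by
        refine integral_congr_ae (Eventually.of_forall fun ω => ?_)
        simp only [orbitAverage]
        rw [← integral_inner]
        · simp_rw [inner_smul_right]
        · refine hgi.bdd_smul (φ := fun z => h (θ (-z) ω)) 1 ?_
            (Eventually.of_forall fun z => hh1 _)
          exact (hθ.measurable_comp hh measurable_neg measurable_const).aestronglyMeasurable
    _ = ∫ z, (∫ ω, h (θ (-z) ω) * inner ℝ (e ω) (gradient φ z) ∂P) := integral_integral_swap hI1
    _ = ∫ z, (∫ ω, h ω * fderiv ℝ φ z (e (θ z ω)) ∂P) := by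
        refine integral_congr_ae (Eventually.of_forall fun z => ?_)
        simp only
        rw [← hθ.integral_comp _ z]
        · refine integral_congr_ae ?_
          filter_upwards [hθ.zero] with ω hω
          rw [hθ.add, neg_add_cancel, hω, real_inner_comm, inner_gradient_eq_fderiv]
        · exact ((hθ.measurable_comp hh measurable_const measurable_id).mul
            (he.inner measurable_const)).aestronglyMeasurable
    _ = ∫ ω, (∫ z, h ω * fderiv ℝ φ z (e (θ z ω))) ∂P := (integral_integral_swap hI3).symm
    _ = _ := by simp_rw [integral_const_mul]

end IsStationaryFlow

/-! ### The energy estimate -/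

/-- A linear form bounded by the norm of the image under a linear map `A` into a Hilbert space
is represented by a vector in the closure of the range of `A`. -/
theorem exists_mem_closure_range_of_le {V H : Type*} [AddCommGroup V] [Module ℝ V]
    [NormedAddCommGroup H] [InnerProductSpace ℝ H] [CompleteSpace H] (A : V →ₗ[ℝ] H)
    (l : V →ₗ[ℝ] ℝ) (C : ℝ) (h : ∀ v, |l v| ≤ C * ‖A v‖) :
    ∃ e ∈ (LinearMap.range A).topologicalClosure, ∀ v, inner ℝ e (A v) = l v := by
  have hker : LinearMap.ker A ≤ LinearMap.ker l := by
    intro v hv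
    have := h v
    rw [LinearMap.mem_ker.1 hv, norm_zero, mul_zero] at this
    exact abs_eq_zero.1 (le_antisymm this (abs_nonneg _))
  set f : LinearMap.range A →ₗ[ℝ] ℝ :=
    ((LinearMap.ker A).liftQ l hker).comp A.quotKerEquivRange.symm.toLinearMap with hf
  have hfA : ∀ v, f ⟨A v, LinearMap.mem_range_self A v⟩ = l v := by
    intro v
    have : A.quotKerEquivRange.symm ⟨A v, LinearMap.mem_range_self A v⟩ =
        (LinearMap.ker A).mkQ v := by
      rw [LinearEquiv.symm_apply_eq]
      rfl
    rw [hf, LinearMap.comp_apply, LinearEquiv.coe_coe, this]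
    simp
  have hfb : ∀ x, ‖f x‖ ≤ C * ‖x‖ := by
    rintro ⟨_, v, rfl⟩
    rw [hfA]
    exact h v
  obtain ⟨g, hg, -⟩ := exists_extension_norm_eq (LinearMap.range A) (f.mkContinuous C hfb)
  set K := (LinearMap.range A).topologicalClosure with hK
  have hKc : IsClosed (K : Set H) := Submodule.isClosed_topologicalClosure _
  have : CompleteSpace K := hKc.completeSpace_coe
  set e' := (InnerProductSpace.toDual ℝ H).symm g with he'
  refine ⟨K.starProjection e', Submodule.starProjection_apply_mem _ _, fun v => ?_⟩
  have hAv : A v ∈ K := Submodule.le_topologicalClosure _ (LinearMap.mem_range_self A v)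
  have h1 := K.starProjection_inner_eq_zero e' (A v) hAv
  rw [inner_sub_left, sub_eq_zero] at h1
  rw [← h1, he', InnerProductSpace.toDual_symm_apply, ← hfA]
  exact hg ⟨A v, LinearMap.mem_range_self A v⟩

/-- The logarithmic factor of the Poincaré inequality at radius `R = (1 + η) t` is bounded by a
multiple of `t ^ (α / 2)`. -/
theorem exists_log_sq_le {η α : ℝ} (hη : 0 < η) (hα : 0 < α) :
    ∃ C : ℝ, 0 ≤ C ∧ ∀ t : ℝ, 1 ≤ t →
      8 * Real.log (2 * ((1 + η) * t) / η) ^ 2 + 2 ≤ C * t ^ (α / 2) := by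
  set k : ℝ := 2 * (1 + η) / η with hk
  have hk1 : 1 ≤ k := by rw [hk, le_div_iff₀ hη]; linarith
  have hk0 : 0 < k := by linarith
  refine ⟨8 * (k ^ (α / 4) / (α / 4)) ^ 2 + 2, by positivity, fun t ht => ?_⟩
  have ht0 : 0 < t := by linarith
  have e : 2 * ((1 + η) * t) / η = k * t := by rw [hk]; ring
  have h1 : Real.log (k * t) ≤ (k * t) ^ (α / 4) / (α / 4) :=
    Real.log_le_rpow_div (by positivity) (by positivity)
  have h0 : 0 ≤ Real.log (k * t) := Real.log_nonneg (by nlinarith)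
  have h2 : (t ^ (α / 4)) ^ 2 = t ^ (α / 2) := by
    rw [← Real.rpow_natCast, ← Real.rpow_mul ht0.le]; congr 1; push_cast; ring
  have h3 : 1 ≤ t ^ (α / 2) := Real.one_le_rpow ht (by positivity)
  rw [e]
  calc 8 * Real.log (k * t) ^ 2 + 2 ≤ 8 * ((k * t) ^ (α / 4) / (α / 4)) ^ 2 + 2 := by gcongr
    _ = 8 * (k ^ (α / 4) / (α / 4)) ^ 2 * t ^ (α / 2) + 2 := by
        rw [Real.mul_rpow hk0.le ht0.le, ← h2]; ring
    _ ≤ _ := by nlinarith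

theorem smearedCharge_add {η : ℝ} {φ ψ : Plane → ℝ} (hφ : Continuous φ) (hψ : Continuous ψ)
    (z : Plane) :
    smearedCharge η (fun x => φ x + ψ x) z = smearedCharge η φ z + smearedCharge η ψ z := by
  have hc := continuous_circle
  rw [smearedCharge, smearedCharge, smearedCharge, ← mul_add, intervalIntegral.integral_add]
  · exact (Continuous.intervalIntegrable (by fun_prop) _ _)
  · exact (Continuous.intervalIntegrable (by fun_prop) _ _)

theorem smearedCharge_const_mul {η : ℝ} (c : ℝ) (φ : Plane → ℝ) (z : Plane) :
    smearedCharge η (fun x => c * φ x) z = c * smearedCharge η φ z := by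
  rw [smearedCharge, smearedCharge, intervalIntegral.integral_const_mul]
  ring

/-- The vector space of smooth observables, together with their gradients. -/
def smoothObservables {Ω : Type*} [MeasurableSpace Ω] (θ : Plane → Ω → Ω) :
    Submodule ℝ ((Ω → ℝ) × (Ω → Plane)) where
  carrier := {v | IsSmoothObservable θ v.1 v.2}
  zero_mem' := ⟨measurable_const, measurable_const, ⟨0, by simp⟩, fun ω =>
    ⟨continuous_const, fun x => by
      simpa using hasFDerivAt_const (0 : ℝ) x⟩⟩
  add_mem' := by
    rintro v w ⟨hv1, hv2, ⟨C, hC⟩, hv3⟩ ⟨hw1, hw2, ⟨D, hD⟩, hw3⟩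
    refine ⟨hv1.add hw1, hv2.add hw2, ⟨C + D, fun ω => ⟨?_, ?_⟩⟩, fun ω =>
      ⟨(hv3 ω).continuous.add (hw3 ω).continuous, fun x => ?_⟩⟩
    · exact (abs_add_le _ _).trans (add_le_add (hC ω).1 (hD ω).1)
    · exact (norm_add_le _ _).trans (add_le_add (hC ω).2 (hD ω).2)
    · have := ((hv3 ω).hasFDerivAt x).add ((hw3 ω).hasFDerivAt x)
      rw [← map_add] at this
      exact this
  smul_mem' := by
    rintro c v ⟨hv1, hv2, ⟨C, hC⟩, hv3⟩
    refine ⟨hv1.const_smul c, hv2.const_smul c, ⟨|c| * C, fun ω => ⟨?_, ?_⟩⟩, fun ω =>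
      ⟨(hv3 ω).continuous.const_smul c, fun x => ?_⟩⟩
    · simp only [Prod.smul_fst, Pi.smul_apply, smul_eq_mul, abs_mul]
      exact mul_le_mul_of_nonneg_left (hC ω).1 (abs_nonneg _)
    · simp only [Prod.smul_snd, Pi.smul_apply, norm_smul, Real.norm_eq_abs]
      exact mul_le_mul_of_nonneg_left (hC ω).2 (abs_nonneg _)
    · have := ((hv3 ω).hasFDerivAt x).const_smul c
      rw [← map_smul] at this
      exact this

namespace IsSmoothObservable

variable {Ω : Type*} [MeasurableSpace Ω] {θ : Plane → Ω → Ω} {P : Measure Ω} {τ : Ω → Plane}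
  {ψ : Ω → ℝ} {G : Ω → Plane}

theorem continuous (hψ : IsSmoothObservable θ ψ G) (ω : Ω) : Continuous fun y => ψ (θ y ω) :=
  (hψ.isGradientField ω).continuous_potential

theorem integrable_smearedCharge [IsProbabilityMeasure P] (hψ : IsSmoothObservable θ ψ G)
    (hθ : IsStationaryFlow θ P) (η : ℝ) {q : Ω → Plane} (hq : Measurable q) :
    Integrable (fun ω => smearedCharge η (fun y => ψ (θ y ω)) (q ω)) P := by
  obtain ⟨C, hC⟩ := hψ.bounded
  have hm : Measurable fun ω => smearedCharge η (fun y => ψ (θ y ω)) (q ω) := by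
    simp_rw [smearedCharge_eq]
    refine Measurable.const_mul ?_ _
    have : StronglyMeasurable fun p : Ω × ℝ =>
        ψ (θ (q p.1 + η • !₂[Real.cos p.2, Real.sin p.2]) p.1) := by
      refine (hθ.measurable_comp hψ.measurable ?_ measurable_fst).stronglyMeasurable
      exact (hq.comp measurable_fst).add
        ((continuous_circle.measurable.comp measurable_snd).const_smul η)
    exact (StronglyMeasurable.integral_prod_right' this).measurable
  refine Integrable.of_bound hm.aestronglyMeasurable C (Eventually.of_forall fun ω => ?_)
  exact abs_smearedCharge_le fun x _ => (hC _).1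

theorem memLp_gradient [IsProbabilityMeasure P] (hψ : IsSmoothObservable θ ψ G) : MemLp G 2 P := by
  obtain ⟨C, hC⟩ := hψ.bounded
  exact MemLp.of_bound hψ.measurable_gradient.aestronglyMeasurable C
    (Eventually.of_forall fun ω => (hC ω).2)

/-- The energy estimate: the mean potential difference between the displaced and the original
position of a charge is controlled by the `L²` norm of the field. The Dirichlet energy in a disk of
radius comparable to `t = 1 + ‖τ‖` is averaged over the environment with the weight `t ^ (2 + α)`:
the exponent `2` pays for the area of the disk, and half of `α` for the logarithm in the Poincaré
inequality. -/
theorem sq_lintegral_potential_difference_le [IsProbabilityMeasure P]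
    (hθ : IsStationaryFlow θ P) (hτ : Measurable τ) {α : ℝ} (hα : 0 < α)
    (hm : ∫⁻ ω, ENNReal.ofReal ((1 + ‖τ ω‖) ^ (2 + α)) ∂P < ∞) {η : ℝ} (hη : 0 < η) :
    ∃ K : ℝ≥0∞, K < ∞ ∧ ∀ ψ G, IsSmoothObservable θ ψ G →
      (∫⁻ ω, ‖smearedCharge η (fun y => ψ (θ y ω)) (τ ω) -
        smearedCharge η (fun y => ψ (θ y ω)) 0‖ₑ ∂P) ^ 2 ≤ K * ∫⁻ ω, ‖G ω‖ₑ ^ 2 ∂P := by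
  obtain ⟨C, hC0, hC⟩ := exists_log_sq_le hη hα
  -- `4 + 3 * η` is such that `1 + ‖y‖ ≤ (4 + 3 * η) * t` in the disk of radius `3 * R`.
  set D : ℝ := C * (4 + 3 * η) ^ (2 + α / 2) with hD
  have hD0 : 0 ≤ D := by positivity
  set w : Ω → ℝ≥0∞ := fun ω => ENNReal.ofReal ((1 + ‖τ ω‖) ^ (2 + α)) with hw
  have hwm : Measurable w := by fun_prop
  set v : Plane → ℝ≥0∞ := fun y => (ENNReal.ofReal ((1 + ‖y‖) ^ (2 + α / 2)))⁻¹ with hv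
  have hvm : Measurable v := by fun_prop
  have hvi : ∫⁻ y, v y < ∞ := IsStationaryFlow.lintegral_inv_weight_lt_top (by positivity)
  refine ⟨(∫⁻ ω, w ω ∂P) * (ENNReal.ofReal D * ∫⁻ y, v y),
    ENNReal.mul_lt_top hm (ENNReal.mul_lt_top ENNReal.ofReal_lt_top hvi), fun ψ G hψ => ?_⟩
  set Δ : Ω → ℝ≥0∞ := fun ω => ‖smearedCharge η (fun y => ψ (θ y ω)) (τ ω) -
        smearedCharge η (fun y => ψ (θ y ω)) 0‖ₑ with hΔ
  have hΔm : AEMeasurable Δ P :=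
    ((hψ.integrable_smearedCharge hθ η hτ).sub
      (hψ.integrable_smearedCharge hθ η measurable_const)).aestronglyMeasurable.enorm
  have hGm : Measurable fun ω => ‖G ω‖ₑ ^ 2 := hψ.measurable_gradient.enorm.pow_const 2
  have hpt : ∀ ω, (w ω)⁻¹ * Δ ω ^ 2 ≤ ENNReal.ofReal D * ∫⁻ y, v y * ‖G (θ y ω)‖ₑ ^ 2 := by
    intro ω
    set t := 1 + ‖τ ω‖ with ht
    have ht1 : 1 ≤ t := by rw [ht]; linarith [norm_nonneg (τ ω)]
    have ht0 : 0 < t := by linarith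
    set R := (1 + η) * t with hR
    have hηR : η ≤ R := by nlinarith
    have hτR : ‖τ ω‖ ≤ R := by nlinarith [norm_nonneg (τ ω)]
    have h1 := (hψ.isGradientField ω).enorm_smearedCharge_sub_sq_le hη hηR hτR
    have hlog : 0 ≤ Real.log (2 * R / η) := by
      refine Real.log_nonneg ?_
      rw [le_div_iff₀ hη]; linarith
    have h2 : 8 * ENNReal.ofReal (Real.log (2 * R / η)) ^ 2 + 2 ≤
        ENNReal.ofReal (C * t ^ (α / 2)) := by
      refine le_trans (le_of_eq ?_) (ENNReal.ofReal_le_ofReal (hC t ht1))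
      rw [ENNReal.ofReal_add (by positivity) (by norm_num), ENNReal.ofReal_mul (by norm_num),
        ENNReal.ofReal_pow hlog]
      norm_num
    have hGω : Measurable fun y => ‖G (θ y ω)‖ₑ ^ 2 :=
      hθ.measurable_comp hGm measurable_id measurable_const
    calc (w ω)⁻¹ * Δ ω ^ 2
        ≤ (w ω)⁻¹ * (ENNReal.ofReal (C * t ^ (α / 2)) *
            ∫⁻ y in Metric.closedBall 0 (3 * R), ‖G (θ y ω)‖ₑ ^ 2) := by
          gcongr
          exact h1.trans (by gcongr)
      _ = ∫⁻ y in Metric.closedBall 0 (3 * R), (w ω)⁻¹ * ENNReal.ofReal (C * t ^ (α / 2)) *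
            ‖G (θ y ω)‖ₑ ^ 2 := by
          rw [lintegral_const_mul _ hGω, mul_assoc]
      _ ≤ ∫⁻ y in Metric.closedBall 0 (3 * R), ENNReal.ofReal D * (v y * ‖G (θ y ω)‖ₑ ^ 2) := by
          refine setLIntegral_mono' measurableSet_closedBall fun y hy => ?_
          rw [← mul_assoc]
          refine mul_le_mul_left ?_ _
          rw [mem_closedBall_zero_iff] at hy
          simp only [hw, hv]
          rw [← ENNReal.ofReal_inv_of_pos (by positivity), ← ENNReal.ofReal_mul (by positivity),
            ← ENNReal.ofReal_inv_of_pos (by positivity), ← ENNReal.ofReal_mul hD0]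
          refine ENNReal.ofReal_le_ofReal ?_
          have h3 : t ^ (2 + α) = t ^ (2 + α / 2) * t ^ (α / 2) := by
            rw [← Real.rpow_add ht0]; congr 1; ring
          have h4 : (1 + ‖y‖) ^ (2 + α / 2) ≤ (4 + 3 * η) ^ (2 + α / 2) * t ^ (2 + α / 2) := by
            rw [← Real.mul_rpow (by positivity) ht0.le]
            refine Real.rpow_le_rpow (by positivity) ?_ (by positivity)
            nlinarith
          have p1 : 0 < t ^ (2 + α / 2) := by positivity
          have p2 : 0 < t ^ (α / 2) := by positivity
          have p3 : 0 < (1 + ‖y‖) ^ (2 + α / 2) := by positivity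
          rw [h3, hD]
          have : (t ^ (2 + α / 2) * t ^ (α / 2))⁻¹ * (C * t ^ (α / 2)) =
              C / t ^ (2 + α / 2) := by field_simp
          rw [this, ← div_eq_mul_inv, div_le_div_iff₀ p1 p3]
          calc C * (1 + ‖y‖) ^ (2 + α / 2)
              ≤ C * ((4 + 3 * η) ^ (2 + α / 2) * t ^ (2 + α / 2)) := by gcongr
            _ = _ := by ring
      _ ≤ ∫⁻ y, ENNReal.ofReal D * (v y * ‖G (θ y ω)‖ₑ ^ 2) := setLIntegral_le_lintegral _ _
      _ = _ := lintegral_const_mul _ (hvm.mul hGω)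
  calc (∫⁻ ω, Δ ω ∂P) ^ 2
      ≤ (∫⁻ ω, ((w ω)⁻¹)⁻¹ ∂P) * ∫⁻ ω, (w ω)⁻¹ * Δ ω ^ 2 ∂P := by
        refine sq_lintegral_le_weighted hwm.inv.aemeasurable hΔm (fun ω => ?_) (fun ω => ?_)
        · simp [hw]
        · have : 0 < (1 + ‖τ ω‖) ^ (2 + α) := by positivity
          simp [hw, this]
    _ ≤ (∫⁻ ω, w ω ∂P) * ∫⁻ ω, (ENNReal.ofReal D * ∫⁻ y, v y * ‖G (θ y ω)‖ₑ ^ 2) ∂P := by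
        simp only [inv_inv]
        exact mul_le_mul_right (lintegral_mono hpt) _
    _ = (∫⁻ ω, w ω ∂P) * (ENNReal.ofReal D * ((∫⁻ y, v y) * ∫⁻ ω, ‖G ω‖ₑ ^ 2 ∂P)) := by
        rw [lintegral_const_mul' _ _ ENNReal.ofReal_ne_top, lintegral_lintegral_swap]
        · congr 2
          have : ∀ y, ∫⁻ ω, v y * ‖G (θ y ω)‖ₑ ^ 2 ∂P = v y * ∫⁻ ω, ‖G ω‖ₑ ^ 2 ∂P := by
            intro y
            have hGy : Measurable fun ω => ‖G (θ y ω)‖ₑ ^ 2 :=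
              hθ.measurable_comp hGm measurable_const measurable_id
            rw [lintegral_const_mul _ hGy, hθ.lintegral_comp hGm]
          simp_rw [this]
          rw [lintegral_mul_const _ hvm]
        · exact ((hvm.comp measurable_snd).mul
            (hθ.measurable_comp hGm measurable_snd measurable_fst)).aemeasurable
    _ = _ := by ring

end IsSmoothObservable

/-! ### The stationary field -/

theorem continuous_quarterTurn : Continuous quarterTurn := by
  refine (PiLp.continuous_toLp 2 _).comp (continuous_pi fun i => ?_)
  fin_cases i
  · exact (EuclideanSpace.proj (𝕜 := ℝ) (1 : Fin 2)).continuous.neg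
  · exact (EuclideanSpace.proj (𝕜 := ℝ) (0 : Fin 2)).continuous

theorem norm_quarterTurn (v : Plane) : ‖quarterTurn v‖ = ‖v‖ := by
  rw [← sq_eq_sq₀ (norm_nonneg _) (norm_nonneg _), EuclideanSpace.norm_sq_eq,
    EuclideanSpace.norm_sq_eq, Fin.sum_univ_two, Fin.sum_univ_two]
  simp [quarterTurn, add_comm]

theorem inner_quarterTurn_left (v w : Plane) :
    inner ℝ (quarterTurn v) w = -inner ℝ v (quarterTurn w) := by
  simp only [PiLp.inner_apply, Fin.sum_univ_two, quarterTurn]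
  simp

theorem quarterTurn_eq (v : Plane) :
    quarterTurn v = v 0 • EuclideanSpace.single 1 1 - v 1 • EuclideanSpace.single 0 1 := by
  ext i
  fin_cases i <;> simp [quarterTurn]

theorem quarterTurn_const_smul (c : ℝ) (v : Plane) : quarterTurn (c • v) = c • quarterTurn v := by
  ext i
  fin_cases i <;> simp [quarterTurn]

theorem integral_fderiv_mul_eq_neg {a : Plane → ℝ} {G : Plane → Plane} (ha : IsGradientField a G)
    {g : Plane → ℝ} (hg : ContDiff ℝ 1 g) (hgc : HasCompactSupport g) (v : Plane) :
    ∫ x, inner ℝ (G x) v * g x = -∫ x, a x * fderiv ℝ g x v := by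
  have hfd : ∀ x, fderiv ℝ a x v = inner ℝ (G x) v := fun x => by
    rw [(ha.hasFDerivAt x).fderiv, innerSL_apply_apply]
  have h1 := ha.continuous
  have h2 := ha.continuous_potential
  have h3 : Continuous fun x => fderiv ℝ g x v :=
    (hg.continuous_fderiv (by simp)).clm_apply continuous_const
  have h4 := hg.continuous
  have h5 : HasCompactSupport fun x => fderiv ℝ g x v :=
    (hgc.fderiv ℝ).comp_left (g := fun L : Plane →L[ℝ] ℝ => L v) (by simp)
  have hIBP := integral_mul_fderiv_eq_neg_fderiv_mul_of_integrable (μ := (volume : Measure Plane))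
    (f := a) (g := g) (v := v) ?_ ?_ ?_ (fun x _ => (ha.hasFDerivAt x).differentiableAt)
    (fun x _ => (hg.differentiable (by simp)) x)
  · simp_rw [hIBP, hfd, neg_neg]
  · simp_rw [hfd]
    exact ((h1.inner continuous_const).mul h4).integrable_of_hasCompactSupport hgc.mul_left
  · exact (h2.mul h3).integrable_of_hasCompactSupport h5.mul_left
  · exact (h2.mul h4).integrable_of_hasCompactSupport hgc.mul_left

/-- A continuous gradient field is curl free in the sense of distributions. -/
theorem integral_fderiv_quarterTurn_eq_zero {a : Plane → ℝ} {G : Plane → Plane}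
    (ha : IsGradientField a G) {φ : Plane → ℝ} (hφ : ContDiff ℝ (⊤ : ℕ∞) φ)
    (hφc : HasCompactSupport φ) : ∫ x, fderiv ℝ φ x (quarterTurn (G x)) = 0 := by
  have hd : ContDiff ℝ 1 (fderiv ℝ φ) := hφ.fderiv_right (by norm_cast)
  have hg : ∀ v : Plane, ContDiff ℝ 1 fun x => fderiv ℝ φ x v := fun v =>
    hd.clm_apply contDiff_const
  have hgc : ∀ v : Plane, HasCompactSupport fun x => fderiv ℝ φ x v := fun v =>
    (hφc.fderiv ℝ).comp_left (g := fun L : Plane →L[ℝ] ℝ => L v) (by simp)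
  have hsymm : ∀ x v w, fderiv ℝ (fun y => fderiv ℝ φ y v) x w =
      fderiv ℝ (fun y => fderiv ℝ φ y w) x v := by
    intro x v w
    have h := (hφ.contDiffAt (x := x)).isSymmSndFDerivAt (by simp; norm_cast)
    have e : ∀ v w, fderiv ℝ (fun y => fderiv ℝ φ y v) x w = fderiv ℝ (fderiv ℝ φ) x w v := by
      intro v w
      rw [fderiv_clm_apply ((hd.differentiable (by simp)) x) (differentiableAt_const _)]
      simp
    rw [e, e]
    exact h w v
  have hin : ∀ (u : Plane) i, u i = inner ℝ u (EuclideanSpace.single i (1 : ℝ)) := by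
    intro u i
    rw [EuclideanSpace.inner_single_right]
    simp
  have hint : ∀ v w : Plane, Integrable fun x => inner ℝ (G x) v * fderiv ℝ φ x w := fun v w =>
    (((ha.continuous.inner continuous_const).mul (hg w).continuous)).integrable_of_hasCompactSupport
      (hgc w).mul_left
  have : ∀ x, fderiv ℝ φ x (quarterTurn (G x)) =
      inner ℝ (G x) (EuclideanSpace.single 0 (1 : ℝ)) * fderiv ℝ φ x (EuclideanSpace.single 1 1) -
      inner ℝ (G x) (EuclideanSpace.single 1 (1 : ℝ)) *
        fderiv ℝ φ x (EuclideanSpace.single 0 1) := by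
    intro x
    rw [quarterTurn_eq, map_sub, map_smul, map_smul, hin, hin]
    rfl
  simp_rw [this]
  rw [integral_sub (hint _ _) (hint _ _), integral_fderiv_mul_eq_neg ha (hg _) (hgc _),
    integral_fderiv_mul_eq_neg ha (hg _) (hgc _)]
  simp_rw [hsymm _ (EuclideanSpace.single 1 (1 : ℝ))]
  ring

namespace IsStationaryFlow

variable {Ω : Type*} [MeasurableSpace Ω] {θ : Plane → Ω → Ω} {P : Measure Ω} {τ : Ω → Plane}

/-- Integrals against the displaced Lebesgue measure, weighted by a bounded random variable. -/
theorem integral_mul_integral_displacedLebesgue [IsProbabilityMeasure P]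
    (hθ : IsStationaryFlow θ P) (hτ : Measurable τ) {h : Ω → ℝ} (hh : Measurable h)
    (hh1 : ∀ ω, |h ω| ≤ 1) {g : Plane → ℝ} (hg : Integrable g) (hgm : Measurable g) :
    Integrable (fun ω => ∫ z, g z ∂displacedLebesgue θ τ ω) P ∧
    ∫ ω, (h ω * ∫ z, g z ∂displacedLebesgue θ τ ω) ∂P =
      ∫ ω, (∫ z, h (θ (τ ω - z) ω) * g z) ∂P := by
  simp_rw [hθ.integral_displacedLebesgue hτ _ hgm]
  have hI : Integrable (fun p : Ω × Plane => g (p.2 + τ (θ p.2 p.1))) (P.prod volume) := by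
    have hm : Measurable fun p : Ω × Plane => g (p.2 + τ (θ p.2 p.1)) :=
      hgm.comp (hθ.measurable_displacement hτ)
    refine ⟨hm.aestronglyMeasurable, ?_⟩
    rw [HasFiniteIntegral, lintegral_prod _ hm.enorm.aemeasurable]
    have := hθ.lintegral_lintegral_displacedLebesgue hτ hgm.enorm
    simp_rw [hθ.lintegral_displacedLebesgue hτ _ hgm.enorm] at this
    rw [this]
    exact hg.2
  refine ⟨hI.integral_prod_left, ?_⟩
  have hI1 : Integrable (fun p : Ω × Plane => h p.1 * g (p.2 + τ (θ p.2 p.1))) (P.prod volume) :=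
    hI.bdd_mul (c := 1) (hh.comp measurable_fst).aestronglyMeasurable
      (Eventually.of_forall fun p => hh1 _)
  have hI2 : Integrable (fun p : Ω × Plane => h (θ (-p.2) p.1) * g (p.2 + τ p.1))
      (P.prod volume) := by
    refine Integrable.bdd_mul (c := 1) (integrable_translate_prod hg hgm hτ).swap ?_
      (Eventually.of_forall fun p => hh1 _)
    exact (hθ.measurable_comp hh measurable_snd.neg measurable_fst).aestronglyMeasurable
  calc ∫ ω, (h ω * ∫ y, g (y + τ (θ y ω))) ∂P
      = ∫ ω, (∫ y, h ω * g (y + τ (θ y ω))) ∂P := by simp_rw [integral_const_mul]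
    _ = ∫ y, (∫ ω, h ω * g (y + τ (θ y ω)) ∂P) := integral_integral_swap hI1
    _ = ∫ y, (∫ ω, h (θ (-y) ω) * g (y + τ ω) ∂P) := by
        refine integral_congr_ae (Eventually.of_forall fun y => ?_)
        simp only
        rw [← hθ.integral_comp (u := fun ω => h (θ (-y) ω) * g (y + τ ω)) _ y]
        · refine integral_congr_ae ?_
          filter_upwards [hθ.zero] with ω hω
          rw [hθ.add, neg_add_cancel, hω]
        · exact ((hθ.measurable_comp hh measurable_const measurable_id).mul
            (hgm.comp (measurable_const.add hτ))).aestronglyMeasurable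
    _ = ∫ ω, (∫ y, h (θ (-y) ω) * g (y + τ ω)) ∂P := (integral_integral_swap hI2).symm
    _ = _ := by
        refine integral_congr_ae (Eventually.of_forall fun ω => ?_)
        simp only
        rw [← integral_add_right_eq_self (fun z => h (θ (τ ω - z) ω) * g z) (τ ω)]
        refine integral_congr_ae (Eventually.of_forall fun y => ?_)
        simp only
        congr 3
        abel

theorem integral_orbit_mul [IsProbabilityMeasure P]
    (hθ : IsStationaryFlow θ P) {h : Ω → ℝ} (hh : Measurable h)
    (hh1 : ∀ ω, |h ω| ≤ 1) {g : Plane → ℝ} (hg : Integrable g) :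
    ∫ ω, (∫ z, h (θ (0 - z) ω) * g z) ∂P = ∫ ω, h ω * (∫ z, g z) ∂P := by
  have hI : Integrable (fun p : Ω × Plane => h (θ (0 - p.2) p.1) * g p.2) (P.prod volume) := by
    refine Integrable.bdd_mul (c := 1) (hg.comp_snd P) ?_ (Eventually.of_forall fun p => hh1 _)
    exact (hθ.measurable_comp hh (measurable_const.sub measurable_snd)
      measurable_fst).aestronglyMeasurable
  rw [integral_integral_swap hI, integral_mul_const, ← integral_const_mul]
  refine integral_congr_ae (Eventually.of_forall fun z => ?_)
  simp only
  rw [integral_mul_const, hθ.integral_comp hh.aestronglyMeasurable]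

/-- The potential difference of an averaged observable tests the charge distribution. -/
theorem integral_smearedCharge_orbitAverage [IsProbabilityMeasure P]
    (hθ : IsStationaryFlow θ P) (hτ : Measurable τ) {h : Ω → ℝ} (hh : Measurable h)
    (hh1 : ∀ ω, |h ω| ≤ 1) (η : ℝ) {φ : Plane → ℝ} (hφ : ContDiff ℝ (⊤ : ℕ∞) φ)
    (hφc : HasCompactSupport φ) :
    ∫ ω, (smearedCharge η (fun y => orbitAverage θ h φ (θ y ω)) (τ ω) -
        smearedCharge η (fun y => orbitAverage θ h φ (θ y ω)) 0) ∂P =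
      ∫ ω, (h ω * ((∫ z, smearedCharge η φ z ∂displacedLebesgue θ τ ω) - ∫ x, φ x)) ∂P := by
  have hφi := hφ.continuous.integrable_of_hasCompactSupport (μ := volume) hφc
  have hsc := continuous_smearedCharge η hφ.continuous
  have hsi := hsc.integrable_of_hasCompactSupport (μ := volume)
    (hasCompactSupport_smearedCharge η hφc)
  have hobs := hθ.isSmoothObservable_orbitAverage hh hh1 hφ hφc
  have e : ∀ q ω, smearedCharge η (fun y => orbitAverage θ h φ (θ y ω)) q =
      ∫ z, h (θ (q - z) ω) * smearedCharge η φ z := by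
    intro q ω
    have : (fun y => orbitAverage θ h φ (θ y ω)) = fun y => ∫ z, h (θ (y - z) ω) * φ z := by
      ext y
      rw [hθ.orbitAverage_comp]
      rfl
    rw [this]
    exact smearedCharge_convolution η (H := fun y => h (θ y ω))
      (hθ.measurable_comp hh measurable_id measurable_const) (fun y => hh1 _) hφi
      hφ.continuous.measurable q
  have h1 := hθ.integral_mul_integral_displacedLebesgue hτ hh hh1 hsi hsc.measurable
  rw [integral_sub (hobs.integrable_smearedCharge hθ η hτ)
    (hobs.integrable_smearedCharge hθ η measurable_const)]
  simp_rw [e]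
  rw [← h1.2, hθ.integral_orbit_mul hh hh1 hsi,
    integral_smearedCharge η hφi hφ.continuous.measurable, ← integral_sub]
  · simp_rw [mul_sub]
  · exact h1.1.bdd_mul (c := 1) hh.aestronglyMeasurable (Eventually.of_forall fun p => hh1 _)
  · exact (integrable_const _).bdd_mul (c := 1) hh.aestronglyMeasurable
      (Eventually.of_forall fun p => hh1 _)

/-- Two integrable random variables with the same integrals against bounded variables agree. -/
theorem ae_eq_of_forall_integral_mul_eq {f g : Ω → ℝ}
    (hf : Integrable f P) (hg : Integrable g P)
    (H : ∀ h : Ω → ℝ, Measurable h → (∀ ω, |h ω| ≤ 1) →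
      ∫ ω, h ω * f ω ∂P = ∫ ω, h ω * g ω ∂P) : f =ᵐ[P] g := by
  refine Integrable.ae_eq_of_forall_setIntegral_eq f g hf hg fun s hs _ => ?_
  have := H (s.indicator fun _ => 1) (measurable_const.indicator hs) (fun ω => by
    by_cases hω : ω ∈ s <;> simp [hω])
  rw [← integral_indicator hs, ← integral_indicator hs]
  convert this using 2 <;>
  · ext ω
    by_cases hω : ω ∈ s <;> simp [hω]

/-- Existence of a square-integrable `e` such that `x ↦ e (θ x ω)` satisfies, up to a factor `-2π`,
the equations of an electric field. The exceptional event may depend on the test function here. -/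
theorem exists_field [IsProbabilityMeasure P] (hθ : IsStationaryFlow θ P) (hτ : Measurable τ)
    {α : ℝ} (hα : 0 < α) (hm : ∫⁻ ω, ENNReal.ofReal ((1 + ‖τ ω‖) ^ (2 + α)) ∂P < ∞)
    {η : ℝ} (hη : 0 < η) :
    ∃ e : Ω → Plane, Measurable e ∧ MemLp e 2 P ∧
      ∀ φ : Plane → ℝ, ContDiff ℝ (⊤ : ℕ∞) φ → HasCompactSupport φ → ∀ᵐ ω ∂P,
        ∫ x, fderiv ℝ φ x (quarterTurn (e (θ x ω))) = 0 ∧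
        ∫ x, fderiv ℝ φ x (e (θ x ω)) =
          (∫ z, smearedCharge η φ z ∂displacedLebesgue θ τ ω) - ∫ x, φ x := by
  obtain ⟨K, hK, hKb⟩ := IsSmoothObservable.sq_lintegral_potential_difference_le hθ hτ hα hm hη
  have hobs : ∀ v : smoothObservables θ, IsSmoothObservable θ v.1.1 v.1.2 := fun v => v.2
  let A : smoothObservables θ →ₗ[ℝ] Lp Plane 2 P :=
    { toFun := fun v => ((hobs v).memLp_gradient (P := P)).toLp v.1.2
      map_add' := fun v w => rfl
      map_smul' := fun c v => rfl }
  have hA : ∀ v, ‖A v‖ₑ ^ 2 = ∫⁻ ω, ‖v.1.2 ω‖ₑ ^ 2 ∂P := by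
    intro v
    have h2 := eLpNorm_nnreal_pow_eq_lintegral (f := v.1.2) (μ := P) (p := 2) (by norm_num)
    change ‖((hobs v).memLp_gradient (P := P)).toLp v.1.2‖ₑ ^ 2 = _
    rw [Lp.enorm_toLp]
    simpa using h2
  let Δ : ((Ω → ℝ) × (Ω → Plane)) → Ω → ℝ := fun v ω =>
    smearedCharge η (fun y => v.1 (θ y ω)) (τ ω) - smearedCharge η (fun y => v.1 (θ y ω)) 0
  have hΔi : ∀ v : smoothObservables θ, Integrable (Δ v.1) P := fun v =>
    ((hobs v).integrable_smearedCharge hθ η hτ).sub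
      ((hobs v).integrable_smearedCharge hθ η measurable_const)
  -- The mean potential difference, a linear form bounded by the norm of the gradient.
  let l : smoothObservables θ →ₗ[ℝ] ℝ :=
    { toFun := fun v => ∫ ω, Δ v.1 ω ∂P
      map_add' := fun v w => by
        rw [← integral_add (hΔi v) (hΔi w)]
        refine integral_congr_ae (Eventually.of_forall fun ω => ?_)
        have := smearedCharge_add (η := η) ((hobs v).continuous ω) ((hobs w).continuous ω)
        change smearedCharge η (fun y => v.1.1 (θ y ω) + w.1.1 (θ y ω)) (τ ω) -
          smearedCharge η (fun y => v.1.1 (θ y ω) + w.1.1 (θ y ω)) 0 = _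
        rw [this, this]
        simp only [Δ]
        ring
      map_smul' := fun c v => by
        simp only [RingHom.id_apply, smul_eq_mul]
        rw [← integral_const_mul]
        refine integral_congr_ae (Eventually.of_forall fun ω => ?_)
        have := smearedCharge_const_mul (η := η) c fun y => v.1.1 (θ y ω)
        change smearedCharge η (fun y => c * v.1.1 (θ y ω)) (τ ω) -
          smearedCharge η (fun y => c * v.1.1 (θ y ω)) 0 = _
        rw [this, this]
        simp only [Δ]
        ring }
  have hl : ∀ v, |l v| ≤ √K.toReal * ‖A v‖ := by
    intro v
    have h1 : ‖l v‖ₑ ^ 2 ≤ K * ‖A v‖ₑ ^ 2 := by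
      rw [hA]
      refine le_trans ?_ (hKb _ _ (hobs v))
      gcongr
      exact enorm_integral_le_lintegral_enorm _
    have h2 : |l v| ^ 2 ≤ (√K.toReal * ‖A v‖) ^ 2 := by
      rw [mul_pow, Real.sq_sqrt ENNReal.toReal_nonneg]
      have := ENNReal.toReal_mono (by finiteness) h1
      simpa using this
    exact abs_le_of_sq_le_sq' h2 (by positivity) |>.2 |> fun h => by
      simpa using h
  obtain ⟨e0, he0, he⟩ := exists_mem_closure_range_of_le A l _ hl
  have hem : Measurable (e0 : Ω → Plane) := (Lp.stronglyMeasurable e0).measurable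
  have heL : MemLp (e0 : Ω → Plane) 2 P := Lp.memLp e0
  have hei : Integrable (e0 : Ω → Plane) P := heL.integrable (by norm_num)
  refine ⟨e0, hem, heL, fun φ hφ hφc => ?_⟩
  have hsc := continuous_smearedCharge η hφ.continuous
  have hsi := hsc.integrable_of_hasCompactSupport (μ := volume)
    (hasCompactSupport_smearedCharge η hφc)
  have curl : (fun ω => ∫ x, fderiv ℝ φ x (quarterTurn (e0 (θ x ω)))) =ᵐ[P] fun _ => 0 := by
    have hJm : Measurable fun ω => quarterTurn (e0 ω) := continuous_quarterTurn.measurable.comp hem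
    have hJi : Integrable (fun ω => quarterTurn (e0 ω)) P :=
      hei.norm.mono' hJm.aestronglyMeasurable
        (Eventually.of_forall fun ω => (norm_quarterTurn _).le)
    have h0 : Measurable fun _ : Ω => (0 : ℝ) := measurable_const
    refine ae_eq_of_forall_integral_mul_eq
      (hθ.integral_inner_orbitAverage_gradient h0 (by simp) hφ hφc hJm hJi).1
      (integrable_const _) fun h hh hh1 => ?_
    have hob := hθ.isSmoothObservable_orbitAverage hh hh1 hφ hφc
    rw [← (hθ.integral_inner_orbitAverage_gradient hh hh1 hφ hφc hJm hJi).2]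
    have hQm : Measurable fun ω => quarterTurn (orbitAverage θ h (gradient φ) ω) :=
      continuous_quarterTurn.measurable.comp hob.measurable_gradient
    have hQ : MemLp (fun ω => quarterTurn (orbitAverage θ h (gradient φ) ω)) 2 P :=
      (hob.memLp_gradient (P := P)).of_le hQm.aestronglyMeasurable
        (Eventually.of_forall fun ω => (norm_quarterTurn _).le)
    -- The quarter turn is moved to the averaged gradient, to get a continuous linear form in `f`.
    have key : ∀ f : Lp Plane 2 P, inner ℝ f (hQ.toLp _) =
        -∫ ω, inner ℝ (quarterTurn (f ω)) (orbitAverage θ h (gradient φ) ω) ∂P := by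
      intro f
      rw [L2.inner_def, ← integral_neg]
      refine integral_congr_ae ?_
      filter_upwards [hQ.coeFn_toLp] with ω hω
      rw [hω, inner_quarterTurn_left, neg_neg]
    -- Gradients are curl free, and this passes to the closure, which contains `e0`.
    have hz : inner ℝ e0 (hQ.toLp _) = 0 := by
      have hcl : IsClosed {f : Lp Plane 2 P | inner ℝ f (hQ.toLp _) = 0} :=
        isClosed_eq (by fun_prop) continuous_const
      refine closure_minimal (t := {f : Lp Plane 2 P | inner ℝ f (hQ.toLp _) = 0}) ?_ hcl he0
      rintro _ ⟨v, rfl⟩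
      rw [Set.mem_ofPred_eq, key, neg_eq_zero]
      have hGm := (hobs v).measurable_gradient
      have hJGm : Measurable fun ω => quarterTurn (v.1.2 ω) :=
        continuous_quarterTurn.measurable.comp hGm
      have hJGi : Integrable (fun ω => quarterTurn (v.1.2 ω)) P :=
        (((hobs v).memLp_gradient (P := P)).integrable (by norm_num)).norm.mono'
          hJGm.aestronglyMeasurable (Eventually.of_forall fun ω => (norm_quarterTurn _).le)
      have h2 := (hθ.integral_inner_orbitAverage_gradient hh hh1 hφ hφc hJGm hJGi).2
      simp_rw [integral_fderiv_quarterTurn_eq_zero ((hobs v).isGradientField _) hφ hφc] at h2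
      simp only [mul_zero, integral_zero] at h2
      rw [← h2]
      refine integral_congr_ae ?_
      filter_upwards [((hobs v).memLp_gradient (P := P)).coeFn_toLp] with ω hω
      change inner ℝ (quarterTurn ((((hobs v).memLp_gradient (P := P)).toLp v.1.2) ω)) _ = _
      rw [hω]
    rw [key, neg_eq_zero] at hz
    rw [hz]
    simp
  have div : (fun ω => ∫ x, fderiv ℝ φ x (e0 (θ x ω))) =ᵐ[P]
      fun ω => (∫ z, smearedCharge η φ z ∂displacedLebesgue θ τ ω) - ∫ x, φ x := by
    have h0 : Measurable fun _ : Ω => (0 : ℝ) := measurable_const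
    refine ae_eq_of_forall_integral_mul_eq
      (hθ.integral_inner_orbitAverage_gradient h0 (by simp) hφ hφc hem hei).1
      ((hθ.integral_mul_integral_displacedLebesgue hτ h0 (by simp) hsi hsc.measurable).1.sub
        (integrable_const _)) fun h hh hh1 => ?_
    have hob := hθ.isSmoothObservable_orbitAverage hh hh1 hφ hφc
    rw [← (hθ.integral_inner_orbitAverage_gradient hh hh1 hφ hφc hem hei).2,
      ← hθ.integral_smearedCharge_orbitAverage hτ hh hh1 η hφ hφc]
    have := he ⟨(orbitAverage θ h φ, orbitAverage θ h (gradient φ)), hob⟩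
    change _ = ∫ ω, Δ (orbitAverage θ h φ, orbitAverage θ h (gradient φ)) ω ∂P at this
    rw [← this, L2.inner_def]
    refine integral_congr_ae ?_
    filter_upwards [(hob.memLp_gradient (P := P)).coeFn_toLp] with ω hω
    change _ = inner ℝ (e0 ω) (((hob.memLp_gradient (P := P)).toLp _) ω)
    rw [hω]
  filter_upwards [curl, div] with ω h1 h2 using ⟨h1, h2⟩

end IsStationaryFlow

/-! ### All test functions simultaneously, and the Coulomb energy -/

theorem fderiv_eq_zero_of_radius {φ : Plane → ℝ} {r : ℝ} (h : ∀ x, r < ‖x‖ → φ x = 0) {x : Plane}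
    (hx : r < ‖x‖) : fderiv ℝ φ x = 0 := by
  have : φ =ᶠ[𝓝 x] fun _ => 0 := by
    filter_upwards [(isOpen_lt continuous_const continuous_norm).mem_nhds hx] with y hy
    exact h y hy
  rw [this.fderiv_eq, fderiv_const_apply]

/-- The test functions supported in a given disk are separable for the `C¹` topology. -/
theorem exists_countable_dense_testFunctions (r : ℝ) :
    ∃ D : Set (Plane → ℝ), D.Countable ∧
      (∀ ψ ∈ D, ContDiff ℝ (⊤ : ℕ∞) ψ ∧ ∀ x, r < ‖x‖ → ψ x = 0) ∧
      ∀ φ : Plane → ℝ, ContDiff ℝ (⊤ : ℕ∞) φ → (∀ x, r < ‖x‖ → φ x = 0) → ∀ ε : ℝ, 0 < ε →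
        ∃ ψ ∈ D, ∀ x, |φ x - ψ x| ≤ ε ∧ ‖fderiv ℝ φ x - fderiv ℝ ψ x‖ ≤ ε := by
  let T := {φ : Plane → ℝ // ContDiff ℝ (⊤ : ℕ∞) φ ∧ ∀ x, r < ‖x‖ → φ x = 0}
  let K := {x : Plane // x ∈ Metric.closedBall (0 : Plane) r}
  have : CompactSpace K := isCompact_iff_compactSpace.1 (isCompact_closedBall (0 : Plane) r)
  let F : T → C(K, ℝ × Plane) := fun φ =>
    ⟨fun x => (φ.1 x.1, gradient φ.1 x.1),
      (φ.2.1.continuous.comp continuous_subtype_val).prodMk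
        ((continuous_gradient φ.2.1).comp continuous_subtype_val)⟩
  obtain ⟨s, hs, hsd⟩ := TopologicalSpace.exists_countable_dense (Set.range F)
  have hch : ∀ y : Set.range F, ∃ φ : T, F φ = y.1 := fun y => y.2
  choose c hc using hch
  refine ⟨(fun y => (c y).1) '' s, hs.image _, ?_, fun φ hφ hφr ε hε => ?_⟩
  · rintro _ ⟨y, -, rfl⟩
    exact (c y).2
  · obtain ⟨y, hy, hys⟩ := hsd.exists_dist_lt ⟨F ⟨φ, hφ, hφr⟩, Set.mem_range_self _⟩ hε
    refine ⟨(c y).1, ⟨y, hy, rfl⟩, fun x => ?_⟩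
    by_cases hx : r < ‖x‖
    · rw [hφr x hx, (c y).2.2 x hx, fderiv_eq_zero_of_radius hφr hx,
        fderiv_eq_zero_of_radius (c y).2.2 hx]
      simp [hε.le]
    · have hxK : x ∈ Metric.closedBall (0 : Plane) r := by
        rw [mem_closedBall_zero_iff]; exact not_lt.1 hx
      have h1 : dist (F ⟨φ, hφ, hφr⟩) (F (c y)) < ε := by rw [hc]; exact hys
      have h2 := (ContinuousMap.dist_apply_le_dist (f := F ⟨φ, hφ, hφr⟩) (g := F (c y))
        ⟨x, hxK⟩).trans h1.le
      change dist (φ x, gradient φ x) ((c y).1 x, gradient (c y).1 x) ≤ ε at h2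
      rw [Prod.dist_eq, max_le_iff, Real.dist_eq, dist_eq_norm] at h2
      refine ⟨h2.1, ?_⟩
      rw [← toDual_gradient, ← toDual_gradient, ← map_sub, LinearIsometryEquiv.norm_map]
      exact h2.2

/-- Two functions carried by `B` and close to each other with respect to a weight `w` have close
integrals. The measurability and domination hypotheses ensure integrability. -/
theorem abs_integral_sub_integral_le {μ : Measure Plane} {f g w : Plane → ℝ} {B : Set Plane}
    {C ε : ℝ} (hB : MeasurableSet B) (hw : IntegrableOn w B μ) (hf : AEStronglyMeasurable f μ)
    (hg : AEStronglyMeasurable g μ) (hfC : ∀ x, |f x| ≤ B.indicator (fun x => C * w x) x)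
    (hfg : ∀ x, |f x - g x| ≤ B.indicator (fun x => ε * w x) x) :
    |∫ x, f x ∂μ - ∫ x, g x ∂μ| ≤ ε * ∫ x in B, w x ∂μ := by
  have hC : ∀ c : ℝ, Integrable (B.indicator fun x => c * w x) μ := fun c =>
    (integrable_indicator_iff hB).2 (hw.const_mul c)
  have hfi : Integrable f μ := (hC C).mono' hf (Eventually.of_forall hfC)
  have hdi : Integrable (fun x => f x - g x) μ :=
    (hC ε).mono' (hf.sub hg) (Eventually.of_forall hfg)
  have hgi : Integrable g μ := by
    have := hfi.sub hdi
    refine this.congr (Eventually.of_forall fun x => ?_)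
    simp
  rw [← integral_sub hfi hgi, ← integral_const_mul, ← integral_indicator hB]
  exact norm_integral_le_of_norm_le (f := fun x => f x - g x) (hC ε) (Eventually.of_forall hfg)

theorem abs_integral_fderiv_sub_le {E : Plane → Plane} (hE : LocallyIntegrable E)
    {φ ψ : Plane → ℝ} (hφ : ContDiff ℝ (⊤ : ℕ∞) φ) (hψ : ContDiff ℝ (⊤ : ℕ∞) ψ) {r : ℝ}
    (hφr : ∀ x, r < ‖x‖ → φ x = 0) (hψr : ∀ x, r < ‖x‖ → ψ x = 0) {ε : ℝ}
    (h : ∀ x, ‖fderiv ℝ φ x - fderiv ℝ ψ x‖ ≤ ε) :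
    |(∫ x, fderiv ℝ φ x (E x)) - ∫ x, fderiv ℝ ψ x (E x)| ≤
      ε * ∫ x in Metric.closedBall 0 r, ‖E x‖ := by
  obtain ⟨C, hC⟩ := (hφ.continuous_fderiv (by simp)).bounded_above_of_compact_support
    ((hasCompactSupport_of_radius hφr).fderiv ℝ)
  have hm : ∀ {χ : Plane → ℝ}, ContDiff ℝ (⊤ : ℕ∞) χ →
      AEStronglyMeasurable (fun x => fderiv ℝ χ x (E x)) volume := by
    intro χ hχ
    simp_rw [← inner_gradient_eq_fderiv]
    exact (continuous_gradient hχ).aestronglyMeasurable.inner hE.aestronglyMeasurable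
  refine abs_integral_sub_integral_le (C := C) measurableSet_closedBall
    (hE.integrableOn_isCompact (isCompact_closedBall _ _)).norm (hm hφ) (hm hψ)
    (fun x => ?_) (fun x => ?_)
  · by_cases hx : x ∈ Metric.closedBall (0 : Plane) r
    · rw [Set.indicator_of_mem hx]
      exact (fderiv ℝ φ x).le_of_opNorm_le (hC x) _
    · rw [Set.indicator_of_notMem hx]
      rw [mem_closedBall_zero_iff, not_le] at hx
      rw [fderiv_eq_zero_of_radius hφr hx]
      simp
  · by_cases hx : x ∈ Metric.closedBall (0 : Plane) r
    · rw [Set.indicator_of_mem hx]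
      exact (fderiv ℝ φ x - fderiv ℝ ψ x).le_of_opNorm_le (h x) _
    · rw [Set.indicator_of_notMem hx]
      rw [mem_closedBall_zero_iff, not_le] at hx
      rw [fderiv_eq_zero_of_radius hφr hx, fderiv_eq_zero_of_radius hψr hx]
      simp

theorem abs_integral_sub_le_of_support {μ : Measure Plane} {φ ψ : Plane → ℝ} (hφ : Continuous φ)
    (hψ : Continuous ψ) {r : ℝ} (hμ : μ (Metric.closedBall 0 r) < ∞)
    (hφr : ∀ x, r < ‖x‖ → φ x = 0) (hψr : ∀ x, r < ‖x‖ → ψ x = 0) {ε : ℝ}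
    (h : ∀ x, |φ x - ψ x| ≤ ε) :
    |∫ x, φ x ∂μ - ∫ x, ψ x ∂μ| ≤ ε * ∫ _ in Metric.closedBall 0 r, 1 ∂μ := by
  obtain ⟨C, hC⟩ := hφ.bounded_above_of_compact_support (hasCompactSupport_of_radius hφr)
  refine abs_integral_sub_integral_le (C := C) measurableSet_closedBall
    (integrableOn_const hμ.ne) hφ.aestronglyMeasurable hψ.aestronglyMeasurable
    (fun x => ?_) (fun x => ?_)
  · by_cases hx : x ∈ Metric.closedBall (0 : Plane) r
    · rw [Set.indicator_of_mem hx, mul_one]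
      exact hC x
    · rw [Set.indicator_of_notMem hx]
      rw [mem_closedBall_zero_iff, not_le] at hx
      simp [hφr x hx]
  · by_cases hx : x ∈ Metric.closedBall (0 : Plane) r
    · rw [Set.indicator_of_mem hx, mul_one]
      exact h x
    · rw [Set.indicator_of_notMem hx]
      rw [mem_closedBall_zero_iff, not_le] at hx
      simp [hφr x hx, hψr x hx]

theorem abs_smearedCharge_sub_le {η ε : ℝ} {φ ψ : Plane → ℝ} (hφ : Continuous φ)
    (hψ : Continuous ψ) (h : ∀ x, |φ x - ψ x| ≤ ε) (z : Plane) :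
    |smearedCharge η φ z - smearedCharge η ψ z| ≤ ε := by
  have e := smearedCharge_add (η := η) (hφ.sub hψ) hψ z
  simp only [Pi.sub_apply, sub_add_cancel] at e
  rw [e, add_sub_cancel_right]
  exact abs_smearedCharge_le fun x _ => h x

theorem eq_of_forall_abs_sub_le {a b c : ℝ} (h : ∀ ε : ℝ, 0 < ε → |a - b| ≤ ε * c) : a = b := by
  have hc : 0 ≤ c := by simpa using (abs_nonneg _).trans (h 1 one_pos)
  refine eq_of_forall_dist_le fun ε hε => ?_
  refine (h (ε / (c + 1)) (by positivity)).trans ?_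
  rw [div_mul_eq_mul_div, div_le_iff₀ (by positivity)]
  nlinarith

namespace IsStationaryFlow

variable {Ω : Type*} [MeasurableSpace Ω] {θ : Plane → Ω → Ω} {P : Measure Ω} {τ : Ω → Plane}

theorem ae_locallyIntegrable [IsProbabilityMeasure P] (hθ : IsStationaryFlow θ P) {e : Ω → Plane}
    (he : Measurable e) (hei : Integrable e P) :
    ∀ᵐ ω ∂P, LocallyIntegrable fun x => e (θ x ω) := by
  filter_upwards [hθ.ae_lintegral_closedBall_lt_top he.enorm hei.2] with ω hω
  rw [locallyIntegrable_iff]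
  intro K hK
  obtain ⟨r, hr⟩ := hK.isBounded.subset_closedBall 0
  refine IntegrableOn.mono_set ⟨?_, hω r⟩ hr
  exact (hθ.measurable_comp he measurable_id measurable_const).aestronglyMeasurable

/-- The stationary electric field generated by the displaced Lebesgue measure: the exceptional event
no longer depends on the test function, by density of countably many of them. -/
theorem exists_isElectricField [IsProbabilityMeasure P] (hθ : IsStationaryFlow θ P)
    (hτ : Measurable τ) {α : ℝ} (hα : 0 < α)
    (hm : ∫⁻ ω, ENNReal.ofReal ((1 + ‖τ ω‖) ^ (2 + α)) ∂P < ∞) {η : ℝ} (hη : 0 < η) :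
    ∃ e : Ω → Plane, Measurable e ∧ MemLp e 2 P ∧
      ∀ᵐ ω ∂P, IsElectricField η (displacedLebesgue θ τ ω) fun x => e (θ x ω) := by
  obtain ⟨e, he, heL, hφ⟩ := hθ.exists_field hτ hα hm hη
  refine ⟨fun ω => (-(2 * Real.pi)) • e ω, he.const_smul (-(2 * Real.pi)),
    heL.const_smul (-(2 * Real.pi)), ?_⟩
  have hei : Integrable e P := heL.integrable (by norm_num)
  choose D hDc hD hDd using fun n : ℕ => exists_countable_dense_testFunctions (n : ℝ)
  have hall : ∀ n : ℕ, ∀ᵐ ω ∂P, ∀ φ ∈ D n,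
      ∫ x, fderiv ℝ φ x (quarterTurn (e (θ x ω))) = 0 ∧
      ∫ x, fderiv ℝ φ x (e (θ x ω)) =
        (∫ z, smearedCharge η φ z ∂displacedLebesgue θ τ ω) - ∫ x, φ x := fun n =>
    (ae_ball_iff (hDc n)).2 fun φ hφD =>
      hφ φ (hD n φ hφD).1 (hasCompactSupport_of_radius (hD n φ hφD).2)
  filter_upwards [ae_all_iff.2 hall, hθ.ae_locallyIntegrable he hei,
    hθ.ae_displacedLebesgue_closedBall_lt_top hτ] with ω hω hli hfin
  have hJli : LocallyIntegrable fun x => quarterTurn (e (θ x ω)) :=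
    hli.mono (continuous_quarterTurn.comp_aestronglyMeasurable hli.aestronglyMeasurable)
      (Eventually.of_forall fun x => (norm_quarterTurn _).le)
  refine ⟨hli.smul (-(2 * Real.pi)), fun φ hφs hφc => ?_⟩
  obtain ⟨r, -, hr⟩ := exists_radius_of_hasCompactSupport hφc
  obtain ⟨n, hn⟩ := exists_nat_ge r
  have hφn : ∀ x, (n : ℝ) < ‖x‖ → φ x = 0 := fun x hx => hr x (hn.trans_lt hx)
  have h1 : ∫ x, fderiv ℝ φ x (quarterTurn (e (θ x ω))) = 0 := by
    refine eq_of_forall_abs_sub_le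
      (c := ∫ x in Metric.closedBall 0 (n : ℝ), ‖quarterTurn (e (θ x ω))‖) fun ε hε => ?_
    obtain ⟨ψ, hψD, hψ⟩ := hDd n φ hφs hφn ε hε
    rw [← (hω n ψ hψD).1]
    exact abs_integral_fderiv_sub_le hJli hφs (hD n ψ hψD).1 hφn (hD n ψ hψD).2
      fun x => (hψ x).2
  have h2 : ∫ x, fderiv ℝ φ x (e (θ x ω)) =
      (∫ z, smearedCharge η φ z ∂displacedLebesgue θ τ ω) - ∫ x, φ x := by
    refine eq_of_forall_abs_sub_le (c := (∫ x in Metric.closedBall 0 (n : ℝ), ‖e (θ x ω)‖) +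
      ((∫ _ in Metric.closedBall 0 ((n : ℝ) + |η|), 1 ∂displacedLebesgue θ τ ω) +
        ∫ _ in Metric.closedBall (0 : Plane) (n : ℝ), 1)) fun ε hε => ?_
    obtain ⟨ψ, hψD, hψ⟩ := hDd n φ hφs hφn ε hε
    have hψs := (hD n ψ hψD).1
    have hψn := (hD n ψ hψD).2
    have a1 := abs_integral_fderiv_sub_le hli hφs hψs hφn hψn fun x => (hψ x).2
    have a2 := abs_integral_sub_le_of_support (continuous_smearedCharge η hφs.continuous)
      (continuous_smearedCharge η hψs.continuous) (hfin ((n : ℝ) + |η|))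
      (fun x hx => smearedCharge_eq_zero hφn hx) (fun x hx => smearedCharge_eq_zero hψn hx)
      (abs_smearedCharge_sub_le hφs.continuous hψs.continuous fun x => (hψ x).1)
    have a3 := abs_integral_sub_le_of_support (μ := volume) hφs.continuous hψs.continuous
      (isCompact_closedBall _ _).measure_lt_top hφn hψn fun x => (hψ x).1
    rw [(hω n ψ hψD).2] at a1
    rw [abs_le] at a1 a2 a3 ⊢
    constructor <;> linarith
  constructor
  · simp only [quarterTurn_const_smul, map_smul, smul_eq_mul]
    rw [integral_const_mul, h1, mul_zero]
  · simp only [map_smul, smul_eq_mul]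
    rw [integral_const_mul, h2]
    ring

theorem regularizedCoulombEnergy_displacedLebesgue_lt_top {Ω : Type} [MeasurableSpace Ω]
    {θ : Plane → Ω → Ω} {P : Measure Ω} {τ : Ω → Plane} [IsProbabilityMeasure P]
    (hθ : IsStationaryFlow θ P) (hτ : Measurable τ) {α : ℝ} (hα : 0 < α)
    (hm : ∫⁻ ω, ENNReal.ofReal ((1 + ‖τ ω‖) ^ (2 + α)) ∂P < ∞) {η : ℝ} (hη : 0 < η)
    (hX : IsPointProcess (displacedLebesgue θ τ) P) :
    regularizedCoulombEnergy η (P.map (displacedLebesgue θ τ)) < ∞ := by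
  obtain ⟨e, he, heL, hE⟩ := hθ.exists_isElectricField hτ hα hm hη
  have hEm : Measurable (Function.uncurry fun ω x => e (θ x ω)) :=
    hθ.measurable_comp he measurable_snd measurable_fst
  refine lt_of_le_of_lt (b := ∫⁻ ω, (∫⁻ x in {x : Plane | ∀ i, x i ∈ Set.Icc (0 : ℝ) 1},
    ‖e (θ x ω)‖ₑ ^ 2) ∂P) (sInf_le ⟨Ω, _, P, displacedLebesgue θ τ, fun ω x => e (θ x ω),
      inferInstance, hX, rfl, hEm, fun u => ?_, hE, rfl⟩) ?_
  · have hF : Measurable fun ω => (displacedLebesgue θ τ ω, fun x => e (θ x ω)) :=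
      (hθ.measurable_displacedLebesgue hτ).prodMk (measurable_pi_lambda _ fun x =>
        hθ.measurable_comp he measurable_const measurable_id)
    have hu : Measurable (θ u) := (hθ.measurePreserving u).measurable
    have e1 : (fun ω => ((displacedLebesgue θ τ ω).map (fun z => z - u),
        fun x => e (θ (x + u) ω))) =
        (fun ω => (displacedLebesgue θ τ ω, fun x => e (θ x ω))) ∘ θ u := by
      ext1 ω
      simp only [Function.comp_apply, hθ.displacedLebesgue_comp hτ, hθ.add]
    refine ⟨?_, hF.aemeasurable, ?_⟩
    · rw [e1]
      exact (hF.comp hu).aemeasurable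
    · rw [e1, ← Measure.map_map hF hu, (hθ.measurePreserving u).map_eq]
  · rw [hθ.lintegral_lintegral_comp (f := fun ω => ‖e ω‖ₑ ^ 2) (he.enorm.pow_const 2)]
    refine ENNReal.mul_lt_top ?_ ?_
    · rw [Measure.restrict_apply_univ]
      refine (measure_mono (t := Metric.closedBall 0 2) fun x hx => ?_).trans_lt
        (isCompact_closedBall _ _).measure_lt_top
      rw [mem_closedBall_zero_iff, ← sq_le_sq₀ (norm_nonneg _) (by norm_num),
        EuclideanSpace.norm_sq_eq, Fin.sum_univ_two]
      have h0 := hx 0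
      have h1 := hx 1
      simp only [Real.norm_eq_abs, sq_abs]
      rw [Set.mem_Icc] at h0 h1
      nlinarith
    · have h2 := eLpNorm_nnreal_pow_eq_lintegral (f := e) (μ := P) (p := 2) (by norm_num)
      have h3 : eLpNorm e 2 P ^ 2 = ∫⁻ ω, ‖e ω‖ₑ ^ 2 ∂P := by simpa using h2
      rw [← h3]
      exact ENNReal.pow_lt_top heL.2

end IsStationaryFlow

/-! ### Mollified disks -/

/-- The convolution of the indicator function of the closed disk of radius `s` with `g`. -/
noncomputable def smoothedDisk (s : ℝ) (g : Plane → ℝ) (x : Plane) : ℝ :=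
  ∫ z, (Metric.closedBall (0 : Plane) s).indicator (fun _ => (1 : ℝ)) (x - z) * g z

theorem abs_indicator_closedBall_le (s : ℝ) (x : Plane) :
    |(Metric.closedBall (0 : Plane) s).indicator (fun _ => (1 : ℝ)) x| ≤ 1 := by
  by_cases hx : x ∈ Metric.closedBall (0 : Plane) s <;> simp [hx]

theorem measurable_indicator_closedBall (s : ℝ) :
    Measurable ((Metric.closedBall (0 : Plane) s).indicator fun _ => (1 : ℝ)) :=
  measurable_const.indicator measurableSet_closedBall

theorem integrable_indicator_closedBall (s : ℝ) :
    Integrable ((Metric.closedBall (0 : Plane) s).indicator fun _ => (1 : ℝ)) :=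
  (integrable_indicator_iff measurableSet_closedBall).2
    (integrableOn_const (isCompact_closedBall _ _).measure_lt_top.ne)

theorem abs_smoothedDisk_le {s : ℝ} {g : Plane → ℝ} (hg : Integrable g) (x : Plane) :
    |smoothedDisk s g x| ≤ ∫ z, |g z| := by
  rw [smoothedDisk, ← Real.norm_eq_abs]
  refine norm_integral_le_of_norm_le hg.abs (Eventually.of_forall fun z => ?_)
  rw [norm_mul]
  exact mul_le_of_le_one_left (norm_nonneg _) (abs_indicator_closedBall_le _ _)

theorem measurable_smoothedDisk (s : ℝ) {g : Plane → ℝ} (hg : Measurable g) :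
    Measurable (smoothedDisk s g) := by
  have : StronglyMeasurable fun p : Plane × Plane =>
      (Metric.closedBall (0 : Plane) s).indicator (fun _ => (1 : ℝ)) (p.1 - p.2) * g p.2 :=
    (((measurable_indicator_closedBall s).comp (measurable_fst.sub measurable_snd)).mul
      (hg.comp measurable_snd)).stronglyMeasurable
  exact (StronglyMeasurable.integral_prod_right' this).measurable

theorem smoothedDisk_eq_zero {s r : ℝ} {g : Plane → ℝ} (hg : ∀ x, r < ‖x‖ → g x = 0) {x : Plane}
    (hx : s + r < ‖x‖) : smoothedDisk s g x = 0 := by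
  rw [smoothedDisk]
  refine integral_eq_zero_of_ae (Eventually.of_forall fun z => ?_)
  simp only [Pi.zero_apply, mul_eq_zero]
  by_cases hz : r < ‖z‖
  · exact Or.inr (hg z hz)
  · left
    refine Set.indicator_of_notMem ?_ _
    rw [mem_closedBall_zero_iff, not_le]
    have := norm_sub_norm_le x z
    linarith

theorem smoothedDisk_eq_convolution (s : ℝ) (g : Plane → ℝ) :
    smoothedDisk s g = MeasureTheory.convolution
      ((Metric.closedBall (0 : Plane) s).indicator fun _ => (1 : ℝ)) g
      (ContinuousLinearMap.lsmul ℝ ℝ) volume := by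
  ext x
  rw [smoothedDisk, MeasureTheory.convolution_eq_swap]
  rfl

theorem fourier_smoothedDisk (s : ℝ) {g : Plane → ℝ} (hg : Integrable g) (k : Plane) :
    FourierTransform.fourier (fun x => (smoothedDisk s g x : ℂ)) k =
      FourierTransform.fourier ((Metric.closedBall (0 : Plane) s).indicator fun _ => (1 : ℂ)) k *
        FourierTransform.fourier (fun x => (g x : ℂ)) k := by
  have hi : Integrable ((Metric.closedBall (0 : Plane) s).indicator fun _ => (1 : ℂ)) :=
    (integrable_indicator_iff measurableSet_closedBall).2
      (integrableOn_const (isCompact_closedBall _ _).measure_lt_top.ne)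
  have hgC : Integrable fun x => (g x : ℂ) := hg.ofReal
  rw [← Real.fourier_mul_convolution_eq hi hgC]
  refine congrArg (fun F : Plane → ℂ => FourierTransform.fourier F k) (funext fun x => ?_)
  rw [MeasureTheory.convolution_eq_swap, smoothedDisk, ← integral_complex_ofReal]
  refine integral_congr_ae (Eventually.of_forall fun z => ?_)
  simp only [ContinuousLinearMap.mul_apply']
  by_cases hx : x - z ∈ Metric.closedBall (0 : Plane) s
  · simp only [Set.indicator_of_mem hx, one_mul]
  · simp only [Set.indicator_of_notMem hx, zero_mul]
    rfl

theorem fourier_apply_zero (f : Plane → ℂ) : FourierTransform.fourier f (0 : Plane) = ∫ x, f x := by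
  simp [Real.fourier_eq]

theorem integral_smoothedDisk {s : ℝ} (hs : 0 ≤ s) {g : Plane → ℝ} (hg : Integrable g) :
    ∫ x, smoothedDisk s g x = Real.pi * s ^ 2 * ∫ x, g x := by
  have h := fourier_smoothedDisk s hg 0
  rw [fourier_apply_zero, fourier_apply_zero, fourier_apply_zero, integral_complex_ofReal,
    integral_complex_ofReal,
    integral_indicator measurableSet_closedBall, setIntegral_const, measureReal_def,
    volume_closedBall_plane 0 hs, ENNReal.toReal_ofReal (by positivity)] at h
  apply Complex.ofReal_injective
  rw [h]
  simp

theorem smearedCharge_smoothedDisk (η s : ℝ) {φ : Plane → ℝ} (hφ : Integrable φ)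
    (hφm : Measurable φ) (q : Plane) :
    smearedCharge η (smoothedDisk s φ) q = smoothedDisk s (smearedCharge η φ) q :=
  smearedCharge_convolution η (measurable_indicator_closedBall s)
    (abs_indicator_closedBall_le s) hφ hφm q

theorem contDiff_smoothedDisk (s : ℝ) {φ : Plane → ℝ} (hφ : ContDiff ℝ (⊤ : ℕ∞) φ)
    (hφc : HasCompactSupport φ) : ContDiff ℝ (⊤ : ℕ∞) (smoothedDisk s φ) := by
  rw [smoothedDisk_eq_convolution]
  exact hφc.contDiff_convolution_right _ (integrable_indicator_closedBall s).locallyIntegrable hφ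

theorem hasCompactSupport_smoothedDisk (s : ℝ) {g : Plane → ℝ} (hg : HasCompactSupport g) :
    HasCompactSupport (smoothedDisk s g) := by
  obtain ⟨r, -, hr⟩ := exists_radius_of_hasCompactSupport hg
  exact hasCompactSupport_of_radius fun x hx => smoothedDisk_eq_zero hr hx

theorem fderiv_smoothedDisk (s : ℝ) {φ : Plane → ℝ} (hφ : ContDiff ℝ (⊤ : ℕ∞) φ)
    (hφc : HasCompactSupport φ) (x v : Plane) :
    fderiv ℝ (smoothedDisk s φ) x v = smoothedDisk s (fun y => fderiv ℝ φ y v) x := by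
  have hl := (integrable_indicator_closedBall s).locallyIntegrable
  have hd := hφc.hasFDerivAt_convolution_right (ContinuousLinearMap.lsmul ℝ ℝ) hl
      (hφ.of_le (by simp)) x
  rw [smoothedDisk_eq_convolution, hd.fderiv,
    MeasureTheory.convolution_precompR_apply _ hl (hφc.fderiv ℝ)
      (hφ.continuous_fderiv (by simp)), smoothedDisk_eq_convolution]

theorem smearedCharge_neg (η : ℝ) {φ : Plane → ℝ} (hφ : ∀ x, φ (-x) = φ x) (z : Plane) :
    smearedCharge η φ (-z) = smearedCharge η φ z := by
  have hp : Function.Periodic (fun t => φ (z + η • !₂[Real.cos t, Real.sin t]))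
      (2 * Real.pi) := fun t => by simp
  rw [smearedCharge, smearedCharge]
  congr 1
  have := hp.intervalIntegral_add_eq Real.pi 0
  rw [zero_add] at this
  rw [← this]
  have e := intervalIntegral.integral_comp_add_right (a := 0) (b := 2 * Real.pi)
    (fun t => φ (z + η • !₂[Real.cos t, Real.sin t])) Real.pi
  rw [zero_add, add_comm (2 * Real.pi)] at e
  rw [← e]
  refine intervalIntegral.integral_congr fun t _ => ?_
  change φ (-z + _) = φ (z + _)
  rw [← hφ]
  congr 1
  ext i
  fin_cases i <;> simp [Real.cos_add_pi, Real.sin_add_pi] <;> ring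

/-! ### Fourier multipliers of mollified disks -/

/-- First-order bound at the origin for the Fourier transform of a function of zero integral. -/
theorem norm_fourier_le_of_integral_eq_zero {g : Plane → ℝ} (hg : Integrable g) {r : ℝ}
    (hr : ∀ x, r < ‖x‖ → g x = 0) (h0 : ∫ x, g x = 0) (k : Plane) :
    ‖FourierTransform.fourier (fun x => (g x : ℂ)) k‖ ≤
      (2 * Real.pi * r * ∫ x, |g x|) * ‖k‖ := by
  have hgC : Integrable fun x => (g x : ℂ) := hg.ofReal
  have e : FourierTransform.fourier (fun x => (g x : ℂ)) k =
      ∫ x, (Complex.exp (Complex.I * ((-2 * Real.pi * inner ℝ x k : ℝ) : ℂ)) - 1) * (g x : ℂ) := by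
    have : ∫ x, (g x : ℂ) = 0 := by rw [integral_complex_ofReal, h0, Complex.ofReal_zero]
    have hi : Integrable fun x => Complex.exp (Complex.I * ((-2 * Real.pi * inner ℝ x k : ℝ) : ℂ)) *
        (g x : ℂ) := by
      refine hgC.bdd_mul (c := 1) (by fun_prop) (Eventually.of_forall fun x => ?_)
      rw [mul_comm, Complex.norm_exp_ofReal_mul_I]
    simp_rw [sub_mul, one_mul]
    rw [integral_sub hi hgC, this, sub_zero, Real.fourier_eq']
    refine integral_congr_ae (Eventually.of_forall fun x => ?_)
    simp only [smul_eq_mul]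
    rw [mul_comm Complex.I]
  rw [e]
  have h1 : ∀ x, ‖(Complex.exp (Complex.I * ((-2 * Real.pi * inner ℝ x k : ℝ) : ℂ)) - 1) *
      (g x : ℂ)‖ ≤ (2 * Real.pi * r * ‖k‖) * |g x| := by
    intro x
    rw [norm_mul, Complex.norm_real, Real.norm_eq_abs]
    by_cases hx : r < ‖x‖
    · simp [hr x hx]
    refine mul_le_mul_of_nonneg_right ?_ (abs_nonneg _)
    refine Real.norm_exp_I_mul_ofReal_sub_one_le.trans ?_
    rw [Real.norm_eq_abs, abs_mul, abs_mul, abs_neg, abs_of_pos Real.pi_pos, abs_two, mul_assoc,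
      mul_assoc, mul_assoc]
    gcongr
    exact (abs_real_inner_le_norm x k).trans (by gcongr; exact not_lt.1 hx)
  refine (norm_integral_le_of_norm_le (hg.abs.const_mul _) (Eventually.of_forall h1)).trans ?_
  rw [integral_const_mul]
  exact le_of_eq (by ring)

/-- Second-order bound at the origin for the Fourier transform of an even probability density. -/
theorem norm_one_sub_fourier_le_of_even {g : Plane → ℝ} (hg : Integrable g) {r : ℝ}
    (hr : ∀ x, r < ‖x‖ → g x = 0) (h1 : ∫ x, g x = 1) (he : ∀ x, g (-x) = g x) (k : Plane) :
    ‖1 - FourierTransform.fourier (fun x => (g x : ℂ)) k‖ ≤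
      (2 * Real.pi ^ 2 * r ^ 2 * ∫ x, |g x|) * ‖k‖ ^ 2 := by
  set E : Plane → ℂ := fun x => Complex.exp (((-2 * Real.pi * inner ℝ x k : ℝ) : ℂ) * Complex.I)
    with hE
  have hgC : Integrable fun x => (g x : ℂ) := hg.ofReal
  have hEi : ∀ s : Plane → Plane, Continuous s → Integrable fun x => E (s x) * (g x : ℂ) := by
    intro s hs
    refine hgC.bdd_mul (c := 1) (by fun_prop) (Eventually.of_forall fun x => ?_)
    rw [hE, Complex.norm_exp_ofReal_mul_I]
  have e1 : FourierTransform.fourier (fun x => (g x : ℂ)) k = ∫ x, E x * (g x : ℂ) := by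
    rw [Real.fourier_eq']
    rfl
  -- By evenness, the imaginary exponential can be replaced by a cosine.
  have e2 : FourierTransform.fourier (fun x => (g x : ℂ)) k = ∫ x, E (-x) * (g x : ℂ) := by
    rw [e1, ← integral_neg_eq_self]
    simp_rw [he]
  have e3 : 1 - FourierTransform.fourier (fun x => (g x : ℂ)) k =
      ∫ x, (((1 - Real.cos (2 * Real.pi * inner ℝ x k)) * g x : ℝ) : ℂ) := by
    have : (1 : ℂ) - FourierTransform.fourier (fun x => (g x : ℂ)) k =
        (∫ x, (g x : ℂ)) - ((∫ x, E x * (g x : ℂ)) + ∫ x, E (-x) * (g x : ℂ)) / 2 := by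
      rw [← e1, ← e2, integral_complex_ofReal, h1]
      push_cast
      ring
    have hp : Integrable fun x => E x * (g x : ℂ) := hEi _ continuous_id
    have hn : Integrable fun x => E (-x) * (g x : ℂ) := hEi _ continuous_neg
    have hpn : Integrable fun x => (E x * (g x : ℂ) + E (-x) * (g x : ℂ)) / 2 :=
      (hp.add hn).div_const 2
    rw [this, ← integral_add hp hn, ← integral_div, ← integral_sub hgC hpn]
    refine integral_congr_ae (Eventually.of_forall fun x => ?_)
    simp only [hE, inner_neg_left]
    push_cast
    rw [Complex.cos]
    have a1 : (-2 * (Real.pi : ℂ) * ((inner ℝ x k : ℝ) : ℂ) * Complex.I) =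
      -(2 * Real.pi * ((inner ℝ x k : ℝ) : ℂ)) * Complex.I := by ring
    have a2 : (-2 * (Real.pi : ℂ) * -((inner ℝ x k : ℝ) : ℂ) * Complex.I) =
      (2 * Real.pi * ((inner ℝ x k : ℝ) : ℂ)) * Complex.I := by ring
    rw [a1, a2]
    ring
  rw [e3, integral_complex_ofReal, Complex.norm_real]
  have h2 : ∀ x, ‖(1 - Real.cos (2 * Real.pi * inner ℝ x k)) * g x‖ ≤
      (2 * Real.pi ^ 2 * r ^ 2 * ‖k‖ ^ 2) * |g x| := by
    intro x
    rw [norm_mul, Real.norm_eq_abs, Real.norm_eq_abs]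
    by_cases hx : r < ‖x‖
    · simp [hr x hx]
    refine mul_le_mul_of_nonneg_right ?_ (abs_nonneg _)
    rw [abs_of_nonneg (by linarith [Real.cos_le_one (2 * Real.pi * inner ℝ x k)])]
    have a1 := Real.one_sub_sq_div_two_le_cos (x := 2 * Real.pi * inner ℝ x k)
    have a2 : (inner ℝ x k) ^ 2 ≤ (r * ‖k‖) ^ 2 := by
      rw [sq_le_sq]
      refine (abs_real_inner_le_norm x k).trans (le_trans ?_ (le_abs_self _))
      gcongr
      exact not_lt.1 hx
    have a3 := mul_le_mul_of_nonneg_left a2 (sq_nonneg Real.pi)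
    nlinarith
  refine (norm_integral_le_of_norm_le (hg.abs.const_mul _) (Eventually.of_forall h2)).trans ?_
  rw [integral_const_mul]
  exact le_of_eq (by ring)

theorem norm_fourier_disk_le {s : ℝ} (hs : 0 ≤ s) (k : Plane) :
    ‖FourierTransform.fourier ((Metric.closedBall (0 : Plane) s).indicator fun _ => (1 : ℂ)) k‖ ≤
      Real.pi * s ^ 2 := by
  refine (VectorFourier.norm_fourierIntegral_le_integral_norm _ _ _ _ _).trans ?_
  simp_rw [norm_indicator_eq_indicator_norm]
  rw [integral_indicator measurableSet_closedBall, setIntegral_const, measureReal_def,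
    volume_closedBall_plane 0 hs, ENNReal.toReal_ofReal (by positivity)]
  simp

/-- Along a lacunary sequence of radii, the normalized Fourier transforms of the gradients of the
indicator functions of disks are square summable, uniformly in the frequency: with `t = s ‖k‖`,
the summand is at most a constant times `min (t ^ 2) (1 / t)`, hence than the increment of
`t / (1 + t)` between `t` and `3 t / 2`. -/
theorem sum_norm_fourier_disk_sq_le {s : ℕ → ℝ} (hs : ∀ j, 0 < s j)
    (hs2 : ∀ j, 3 / 2 * s j ≤ s (j + 1)) (n : ℕ) (k : Plane) :
    ∑ j ∈ Finset.range n, ‖k‖ ^ 2 * ‖FourierTransform.fourier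
      ((Metric.closedBall (0 : Plane) (s j)).indicator fun _ => (1 : ℂ)) k‖ ^ 2 / s j ^ 2 ≤
      6000 := by
  set f : ℝ → ℝ := fun t => t / (1 + t) with hf
  have hmono : ∀ a b, 0 ≤ a → a ≤ b → f a ≤ f b := by
    intro a b ha hab
    simp only [hf]
    rw [div_le_div_iff₀ (by linarith) (by linarith)]
    nlinarith
  have hterm : ∀ j, ‖k‖ ^ 2 * ‖FourierTransform.fourier
      ((Metric.closedBall (0 : Plane) (s j)).indicator fun _ => (1 : ℂ)) k‖ ^ 2 / s j ^ 2 ≤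
      6000 * (f (s (j + 1) * ‖k‖) - f (s j * ‖k‖)) := by
    intro j
    have hsj := hs j
    set D := ‖FourierTransform.fourier
      ((Metric.closedBall (0 : Plane) (s j)).indicator fun _ => (1 : ℂ)) k‖ with hD
    have hD0 : 0 ≤ D := norm_nonneg _
    have h1 : D ≤ Real.pi * s j ^ 2 := norm_fourier_disk_le hsj.le k
    have h2 : D ^ 2 * ‖k‖ ^ 3 ≤ 600 * s j := norm_fourier_disk_sq_le hsj k
    set t := s j * ‖k‖ with ht
    have ht0 : 0 ≤ t := by positivity
    have h3 : f (3 / 2 * t) ≤ f (s (j + 1) * ‖k‖) := by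
      refine hmono _ _ (by positivity) ?_
      rw [ht, ← mul_assoc]
      exact mul_le_mul_of_nonneg_right (hs2 j) (norm_nonneg _)
    have h4 : f (3 / 2 * t) - f t = (1 / 2 * t) / ((1 + t) * (1 + 3 / 2 * t)) := by
      simp only [hf]
      field_simp
      ring
    have h5 : ‖k‖ ^ 2 * D ^ 2 / s j ^ 2 ≤ 6000 * (f (3 / 2 * t) - f t) := by
      rw [h4, ← mul_div_assoc, div_le_div_iff₀ (by positivity) (by positivity)]
      rcases le_total t 1 with h | h
      · have hpi : Real.pi ^ 2 ≤ 10 := by nlinarith [Real.pi_lt_d2, Real.pi_pos]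
        have a1 : D ^ 2 ≤ 10 * s j ^ 4 := by
          calc D ^ 2 ≤ (Real.pi * s j ^ 2) ^ 2 := by gcongr
            _ = Real.pi ^ 2 * s j ^ 4 := by ring
            _ ≤ 10 * s j ^ 4 := by gcongr
        have a2 : ‖k‖ ^ 2 * D ^ 2 ≤ 10 * t ^ 2 * s j ^ 2 := by
          calc ‖k‖ ^ 2 * D ^ 2 ≤ ‖k‖ ^ 2 * (10 * s j ^ 4) := by gcongr
            _ = _ := by rw [ht]; ring
        have a3 : t ^ 2 * ((1 + t) * (1 + 3 / 2 * t)) ≤ 5 * t := by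
          have : (1 + t) * (1 + 3 / 2 * t) ≤ 5 := by nlinarith
          calc t ^ 2 * ((1 + t) * (1 + 3 / 2 * t)) ≤ t ^ 2 * 5 := by gcongr
            _ ≤ _ := by nlinarith
        calc ‖k‖ ^ 2 * D ^ 2 * ((1 + t) * (1 + 3 / 2 * t))
            ≤ (10 * t ^ 2 * s j ^ 2) * ((1 + t) * (1 + 3 / 2 * t)) := by gcongr
          _ = 10 * (t ^ 2 * ((1 + t) * (1 + 3 / 2 * t))) * s j ^ 2 := by ring
          _ ≤ 10 * (5 * t) * s j ^ 2 := by gcongr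
          _ ≤ _ := by nlinarith [mul_nonneg ht0 (sq_nonneg (s j))]
      · have hk : 0 < ‖k‖ := by
          by_contra hk
          have : ‖k‖ = 0 := le_antisymm (not_lt.1 hk) (norm_nonneg _)
          rw [ht, this] at h
          norm_num at h
        have a2 : ‖k‖ ^ 2 * D ^ 2 * t ≤ 600 * s j ^ 2 := by
          calc ‖k‖ ^ 2 * D ^ 2 * t = (D ^ 2 * ‖k‖ ^ 3) * s j := by rw [ht]; ring
            _ ≤ 600 * s j * s j := by gcongr
            _ = _ := by ring
        have a3 : (1 + t) * (1 + 3 / 2 * t) ≤ 5 * t ^ 2 := by nlinarith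
        calc ‖k‖ ^ 2 * D ^ 2 * ((1 + t) * (1 + 3 / 2 * t))
            ≤ ‖k‖ ^ 2 * D ^ 2 * (5 * t ^ 2) := by gcongr
          _ = 5 * t * (‖k‖ ^ 2 * D ^ 2 * t) := by ring
          _ ≤ 5 * t * (600 * s j ^ 2) := by gcongr
          _ = _ := by ring
    linarith
  refine (Finset.sum_le_sum fun j _ => hterm j).trans ?_
  rw [← Finset.mul_sum, Finset.sum_range_sub (fun j => f (s j * ‖k‖))]
  have h0 : 0 ≤ f (s 0 * ‖k‖) := by
    have := (hs 0).le
    positivity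
  have h1 : f (s n * ‖k‖) ≤ 1 := by
    have : 0 ≤ s n * ‖k‖ := mul_nonneg (hs n).le (norm_nonneg _)
    simp only [hf]
    rw [div_le_one (by linarith)]
    linarith
  linarith

/-- The multiplier of the difference between a disk and its mollification by an even kernel: the
second-order cancellation at low frequencies and the decay `‖k‖ ^ (-3)` of the squared Fourier
transform of the disk combine into a bound uniform in the frequency. -/
theorem exists_norm_fourier_indicator_sub_smoothedDisk_sq_le {g : Plane → ℝ} (hg : Integrable g)
    {r : ℝ} (hr : ∀ x, r < ‖x‖ → g x = 0) (h1 : ∫ x, g x = 1) (he : ∀ x, g (-x) = g x) :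
    ∃ C : ℝ, 0 ≤ C ∧ ∀ s : ℝ, 0 < s → ∀ k : Plane, ‖FourierTransform.fourier (fun x =>
      (((Metric.closedBall (0 : Plane) s).indicator (fun _ => (1 : ℝ)) x - smoothedDisk s g x : ℝ)
        : ℂ)) k‖ ^ 2 ≤ C * s := by
  set L := 2 * Real.pi ^ 2 * r ^ 2 * ∫ x, |g x| with hL
  set M := max L (1 + ∫ x, |g x|) with hM
  have hM0 : 0 ≤ M := le_trans (by positivity) (le_max_right _ _)
  refine ⟨600 * M ^ 2, by positivity, fun s hs k => ?_⟩
  set D := FourierTransform.fourier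
      ((Metric.closedBall (0 : Plane) s).indicator fun _ => (1 : ℂ)) k with hD
  set G := FourierTransform.fourier (fun x => (g x : ℂ)) k with hG
  have hgC : Integrable fun x => (g x : ℂ) := hg.ofReal
  have hiC : Integrable ((Metric.closedBall (0 : Plane) s).indicator fun _ => (1 : ℂ)) :=
    (integrable_indicator_iff measurableSet_closedBall).2
      (integrableOn_const (isCompact_closedBall _ _).measure_lt_top.ne)
  have e : FourierTransform.fourier (fun x =>
      (((Metric.closedBall (0 : Plane) s).indicator (fun _ => (1 : ℝ)) x - smoothedDisk s g x : ℝ)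
        : ℂ)) k = D * (1 - G) := by
    have hsd : Integrable fun x => (smoothedDisk s g x : ℂ) := by
      rw [smoothedDisk_eq_convolution]
      exact ((integrable_indicator_closedBall s).integrable_convolution _ hg).ofReal
    have hsub := Real.fourier_eq' (fun x =>
      (((Metric.closedBall (0 : Plane) s).indicator (fun _ => (1 : ℝ)) x - smoothedDisk s g x : ℝ)
        : ℂ)) k
    rw [mul_sub, mul_one, ← fourier_smoothedDisk s hg k, hsub, hD, Real.fourier_eq',
      Real.fourier_eq', ← integral_sub]
    · refine integral_congr_ae (Eventually.of_forall fun x => ?_)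
      simp only [smul_eq_mul]
      rw [← mul_sub]
      congr 1
      by_cases hx : x ∈ Metric.closedBall (0 : Plane) s <;> simp [hx]
    · refine hiC.bdd_mul (c := 1) (by fun_prop) (Eventually.of_forall fun x => ?_)
      rw [Complex.norm_exp_ofReal_mul_I]
    · refine hsd.bdd_mul (c := 1) (by fun_prop) (Eventually.of_forall fun x => ?_)
      rw [Complex.norm_exp_ofReal_mul_I]
  have hG1 : ‖1 - G‖ ≤ L * ‖k‖ ^ 2 := norm_one_sub_fourier_le_of_even hg hr h1 he k
  have hG2 : ‖1 - G‖ ≤ 1 + ∫ x, |g x| := by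
    refine (norm_sub_le _ _).trans ?_
    rw [norm_one]
    gcongr
    refine (VectorFourier.norm_fourierIntegral_le_integral_norm _ _ _ _ _).trans (le_of_eq ?_)
    simp
  have h3 : ‖1 - G‖ ^ 2 ≤ M ^ 2 * ‖k‖ ^ 3 := by
    rcases le_total ‖k‖ 1 with h | h
    · calc ‖1 - G‖ ^ 2 ≤ (M * ‖k‖ ^ 2) ^ 2 := by
            gcongr
            exact hG1.trans (by gcongr; exact le_max_left _ _)
        _ = M ^ 2 * (‖k‖ ^ 3 * ‖k‖) := by ring
        _ ≤ M ^ 2 * (‖k‖ ^ 3 * 1) := by gcongr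
        _ = _ := by ring
    · calc ‖1 - G‖ ^ 2 ≤ M ^ 2 * 1 := by
            rw [mul_one]
            gcongr
            exact hG2.trans (le_max_right _ _)
        _ ≤ M ^ 2 * ‖k‖ ^ 3 := by gcongr; exact one_le_pow₀ h
  rw [e, norm_mul, mul_pow]
  calc ‖D‖ ^ 2 * ‖1 - G‖ ^ 2 ≤ ‖D‖ ^ 2 * (M ^ 2 * ‖k‖ ^ 3) := by gcongr
    _ = M ^ 2 * (‖D‖ ^ 2 * ‖k‖ ^ 3) := by ring
    _ ≤ M ^ 2 * (600 * s) :=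
        mul_le_mul_of_nonneg_left (norm_fourier_disk_sq_le hs k) (sq_nonneg _)
    _ = _ := by ring

/-! ### Averages of linear statistics over small translations -/

theorem exists_even_mollifier : ∃ φ : Plane → ℝ, ContDiff ℝ (⊤ : ℕ∞) φ ∧
    (∀ x, 1 < ‖x‖ → φ x = 0) ∧ ∫ x, φ x = 1 ∧ ∀ x, φ (-x) = φ x := by
  let f : ContDiffBump (0 : Plane) := ⟨1 / 2, 1, by norm_num, by norm_num⟩
  refine ⟨f.normed volume, f.contDiff_normed, fun x hx => ?_, f.integral_normed, f.normed_neg⟩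
  by_contra h
  have : x ∈ Function.support (f.normed volume) := h
  rw [f.support_normed_eq, mem_ball_zero_iff] at this
  exact absurd this (not_lt.2 hx.le)

theorem integral_fderiv_eq_zero {φ : Plane → ℝ} (hφ : ContDiff ℝ (⊤ : ℕ∞) φ)
    (hφc : HasCompactSupport φ) (v : Plane) : ∫ x, fderiv ℝ φ x v = 0 := by
  have h : IsGradientField (fun _ : Plane => (1 : ℝ)) fun _ => 0 :=
    ⟨continuous_const, fun x => by simpa using hasFDerivAt_const (1 : ℝ) x⟩
  have := integral_fderiv_mul_eq_neg h (hφ.of_le (by simp)) hφc v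
  simpa using this

theorem fourier_const_mul (c : ℝ) (f : Plane → ℝ) (k : Plane) :
    FourierTransform.fourier (fun x => ((c * f x : ℝ) : ℂ)) k =
      c * FourierTransform.fourier (fun x => (f x : ℂ)) k := by
  rw [Real.fourier_eq', Real.fourier_eq', ← integral_const_mul]
  refine integral_congr_ae (Eventually.of_forall fun x => ?_)
  simp only [smul_eq_mul]
  push_cast
  ring

theorem integrable_prod_of_bounded {ξ ν : Measure Plane} [SFinite ξ] [SFinite ν] {a b : ℝ}
    (ha : ξ (Metric.closedBall 0 a) < ∞) (hb : ν (Metric.closedBall 0 b) < ∞)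
    {f : Plane × Plane → ℝ} (hf : Measurable f) {C : ℝ} (hC : ∀ p, |f p| ≤ C)
    (h0 : ∀ p, f p ≠ 0 → ‖p.1‖ ≤ a ∧ ‖p.2‖ ≤ b) : Integrable f (ξ.prod ν) := by
  set S : Set (Plane × Plane) := Metric.closedBall 0 a ×ˢ Metric.closedBall 0 b with hS
  have hSm : MeasurableSet S := measurableSet_closedBall.prod measurableSet_closedBall
  have hfin : (ξ.prod ν) S ≠ ∞ := by
    rw [hS, Measure.prod_prod]
    exact (ENNReal.mul_lt_top ha hb).ne
  have hi : Integrable (S.indicator fun _ => C) (ξ.prod ν) :=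
    (integrable_indicator_iff hSm).2 (integrableOn_const hfin)
  refine hi.mono' hf.aestronglyMeasurable (Eventually.of_forall fun p => ?_)
  by_cases hp : p ∈ S
  · rw [Set.indicator_of_mem hp]
    exact hC p
  · rw [Set.indicator_of_notMem hp]
    by_contra h
    refine hp ?_
    have := h0 p (fun h' => h (by rw [h', norm_zero]))
    rw [hS, Set.mem_prod, mem_closedBall_zero_iff, mem_closedBall_zero_iff]
    exact this

namespace IsStationaryFlow

variable {Ω : Type*} [MeasurableSpace Ω] {θ : Plane → Ω → Ω} {P : Measure Ω} {τ : Ω → Plane}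

theorem measurable_integral_displacedLebesgue (hθ : IsStationaryFlow θ P) (hτ : Measurable τ)
    {f : Plane → ℝ} (hf : Measurable f) :
    Measurable fun ω => ∫ z, f z ∂displacedLebesgue θ τ ω := by
  simp_rw [hθ.integral_displacedLebesgue hτ _ hf]
  exact (StronglyMeasurable.integral_prod_right'
    (hf.comp (hθ.measurable_displacement hτ)).stronglyMeasurable).measurable

theorem integral_displacedLebesgue_comp (hθ : IsStationaryFlow θ P) (hτ : Measurable τ)
    {f : Plane → ℝ} (hf : Measurable f) (w : Plane) (ω : Ω) :
    ∫ z, f z ∂displacedLebesgue θ τ (θ w ω) = ∫ x, f (x - w) ∂displacedLebesgue θ τ ω := by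
  rw [hθ.displacedLebesgue_comp hτ,
    integral_map (measurable_sub_const w).aemeasurable hf.aestronglyMeasurable]

theorem toReal_displacedLebesgue (hθ : IsStationaryFlow θ P) (hτ : Measurable τ) (s : ℝ)
    (w : Plane) (ω : Ω) :
    (displacedLebesgue θ τ (θ w ω) (Metric.closedBall 0 s)).toReal =
      ∫ x, (Metric.closedBall (0 : Plane) s).indicator (fun _ => (1 : ℝ)) (x - w)
        ∂displacedLebesgue θ τ ω := by
  rw [← hθ.integral_displacedLebesgue_comp hτ (measurable_indicator_closedBall s) w ω,
    integral_indicator measurableSet_closedBall, setIntegral_const, smul_eq_mul, mul_one]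
  rfl

/-- Integrating a linear statistic over small translations amounts to replacing the random measure
by the masses it gives to small disks. -/
theorem setIntegral_integral_displacedLebesgue (hθ : IsStationaryFlow θ P) (hτ : Measurable τ)
    {ω : Ω} (hω : ∀ r, displacedLebesgue θ τ ω (Metric.closedBall 0 r) < ∞) {k : Plane → ℝ}
    (hk : Measurable k) {C : ℝ} (hkC : ∀ x, |k x| ≤ C) {R : ℝ} (hkR : ∀ x, R < ‖x‖ → k x = 0)
    (δ : ℝ) :
    IntegrableOn (fun w => ∫ z, k z ∂displacedLebesgue θ τ (θ w ω)) (Metric.closedBall 0 δ) ∧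
    ∫ w in Metric.closedBall 0 δ, (∫ z, k z ∂displacedLebesgue θ τ (θ w ω)) =
      ∫ z, k z * (displacedLebesgue θ τ (θ z ω) (Metric.closedBall 0 δ)).toReal := by
  have : SFinite (displacedLebesgue θ τ ω) := by
    rw [displacedLebesgue]; infer_instance
  set ξ := displacedLebesgue θ τ ω with hξ
  set β : Plane → ℝ := (Metric.closedBall (0 : Plane) δ).indicator fun _ => (1 : ℝ) with hβ
  have hβm : Measurable β := measurable_indicator_closedBall δ
  have hβ0 : ∀ x, β x ≠ 0 → ‖x‖ ≤ δ := fun x hx => by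
    by_contra h
    refine hx (Set.indicator_of_notMem ?_ _)
    rwa [mem_closedBall_zero_iff]
  have hk0 : ∀ x, k x ≠ 0 → ‖x‖ ≤ R := fun x hx => by
    by_contra h
    exact hx (hkR x (not_le.1 h))
  have hC0 : 0 ≤ C := (abs_nonneg _).trans (hkC 0)
  have hvol : ∀ a : ℝ, (volume : Measure Plane) (Metric.closedBall 0 a) < ∞ := fun a =>
    (isCompact_closedBall _ _).measure_lt_top
  have hbd : ∀ x y, |β x * k y| ≤ C := fun x y => by
    rw [abs_mul]
    calc |β x| * |k y| ≤ 1 * C := by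
          gcongr
          · exact abs_indicator_closedBall_le _ _
          · exact hkC y
      _ = C := one_mul C
  have hI1 : Integrable (fun p : Plane × Plane => β p.1 * k (p.2 - p.1)) (volume.prod ξ) := by
    refine integrable_prod_of_bounded (a := δ) (b := R + δ) (hvol _) (hω _)
      ((hβm.comp measurable_fst).mul (hk.comp (measurable_snd.sub measurable_fst)))
      (fun p => hbd _ _) fun p hp => ?_
    have h1 := hβ0 _ (left_ne_zero_of_mul hp)
    have h2 := hk0 _ (right_ne_zero_of_mul hp)
    have h3 := norm_sub_norm_le p.2 p.1
    exact ⟨h1, by linarith⟩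
  have hI2 : Integrable (fun p : Plane × Plane => β (p.2 - p.1) * k p.1) (volume.prod ξ) := by
    refine integrable_prod_of_bounded (a := R) (b := R + δ) (hvol _) (hω _)
      ((hβm.comp (measurable_snd.sub measurable_fst)).mul (hk.comp measurable_fst))
      (fun p => hbd _ _) fun p hp => ?_
    have h1 := hβ0 _ (left_ne_zero_of_mul hp)
    have h2 := hk0 _ (right_ne_zero_of_mul hp)
    have h3 := norm_sub_norm_le p.2 p.1
    exact ⟨h2, by linarith⟩
  have e0 : ∀ w, (Metric.closedBall (0 : Plane) δ).indicator
      (fun w => ∫ z, k z ∂displacedLebesgue θ τ (θ w ω)) w = ∫ x, β w * k (x - w) ∂ξ := by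
    intro w
    rw [integral_const_mul, ← hθ.integral_displacedLebesgue_comp hτ hk]
    by_cases hw : w ∈ Metric.closedBall (0 : Plane) δ <;> simp [hβ, hw]
  constructor
  · rw [← integrable_indicator_iff measurableSet_closedBall]
    exact hI1.integral_prod_left.congr (Eventually.of_forall fun w => (e0 w).symm)
  rw [← integral_indicator measurableSet_closedBall]
  calc ∫ w, (Metric.closedBall (0 : Plane) δ).indicator
        (fun w => ∫ z, k z ∂displacedLebesgue θ τ (θ w ω)) w
      = ∫ w, (∫ x, β w * k (x - w) ∂ξ) := integral_congr_ae (Eventually.of_forall e0)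
    _ = ∫ x, (∫ w, β w * k (x - w)) ∂ξ := integral_integral_swap hI1
    _ = ∫ x, (∫ z, β (x - z) * k z) ∂ξ := by
        refine integral_congr_ae (Eventually.of_forall fun x => ?_)
        simp only
        rw [← integral_sub_left_eq_self (fun w => β w * k (x - w)) _ x]
        simp
    _ = ∫ z, (∫ x, β (x - z) * k z ∂ξ) := (integral_integral_swap hI2).symm
    _ = _ := by
        refine integral_congr_ae (Eventually.of_forall fun z => ?_)
        simp only
        rw [integral_mul_const, hθ.toReal_displacedLebesgue hτ, mul_comm]

end IsStationaryFlow

/-- The fluctuation of the linear statistic associated with a disk mollified by `g`, around its mean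
value when `g` has integral `1`. -/
noncomputable def diskFluctuation {Ω : Type*} (θ : Plane → Ω → Ω) (τ : Ω → Plane) (g : Plane → ℝ)
    (s : ℝ) (ω : Ω) : ℝ :=
  (∫ z, smoothedDisk s g z ∂displacedLebesgue θ τ ω) - Real.pi * s ^ 2

/-- The difference between the indicator function of a disk and its mollification, integrated
against the masses of the disks of radius `δ`. -/
noncomputable def boundaryFluctuation {Ω : Type*} (θ : Plane → Ω → Ω) (τ : Ω → Plane)
    (g : Plane → ℝ) (δ s : ℝ) (ω : Ω) : ℝ :=
  ∫ z, ((Metric.closedBall (0 : Plane) s).indicator (fun _ => (1 : ℝ)) z - smoothedDisk s g z) *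
    (displacedLebesgue θ τ (θ z ω) (Metric.closedBall 0 δ)).toReal

namespace IsStationaryFlow

variable {Ω : Type*} [MeasurableSpace Ω] {θ : Plane → Ω → Ω} {P : Measure Ω} {τ : Ω → Plane}

theorem measurable_diskFluctuation (hθ : IsStationaryFlow θ P) (hτ : Measurable τ)
    {g : Plane → ℝ} (hg : Measurable g) (s : ℝ) : Measurable (diskFluctuation θ τ g s) :=
  (hθ.measurable_integral_displacedLebesgue hτ (measurable_smoothedDisk s hg)).sub_const _

theorem measurable_toReal_displacedLebesgue (hθ : IsStationaryFlow θ P) (hτ : Measurable τ)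
    (δ : ℝ) : Measurable fun ω => (displacedLebesgue θ τ ω (Metric.closedBall 0 δ)).toReal :=
  ((Measure.measurable_coe measurableSet_closedBall).comp
    (hθ.measurable_displacedLebesgue hτ)).ennreal_toReal

theorem measurable_boundaryFluctuation (hθ : IsStationaryFlow θ P) (hτ : Measurable τ)
    {g : Plane → ℝ} (hg : Measurable g) (δ s : ℝ) :
    Measurable (boundaryFluctuation θ τ g δ s) := by
  refine (StronglyMeasurable.integral_prod_right' (f := fun p : Ω × Plane =>
    ((Metric.closedBall (0 : Plane) s).indicator (fun _ => (1 : ℝ)) p.2 - smoothedDisk s g p.2) *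
    (displacedLebesgue θ τ (θ p.2 p.1) (Metric.closedBall 0 δ)).toReal) ?_).measurable
  refine Measurable.stronglyMeasurable (Measurable.mul ?_ ?_)
  · exact ((measurable_indicator_closedBall s).sub (measurable_smoothedDisk s hg)).comp
      measurable_snd
  · exact hθ.measurable_comp (hθ.measurable_toReal_displacedLebesgue hτ δ) measurable_snd
      measurable_fst

/-- The integral over small translations of the mass of a disk, split into its mean value, the
contribution of the mollified disk and the boundary term. -/
theorem setIntegral_toReal_displacedLebesgue (hθ : IsStationaryFlow θ P) (hτ : Measurable τ)
    {ω : Ω} (hω : ∀ r, displacedLebesgue θ τ ω (Metric.closedBall 0 r) < ∞) {g : Plane → ℝ}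
    (hg : Integrable g) (hgm : Measurable g) {R : ℝ} (hR : 0 ≤ R) (hgR : ∀ x, R < ‖x‖ → g x = 0)
    {δ : ℝ} (hδ : 0 ≤ δ) (s : ℝ) :
    IntegrableOn (fun w => (displacedLebesgue θ τ (θ w ω) (Metric.closedBall 0 s)).toReal)
      (Metric.closedBall 0 δ) ∧
    ∫ w in Metric.closedBall 0 δ,
        (displacedLebesgue θ τ (θ w ω) (Metric.closedBall 0 s)).toReal =
      Real.pi * δ ^ 2 * (Real.pi * s ^ 2) +
        (∫ w in Metric.closedBall 0 δ, diskFluctuation θ τ g s (θ w ω)) +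
        boundaryFluctuation θ τ g δ s ω := by
  set H : Plane → ℝ := (Metric.closedBall (0 : Plane) s).indicator fun _ => (1 : ℝ) with hH
  have hHm : Measurable H := measurable_indicator_closedBall s
  have hSm : Measurable (smoothedDisk s g) := measurable_smoothedDisk s hgm
  have hH0 : ∀ x, s + R < ‖x‖ → H x = 0 := fun x hx => by
    refine Set.indicator_of_notMem ?_ _
    rw [mem_closedBall_zero_iff]
    linarith
  have hS0 : ∀ x, s + R < ‖x‖ → smoothedDisk s g x = 0 := fun x hx => smoothedDisk_eq_zero hgR hx
  have hSb := fun x => abs_smoothedDisk_le (s := s) hg x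
  have hHb := fun x => abs_indicator_closedBall_le s x
  obtain ⟨i1, -⟩ := hθ.setIntegral_integral_displacedLebesgue hτ hω hHm hHb hH0 δ
  obtain ⟨i2, -⟩ := hθ.setIntegral_integral_displacedLebesgue hτ hω hSm hSb hS0 δ
  obtain ⟨i3, e3⟩ := hθ.setIntegral_integral_displacedLebesgue hτ hω (hHm.sub hSm)
    (C := 1 + ∫ x, |g x|) (fun x => (abs_sub _ _).trans (add_le_add (hHb x) (hSb x)))
    (R := s + R) (fun x hx => by rw [Pi.sub_apply, hH0 x hx, hS0 x hx, sub_zero]) δ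
  have e0 : ∀ w, (displacedLebesgue θ τ (θ w ω) (Metric.closedBall 0 s)).toReal =
      ∫ z, H z ∂displacedLebesgue θ τ (θ w ω) := fun w => by
    rw [hθ.toReal_displacedLebesgue hτ, hθ.integral_displacedLebesgue_comp hτ hHm]
  have hfin : ∀ w r, displacedLebesgue θ τ (θ w ω) (Metric.closedBall 0 r) < ∞ := by
    intro w r
    rw [hθ.displacedLebesgue_comp hτ, Measure.map_apply (measurable_sub_const w)
      measurableSet_closedBall]
    refine (measure_mono fun x hx => ?_).trans_lt (hω (r + ‖w‖))
    rw [Set.mem_preimage, mem_closedBall_zero_iff] at hx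
    rw [mem_closedBall_zero_iff]
    have := norm_sub_norm_le x w
    linarith
  have hint : ∀ w {f : Plane → ℝ} {C : ℝ}, Measurable f → (∀ x, |f x| ≤ C) →
      (∀ x, s + R < ‖x‖ → f x = 0) → Integrable f (displacedLebesgue θ τ (θ w ω)) := by
    intro w f C hf hfC hf0
    refine ((integrable_indicator_iff (measurableSet_closedBall (x := (0 : Plane)) (ε := s + R))).2
      (integrableOn_const (C := C) (hfin w (s + R)).ne)).mono' hf.aestronglyMeasurable
      (Eventually.of_forall fun x => ?_)
    by_cases hx : x ∈ Metric.closedBall (0 : Plane) (s + R)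
    · rw [Set.indicator_of_mem hx]
      exact hfC x
    · rw [Set.indicator_of_notMem hx]
      rw [mem_closedBall_zero_iff, not_le] at hx
      rw [hf0 x hx, norm_zero]
  have e1 : ∀ w, ∫ z, H z ∂displacedLebesgue θ τ (θ w ω) =
      Real.pi * s ^ 2 + diskFluctuation θ τ g s (θ w ω) +
        ∫ z, (H - smoothedDisk s g) z ∂displacedLebesgue θ τ (θ w ω) := by
    intro w
    rw [integral_sub' (hint w hHm hHb hH0) (hint w hSm hSb hS0), diskFluctuation]
    ring
  simp_rw [e0]
  refine ⟨i1, ?_⟩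
  simp_rw [e1]
  have hc : IntegrableOn (fun _ : Plane => Real.pi * s ^ 2) (Metric.closedBall 0 δ) :=
    integrableOn_const (isCompact_closedBall _ _).measure_lt_top.ne
  have hd : IntegrableOn (fun w => diskFluctuation θ τ g s (θ w ω)) (Metric.closedBall 0 δ) :=
    i2.sub hc
  have hcd : IntegrableOn (fun w => Real.pi * s ^ 2 + diskFluctuation θ τ g s (θ w ω))
      (Metric.closedBall 0 δ) := hc.add hd
  rw [integral_add hcd i3, integral_add hc hd, e3, setIntegral_const, measureReal_def,
    volume_closedBall_plane 0 hδ, ENNReal.toReal_ofReal (by positivity), smul_eq_mul]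
  rfl

end IsStationaryFlow

/-! ### Variances of mollified disks and of boundary terms -/

theorem enorm_sq_eq_ofReal {E : Type*} [SeminormedAddCommGroup E] (x : E) :
    ‖x‖ₑ ^ 2 = ENNReal.ofReal (‖x‖ ^ 2) := by
  rw [← ofReal_norm, ENNReal.ofReal_pow (norm_nonneg _)]

namespace IsStationaryFlow

variable {Ω : Type*} [MeasurableSpace Ω] {θ : Plane → Ω → Ω} {P : Measure Ω} {τ : Ω → Plane}

/-- The square function estimate for averages along the orbits against mollified disks, normalized
by their radii, with a mollifier of zero integral: the sum over a lacunary sequence of radii is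
bounded independently of the number of terms. -/
theorem sum_lintegral_smoothedDisk_sq_le [IsProbabilityMeasure P] (hθ : IsStationaryFlow θ P)
    {q : Plane → ℝ} (hqi : Integrable q) (hqm : Measurable q) (hq0 : ∀ x, 1 < ‖x‖ → q x = 0)
    (hqI : ∫ x, q x = 0) {u : Ω → ℝ} (hu : Measurable u) (hu2 : ∫⁻ ω, ‖u ω‖ₑ ^ 2 ∂P < ∞)
    {s : ℕ → ℝ} (hs : ∀ j, 0 < s j) (hs2 : ∀ j, 3 / 2 * s j ≤ s (j + 1)) (n : ℕ) :
    ∑ j ∈ Finset.range n, ∫⁻ ω, ‖∫ z, ((s j)⁻¹ * smoothedDisk (s j) q z) * u (θ z ω)‖ₑ ^ 2 ∂P ≤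
      ENNReal.ofReal (6000 * (2 * Real.pi * 1 * ∫ x, |q x|) ^ 2) * ∫⁻ ω, ‖u ω‖ₑ ^ 2 ∂P := by
  set L : ℝ := 2 * Real.pi * 1 * ∫ x, |q x| with hL
  have hqF : ∀ k, ‖FourierTransform.fourier (fun x => (q x : ℂ)) k‖ ≤ L * ‖k‖ := fun k =>
    norm_fourier_le_of_integral_eq_zero hqi hq0 hqI k
  set K : ℕ → Plane → ℝ := fun j z => (s j)⁻¹ * smoothedDisk (s j) q z with hK
  have hKm : ∀ j ∈ Finset.range n, Measurable (K j) := fun j _ =>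
    (measurable_smoothedDisk (s j) hqm).const_mul _
  have hKb : ∀ j ∈ Finset.range n, ∃ C, ∀ x, |K j x| ≤ C := fun j _ =>
    ⟨(s j)⁻¹ * ∫ z, |q z|, fun x => by
      simp only [hK]
      rw [abs_mul, abs_of_pos (inv_pos.2 (hs j))]
      exact mul_le_mul_of_nonneg_left (abs_smoothedDisk_le hqi x) (inv_pos.2 (hs j)).le⟩
  have hρ : 0 ≤ ∑ j ∈ Finset.range n, s j + 1 :=
    add_nonneg (Finset.sum_nonneg fun j _ => (hs j).le) zero_le_one
  have hKs : ∀ j ∈ Finset.range n, ∀ x, ∑ j ∈ Finset.range n, s j + 1 < ‖x‖ → K j x = 0 := by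
    intro j hj x hx
    have := Finset.single_le_sum (f := s) (fun j _ => (hs j).le) hj
    simp only [hK]
    rw [smoothedDisk_eq_zero hq0 (by linarith), mul_zero]
  have hM : ∀ k, ∑ j ∈ Finset.range n,
      ‖FourierTransform.fourier (fun x => (K j x : ℂ)) k‖ₑ ^ 2 ≤
        ENNReal.ofReal (6000 * L ^ 2) := by
    intro k
    simp_rw [enorm_sq_eq_ofReal]
    rw [← ENNReal.ofReal_sum_of_nonneg fun j _ => sq_nonneg _]
    refine ENNReal.ofReal_le_ofReal ?_
    have hj : ∀ j, ‖FourierTransform.fourier (fun x => (K j x : ℂ)) k‖ ^ 2 ≤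
        L ^ 2 * (‖k‖ ^ 2 * ‖FourierTransform.fourier
          ((Metric.closedBall (0 : Plane) (s j)).indicator fun _ => (1 : ℂ)) k‖ ^ 2 /
            s j ^ 2) := by
      intro j
      simp only [hK]
      rw [fourier_const_mul, fourier_smoothedDisk _ hqi, norm_mul, norm_mul,
        Complex.norm_real, norm_inv, Real.norm_of_nonneg (hs j).le]
      have hsj := hs j
      set D := ‖FourierTransform.fourier
          ((Metric.closedBall (0 : Plane) (s j)).indicator fun _ => (1 : ℂ)) k‖
      have hD0 : 0 ≤ D := norm_nonneg _
      calc _ ≤ ((s j)⁻¹ * (D * (L * ‖k‖))) ^ 2 := by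
            gcongr
            exact hqF k
        _ = _ := by
            have := hsj.ne'
            field_simp
    refine (Finset.sum_le_sum fun j _ => hj j).trans ?_
    rw [← Finset.mul_sum, mul_comm]
    exact mul_le_mul_of_nonneg_right (sum_norm_fourier_disk_sq_le hs hs2 n k) (sq_nonneg _)
  exact hθ.sum_lintegral_average_sq_le (Finset.range n) K hKm hKb hρ hKs _ hM hu hu2

/-- The normalized variances of mollified disks are summable along lacunary sequences of radii. The
fluctuation of a disk mollified by a smeared charge is the integral of the stationary field against
a gradient, whose components are disks mollified by the derivatives of `φ`, of zero integral. -/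
theorem exists_sum_lintegral_diskFluctuation_le [IsProbabilityMeasure P]
    (hθ : IsStationaryFlow θ P) (hτ : Measurable τ) {α : ℝ} (hα : 0 < α)
    (hm : ∫⁻ ω, ENNReal.ofReal ((1 + ‖τ ω‖) ^ (2 + α)) ∂P < ∞) {φ : Plane → ℝ}
    (hφ : ContDiff ℝ (⊤ : ℕ∞) φ) (hφ0 : ∀ x, 1 < ‖x‖ → φ x = 0) (hφ1 : ∫ x, φ x = 1) :
    ∃ C : ℝ≥0∞, C < ∞ ∧ ∀ s : ℕ → ℝ, (∀ j, 0 < s j) → (∀ j, 3 / 2 * s j ≤ s (j + 1)) → ∀ n,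
      ∑ j ∈ Finset.range n, ENNReal.ofReal ((s j)⁻¹ ^ 2) *
        ∫⁻ ω, ‖diskFluctuation θ τ (smearedCharge 1 φ) (s j) ω‖ₑ ^ 2 ∂P ≤ C := by
  obtain ⟨e, he, heL, hfield⟩ := hθ.exists_field hτ hα hm one_pos
  have hφc : HasCompactSupport φ := hasCompactSupport_of_radius hφ0
  have hφi : Integrable φ := hφ.continuous.integrable_of_hasCompactSupport hφc
  set v : Fin 2 → Plane := fun i => EuclideanSpace.single i 1 with hv
  set q : Fin 2 → Plane → ℝ := fun i y => fderiv ℝ φ y (v i) with hq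
  have hqc : ∀ i, Continuous (q i) := fun i =>
    (hφ.continuous_fderiv (by simp)).clm_apply continuous_const
  have hq0 : ∀ i x, 1 < ‖x‖ → q i x = 0 := fun i x hx => by
    simp only [hq, fderiv_eq_zero_of_radius hφ0 hx]; rfl
  have hqi : ∀ i, Integrable (q i) := fun i =>
    (hqc i).integrable_of_hasCompactSupport (hasCompactSupport_of_radius (hq0 i))
  have hu : ∀ i, Measurable fun ω => e ω i := fun i =>
    (EuclideanSpace.proj (𝕜 := ℝ) i).continuous.measurable.comp he
  have he2 : ∫⁻ ω, ‖e ω‖ₑ ^ 2 ∂P < ∞ := by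
    have h2 := eLpNorm_nnreal_pow_eq_lintegral (f := e) (μ := P) (p := 2) (by norm_num)
    have h3 : eLpNorm e 2 P ^ 2 = ∫⁻ ω, ‖e ω‖ₑ ^ 2 ∂P := by simpa using h2
    rw [← h3]
    exact ENNReal.pow_lt_top heL.2
  have hu2 : ∀ i, ∫⁻ ω, ‖e ω i‖ₑ ^ 2 ∂P < ∞ := fun i => by
    refine (lintegral_mono fun ω => ?_).trans_lt he2
    have : ‖e ω i‖ₑ ≤ ‖e ω‖ₑ := by
      rw [enorm_le_iff_norm_le]
      exact PiLp.norm_apply_le _ _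
    gcongr
  refine ⟨2 * ∑ i, ENNReal.ofReal (6000 * (2 * Real.pi * 1 * ∫ x, |q i x|) ^ 2) *
      ∫⁻ ω, ‖e ω i‖ₑ ^ 2 ∂P, ENNReal.mul_lt_top (by norm_num) (ENNReal.sum_lt_top.2 fun i _ =>
      ENNReal.mul_lt_top ENNReal.ofReal_lt_top (hu2 i)), fun s hs hs2 n => ?_⟩
  set K : Fin 2 → ℕ → Plane → ℝ := fun i j z => (s j)⁻¹ * smoothedDisk (s j) (q i) z with hK
  have hKm : ∀ i j, Measurable (K i j) := fun i j =>
    (measurable_smoothedDisk (s j) (hqc i).measurable).const_mul _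
  have htrans : ∀ i, ∑ j ∈ Finset.range n, ∫⁻ ω, ‖∫ z, K i j z * e (θ z ω) i‖ₑ ^ 2 ∂P ≤
      ENNReal.ofReal (6000 * (2 * Real.pi * 1 * ∫ x, |q i x|) ^ 2) * ∫⁻ ω, ‖e ω i‖ₑ ^ 2 ∂P :=
    fun i => hθ.sum_lintegral_smoothedDisk_sq_le (hqi i) (hqc i).measurable (hq0 i)
      (integral_fderiv_eq_zero hφ hφc _) (hu i) (hu2 i) hs hs2 n
  have hpt : ∀ j, ∀ᵐ ω ∂P, ENNReal.ofReal ((s j)⁻¹ ^ 2) *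
      ‖diskFluctuation θ τ (smearedCharge 1 φ) (s j) ω‖ₑ ^ 2 ≤
      2 * (‖∫ z, K 0 j z * e (θ z ω) 0‖ₑ ^ 2 + ‖∫ z, K 1 j z * e (θ z ω) 1‖ₑ ^ 2) := by
    intro j
    filter_upwards [hfield _ (contDiff_smoothedDisk (s j) hφ hφc)
      (hasCompactSupport_smoothedDisk (s j) hφc),
      hθ.ae_locallyIntegrable he (heL.integrable (by norm_num))] with ω hω hli
    have hKc : ∀ i, Continuous (K i j) := fun i => by
      simp only [hK]
      have : smoothedDisk (s j) (q i) = fun x => fderiv ℝ (smoothedDisk (s j) φ) x (v i) := by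
        ext x
        rw [fderiv_smoothedDisk (s j) hφ hφc]
      rw [this]
      exact continuous_const.mul (((contDiff_smoothedDisk (s j) hφ hφc).continuous_fderiv
        (by simp)).clm_apply continuous_const)
    have hKs : ∀ i, HasCompactSupport (K i j) := fun i =>
      (hasCompactSupport_smoothedDisk (s j) (hasCompactSupport_of_radius (hq0 i))).mul_left
    have hKi : ∀ i, Integrable fun z => K i j z * e (θ z ω) i := by
      intro i
      have h1 : LocallyIntegrable fun z => e (θ z ω) i := by
        refine hli.mono ((EuclideanSpace.proj (𝕜 := ℝ) i).continuous.comp_aestronglyMeasurable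
          hli.aestronglyMeasurable) (Eventually.of_forall fun x => PiLp.norm_apply_le _ _)
      exact h1.integrable_smul_left_of_hasCompactSupport (hKc i) (hKs i)
    have hdec : ∀ z, (s j)⁻¹ * fderiv ℝ (smoothedDisk (s j) φ) z (e (θ z ω)) =
        K 0 j z * e (θ z ω) 0 + K 1 j z * e (θ z ω) 1 := by
      intro z
      have : e (θ z ω) = e (θ z ω) 0 • v 0 + e (θ z ω) 1 • v 1 := by
        ext i
        fin_cases i <;> simp [hv]
      conv_lhs => rw [this]
      rw [map_add, map_smul, map_smul, fderiv_smoothedDisk (s j) hφ hφc,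
        fderiv_smoothedDisk (s j) hφ hφc]
      simp only [hK, hq, smul_eq_mul]
      ring
    have hD : (s j)⁻¹ * diskFluctuation θ τ (smearedCharge 1 φ) (s j) ω =
        (∫ z, K 0 j z * e (θ z ω) 0) + ∫ z, K 1 j z * e (θ z ω) 1 := by
      rw [← integral_add (hKi 0) (hKi 1)]
      simp_rw [← hdec]
      rw [integral_const_mul, hω.2, diskFluctuation, integral_smoothedDisk (hs j).le hφi, hφ1,
        mul_one]
      congr 3
      exact funext fun z =>
        (smearedCharge_smoothedDisk 1 (s j) hφi hφ.continuous.measurable z).symm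
    have : ENNReal.ofReal ((s j)⁻¹ ^ 2) *
        ‖diskFluctuation θ τ (smearedCharge 1 φ) (s j) ω‖ₑ ^ 2 =
        ‖(s j)⁻¹ * diskFluctuation θ τ (smearedCharge 1 φ) (s j) ω‖ₑ ^ 2 := by
      rw [enorm_mul, mul_pow, enorm_sq_eq_ofReal (s j)⁻¹, Real.norm_eq_abs, sq_abs]
    rw [this, hD]
    refine le_trans ?_ (sq_add_le _ _)
    gcongr
    exact enorm_add_le _ _
  have hmeas : ∀ i j, Measurable fun ω => ‖∫ z, K i j z * e (θ z ω) i‖ₑ ^ 2 := fun i j =>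
    ((StronglyMeasurable.integral_prod_right' (f := fun p : Ω × Plane =>
      K i j p.2 * e (θ p.2 p.1) i) (((hKm i j).comp measurable_snd).mul
        (hθ.measurable_comp (hu i) measurable_snd
          measurable_fst)).stronglyMeasurable).measurable.enorm).pow_const 2
  calc ∑ j ∈ Finset.range n, ENNReal.ofReal ((s j)⁻¹ ^ 2) *
        ∫⁻ ω, ‖diskFluctuation θ τ (smearedCharge 1 φ) (s j) ω‖ₑ ^ 2 ∂P
      ≤ ∑ j ∈ Finset.range n, 2 * (∫⁻ ω, ‖∫ z, K 0 j z * e (θ z ω) 0‖ₑ ^ 2 ∂P +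
          ∫⁻ ω, ‖∫ z, K 1 j z * e (θ z ω) 1‖ₑ ^ 2 ∂P) := by
        refine Finset.sum_le_sum fun j _ => ?_
        rw [← lintegral_const_mul' _ _ ENNReal.ofReal_ne_top]
        refine (lintegral_mono_ae (hpt j)).trans (le_of_eq ?_)
        rw [lintegral_const_mul' _ _ (by norm_num), lintegral_add_left (hmeas 0 j)]
    _ = 2 * ∑ i, ∑ j ∈ Finset.range n, ∫⁻ ω, ‖∫ z, K i j z * e (θ z ω) i‖ₑ ^ 2 ∂P := by
        rw [← Finset.mul_sum, Finset.sum_add_distrib, Fin.sum_univ_two]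
    _ ≤ _ := by
        gcongr with i
        exact htrans i

/-- The second moment of the boundary fluctuation is at most of the order of the perimeter,
uniformly in `δ`. -/
theorem exists_lintegral_boundaryFluctuation_le [IsProbabilityMeasure P]
    (hθ : IsStationaryFlow θ P) (hτ : Measurable τ) {α : ℝ} (hα : 0 < α)
    (hm : ∫⁻ ω, ENNReal.ofReal ((1 + ‖τ ω‖) ^ (2 + α)) ∂P < ∞) {g : Plane → ℝ}
    (hg : Integrable g) (hgm : Measurable g) {r : ℝ} (hr0 : 0 ≤ r) (hr : ∀ x, r < ‖x‖ → g x = 0)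
    (h1 : ∫ x, g x = 1) (he : ∀ x, g (-x) = g x) :
    ∃ C : ℝ≥0∞, C < ∞ ∧ ∀ s δ : ℝ, 0 < s → δ ≤ 1 →
      ∫⁻ ω, ‖boundaryFluctuation θ τ g δ s ω‖ₑ ^ 2 ∂P ≤ C * ENNReal.ofReal s := by
  obtain ⟨C, hC0, hC⟩ := exists_norm_fourier_indicator_sub_smoothedDisk_sq_le hg hr h1 he
  have hX := hθ.lintegral_displacedLebesgue_sq_lt_top hτ hα hm
  refine ⟨ENNReal.ofReal C * ∫⁻ ω, displacedLebesgue θ τ ω (Metric.closedBall 0 1) ^ 2 ∂P,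
    ENNReal.mul_lt_top ENNReal.ofReal_lt_top hX, fun s δ hs hδ => ?_⟩
  have hle : ∫⁻ ω, ‖(displacedLebesgue θ τ ω (Metric.closedBall 0 δ)).toReal‖ₑ ^ 2 ∂P ≤
      ∫⁻ ω, displacedLebesgue θ τ ω (Metric.closedBall 0 1) ^ 2 ∂P := by
    refine lintegral_mono fun ω => ?_
    have : ‖(displacedLebesgue θ τ ω (Metric.closedBall 0 δ)).toReal‖ₑ ≤
        displacedLebesgue θ τ ω (Metric.closedBall 0 1) := by
      rw [← ofReal_norm, Real.norm_of_nonneg ENNReal.toReal_nonneg]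
      exact ENNReal.ofReal_toReal_le.trans (measure_mono (Metric.closedBall_subset_closedBall hδ))
    gcongr
  have := hθ.sum_lintegral_average_sq_le (Finset.range 1)
    (fun _ z => (Metric.closedBall (0 : Plane) s).indicator (fun _ => (1 : ℝ)) z -
      smoothedDisk s g z)
    (fun j _ => (measurable_indicator_closedBall s).sub (measurable_smoothedDisk s hgm))
    (fun j _ => ⟨1 + ∫ x, |g x|, fun x => (abs_sub _ _).trans
      (add_le_add (abs_indicator_closedBall_le s x) (abs_smoothedDisk_le hg x))⟩)
    (ρ := s + r) (by positivity)
    (fun j _ x hx => by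
      rw [smoothedDisk_eq_zero hr hx, Set.indicator_of_notMem, sub_zero]
      rw [mem_closedBall_zero_iff]
      linarith)
    (ENNReal.ofReal (C * s)) (fun k => by
      rw [Finset.sum_range_one, enorm_sq_eq_ofReal]
      exact ENNReal.ofReal_le_ofReal (hC s hs k))
    (hθ.measurable_toReal_displacedLebesgue hτ δ) (hle.trans_lt hX)
  rw [Finset.sum_range_one] at this
  refine this.trans ?_
  rw [ENNReal.ofReal_mul hC0]
  calc _ ≤ ENNReal.ofReal C * ENNReal.ofReal s *
        ∫⁻ ω, displacedLebesgue θ τ ω (Metric.closedBall 0 1) ^ 2 ∂P := by gcongr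
    _ = _ := by ring

end IsStationaryFlow

/-! ### Number variances along lacunary sequences of radii -/

/-- The fluctuation of the mass of the disk of radius `s`, averaged over the translations of length
at most `δ`, written as the sum of its mollified part and of its boundary part. -/
noncomputable def averagedFluctuation {Ω : Type*} (θ : Plane → Ω → Ω) (τ : Ω → Plane)
    (g : Plane → ℝ) (δ s : ℝ) (ω : Ω) : ℝ :=
  (Real.pi * δ ^ 2)⁻¹ * ((∫ w in Metric.closedBall 0 δ, diskFluctuation θ τ g s (θ w ω)) +
    boundaryFluctuation θ τ g δ s ω)

namespace IsStationaryFlow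

variable {Ω : Type*} [MeasurableSpace Ω] {θ : Plane → Ω → Ω} {P : Measure Ω} {τ : Ω → Plane}

theorem measurable_setIntegral_diskFluctuation (hθ : IsStationaryFlow θ P) (hτ : Measurable τ)
    {g : Plane → ℝ} (hg : Measurable g) (δ s : ℝ) : Measurable fun ω =>
      ∫ w in Metric.closedBall 0 δ, diskFluctuation θ τ g s (θ w ω) :=
  (StronglyMeasurable.integral_prod_right' (f := fun p : Ω × Plane =>
    diskFluctuation θ τ g s (θ p.2 p.1)) (hθ.measurable_comp (hθ.measurable_diskFluctuation hτ hg s)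
      measurable_snd measurable_fst).stronglyMeasurable).measurable

theorem measurable_averagedFluctuation (hθ : IsStationaryFlow θ P) (hτ : Measurable τ)
    {g : Plane → ℝ} (hg : Measurable g) (δ s : ℝ) :
    Measurable (averagedFluctuation θ τ g δ s) :=
  ((hθ.measurable_setIntegral_diskFluctuation hτ hg δ s).add
    (hθ.measurable_boundaryFluctuation hτ hg δ s)).const_mul _

/-- The mass of a disk is squeezed between averages over small translations of the masses of a
slightly smaller and a slightly larger disk. -/
theorem averagedFluctuation_le_and_le (hθ : IsStationaryFlow θ P) (hτ : Measurable τ)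
    {ω : Ω} (hω : ∀ r, displacedLebesgue θ τ ω (Metric.closedBall 0 r) < ∞) {g : Plane → ℝ}
    (hg : Integrable g) (hgm : Measurable g) {R : ℝ} (hR : 0 ≤ R) (hgR : ∀ x, R < ‖x‖ → g x = 0)
    {δ : ℝ} (hδ : 0 < δ) (r : ℝ) :
    Real.pi * (r - δ) ^ 2 + averagedFluctuation θ τ g δ (r - δ) ω ≤
        (displacedLebesgue θ τ ω (Metric.closedBall 0 r)).toReal ∧
      (displacedLebesgue θ τ ω (Metric.closedBall 0 r)).toReal ≤
        Real.pi * (r + δ) ^ 2 + averagedFluctuation θ τ g δ (r + δ) ω := by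
  have hV : 0 < Real.pi * δ ^ 2 := by positivity
  have key : ∀ s, Real.pi * s ^ 2 + averagedFluctuation θ τ g δ s ω = (Real.pi * δ ^ 2)⁻¹ *
      ∫ w in Metric.closedBall 0 δ,
        (displacedLebesgue θ τ (θ w ω) (Metric.closedBall 0 s)).toReal := by
    intro s
    rw [(hθ.setIntegral_toReal_displacedLebesgue hτ hω hg hgm hR hgR hδ.le s).2,
      averagedFluctuation]
    field_simp
    ring
  have hc : ∀ c : ℝ, ∫ _ in Metric.closedBall (0 : Plane) δ, c = Real.pi * δ ^ 2 * c := by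
    intro c
    rw [setIntegral_const, measureReal_def, volume_closedBall_plane 0 hδ.le,
      ENNReal.toReal_ofReal hV.le, smul_eq_mul]
  have hci : ∀ c : ℝ, IntegrableOn (fun _ : Plane => c) (Metric.closedBall 0 δ) := fun c =>
    integrableOn_const (isCompact_closedBall _ _).measure_lt_top.ne
  have htr : ∀ w s, displacedLebesgue θ τ (θ w ω) (Metric.closedBall 0 s) =
      displacedLebesgue θ τ ω {x | ‖x - w‖ ≤ s} := by
    intro w s
    rw [hθ.displacedLebesgue_comp hτ, Measure.map_apply (measurable_sub_const w)
      measurableSet_closedBall]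
    congr 1
    ext x
    simp
  constructor
  · rw [key, inv_mul_le_iff₀ hV, ← hc]
    refine setIntegral_mono_on
      (hθ.setIntegral_toReal_displacedLebesgue hτ hω hg hgm hR hgR hδ.le _).1 (hci _)
      measurableSet_closedBall fun w hw => ENNReal.toReal_mono (hω r).ne ?_
    rw [htr]
    refine measure_mono fun x hx => ?_
    rw [mem_closedBall_zero_iff] at hw ⊢
    have h1 : ‖x - w‖ ≤ r - δ := hx
    have h2 := norm_sub_norm_le x w
    linarith
  · rw [key, le_inv_mul_iff₀ hV, ← hc]
    refine setIntegral_mono_on (hci _)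
      (hθ.setIntegral_toReal_displacedLebesgue hτ hω hg hgm hR hgR hδ.le _).1
      measurableSet_closedBall fun w hw => ENNReal.toReal_mono ?_ ?_
    · rw [htr]
      refine ne_of_lt ((measure_mono fun x hx => ?_).trans_lt (hω (r + δ + ‖w‖)))
      rw [mem_closedBall_zero_iff]
      have h1 : ‖x - w‖ ≤ r + δ := hx
      have h2 := norm_sub_norm_le x w
      linarith
    · rw [htr]
      refine measure_mono fun x hx => ?_
      rw [mem_closedBall_zero_iff] at hw hx
      change ‖x - w‖ ≤ r + δ
      exact (norm_sub_le _ _).trans (add_le_add hx hw)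

theorem lintegral_averagedFluctuation_sq_le [IsProbabilityMeasure P] (hθ : IsStationaryFlow θ P)
    (hτ : Measurable τ) {g : Plane → ℝ} (hgm : Measurable g) {δ : ℝ} (hδ : 0 < δ) (s : ℝ) :
    ∫⁻ ω, ‖averagedFluctuation θ τ g δ s ω‖ₑ ^ 2 ∂P ≤
      2 * (∫⁻ ω, ‖diskFluctuation θ τ g s ω‖ₑ ^ 2 ∂P +
        ENNReal.ofReal ((Real.pi * δ ^ 2)⁻¹ ^ 2) *
          ∫⁻ ω, ‖boundaryFluctuation θ τ g δ s ω‖ₑ ^ 2 ∂P) := by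
  have hV : 0 < Real.pi * δ ^ 2 := by positivity
  set c := (Real.pi * δ ^ 2)⁻¹ with hc
  have hc0 : 0 < c := inv_pos.2 hV
  set I : Ω → ℝ := fun ω => ∫ w in Metric.closedBall 0 δ, diskFluctuation θ τ g s (θ w ω) with hI
  have hIm : Measurable I := hθ.measurable_setIntegral_diskFluctuation hτ hgm δ s
  have hDm := hθ.measurable_diskFluctuation hτ hgm s
  have hce : ∀ x : ℝ, ‖c * x‖ₑ ^ 2 = ENNReal.ofReal (c ^ 2) * ‖x‖ₑ ^ 2 := fun x => by
    rw [enorm_mul, mul_pow, enorm_sq_eq_ofReal c, Real.norm_eq_abs, sq_abs]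
  have h1 : ∫⁻ ω, ‖I ω‖ₑ ^ 2 ∂P ≤ ENNReal.ofReal ((Real.pi * δ ^ 2) ^ 2) *
      ∫⁻ ω, ‖diskFluctuation θ τ g s ω‖ₑ ^ 2 ∂P := by
    calc ∫⁻ ω, ‖I ω‖ₑ ^ 2 ∂P
        ≤ ∫⁻ ω, (ENNReal.ofReal (Real.pi * δ ^ 2) * ∫⁻ w in Metric.closedBall 0 δ,
            ‖diskFluctuation θ τ g s (θ w ω)‖ₑ ^ 2) ∂P := by
          refine lintegral_mono fun ω => ?_
          have hm : Measurable fun w => ‖diskFluctuation θ τ g s (θ w ω)‖ₑ :=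
            (hθ.measurable_comp hDm measurable_id measurable_const).enorm
          have := sq_lintegral_le (μ := volume.restrict (Metric.closedBall (0 : Plane) δ))
            hm.aemeasurable
          rw [Measure.restrict_apply_univ, volume_closedBall_plane 0 hδ.le] at this
          refine le_trans ?_ this
          gcongr
          exact enorm_integral_le_lintegral_enorm _
      _ = _ := by
          rw [lintegral_const_mul' _ _ ENNReal.ofReal_ne_top,
            hθ.lintegral_lintegral_comp (f := fun ω => ‖diskFluctuation θ τ g s ω‖ₑ ^ 2)
              (hDm.enorm.pow_const 2), Measure.restrict_apply_univ,
            volume_closedBall_plane 0 hδ.le, ← mul_assoc, ← ENNReal.ofReal_mul hV.le,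
            sq (Real.pi * δ ^ 2)]
  calc ∫⁻ ω, ‖averagedFluctuation θ τ g δ s ω‖ₑ ^ 2 ∂P
      ≤ ∫⁻ ω, 2 * (ENNReal.ofReal (c ^ 2) * ‖I ω‖ₑ ^ 2 +
          ENNReal.ofReal (c ^ 2) * ‖boundaryFluctuation θ τ g δ s ω‖ₑ ^ 2) ∂P := by
        refine lintegral_mono fun ω => ?_
        rw [← hce, ← hce]
        refine le_trans ?_ (sq_add_le _ _)
        rw [averagedFluctuation, mul_add]
        gcongr
        exact enorm_add_le _ _
    _ = 2 * (ENNReal.ofReal (c ^ 2) * ∫⁻ ω, ‖I ω‖ₑ ^ 2 ∂P + ENNReal.ofReal (c ^ 2) *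
          ∫⁻ ω, ‖boundaryFluctuation θ τ g δ s ω‖ₑ ^ 2 ∂P) := by
        rw [lintegral_const_mul' _ _ (by norm_num),
          lintegral_add_left ((hIm.enorm.pow_const 2).const_mul _),
          lintegral_const_mul' _ _ ENNReal.ofReal_ne_top,
          lintegral_const_mul' _ _ ENNReal.ofReal_ne_top]
    _ ≤ 2 * (ENNReal.ofReal (c ^ 2) * (ENNReal.ofReal ((Real.pi * δ ^ 2) ^ 2) *
          ∫⁻ ω, ‖diskFluctuation θ τ g s ω‖ₑ ^ 2 ∂P) + ENNReal.ofReal (c ^ 2) *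
          ∫⁻ ω, ‖boundaryFluctuation θ τ g δ s ω‖ₑ ^ 2 ∂P) := by gcongr
    _ = _ := by
        rw [← mul_assoc (ENNReal.ofReal (c ^ 2)), ← ENNReal.ofReal_mul (sq_nonneg _), ← mul_pow, hc,
          inv_mul_cancel₀ hV.ne', one_pow, ENNReal.ofReal_one, one_mul]

theorem integral_toReal_displacedLebesgue [IsProbabilityMeasure P] (hθ : IsStationaryFlow θ P)
    (hτ : Measurable τ) {r : ℝ} (hr : 0 ≤ r) :
    ∫ ω, (displacedLebesgue θ τ ω (Metric.closedBall 0 r)).toReal ∂P = Real.pi * r ^ 2 := by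
  have hN : Measurable fun ω => displacedLebesgue θ τ ω (Metric.closedBall 0 r) :=
    (Measure.measurable_coe measurableSet_closedBall).comp (hθ.measurable_displacedLebesgue hτ)
  rw [integral_toReal hN.aemeasurable]
  · rw [hθ.lintegral_displacedLebesgue_apply hτ measurableSet_closedBall,
      volume_closedBall_plane 0 hr, ENNReal.toReal_ofReal (by positivity)]
  · filter_upwards [hθ.ae_displacedLebesgue_closedBall_lt_top hτ] with ω hω using hω r

/-- The bound on the number variance given by the squeezing, the last term being the error on the
area. -/
theorem evariance_displacedLebesgue_le [IsProbabilityMeasure P] (hθ : IsStationaryFlow θ P)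
    (hτ : Measurable τ) {g : Plane → ℝ} (hg : Integrable g) (hgm : Measurable g) {R : ℝ}
    (hR : 0 ≤ R) (hgR : ∀ x, R < ‖x‖ → g x = 0) {δ r : ℝ} (hδ : 0 < δ) (hδr : δ ≤ r) :
    evariance (fun ω => (displacedLebesgue θ τ ω (Metric.closedBall 0 r)).toReal) P ≤
      3 * (∫⁻ ω, ‖averagedFluctuation θ τ g δ (r - δ) ω‖ₑ ^ 2 ∂P +
        ∫⁻ ω, ‖averagedFluctuation θ τ g δ (r + δ) ω‖ₑ ^ 2 ∂P +
        ENNReal.ofReal ((3 * Real.pi * r * δ) ^ 2)) := by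
  have hr : 0 < r := hδ.trans_le hδr
  have hA : ∀ s, Measurable fun ω => ‖averagedFluctuation θ τ g δ s ω‖ₑ ^ 2 := fun s =>
    (hθ.measurable_averagedFluctuation hτ hgm δ s).enorm.pow_const 2
  rw [evariance, hθ.integral_toReal_displacedLebesgue hτ hr.le]
  have hpt : ∀ᵐ ω ∂P, ‖(displacedLebesgue θ τ ω (Metric.closedBall 0 r)).toReal -
      Real.pi * r ^ 2‖ₑ ^ 2 ≤ 3 * (‖averagedFluctuation θ τ g δ (r - δ) ω‖ₑ ^ 2 +
        ‖averagedFluctuation θ τ g δ (r + δ) ω‖ₑ ^ 2 +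
        ENNReal.ofReal ((3 * Real.pi * r * δ) ^ 2)) := by
    filter_upwards [hθ.ae_displacedLebesgue_closedBall_lt_top hτ] with ω hω
    obtain ⟨h1, h2⟩ := hθ.averagedFluctuation_le_and_le hτ hω hg hgm hR hgR hδ r
    set N := (displacedLebesgue θ τ ω (Metric.closedBall 0 r)).toReal
    set a := averagedFluctuation θ τ g δ (r - δ) ω
    set b := averagedFluctuation θ τ g δ (r + δ) ω
    have h3 : |N - Real.pi * r ^ 2| ≤ |a| + |b| + 3 * Real.pi * r * δ := by
      have e1 : Real.pi * (r + δ) ^ 2 ≤ Real.pi * r ^ 2 + 3 * Real.pi * r * δ := by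
        have : δ ^ 2 ≤ r * δ := by nlinarith
        nlinarith [Real.pi_pos]
      have e2 : Real.pi * r ^ 2 - 3 * Real.pi * r * δ ≤ Real.pi * (r - δ) ^ 2 := by
        have : 0 ≤ Real.pi * (r * δ) := by positivity
        nlinarith [Real.pi_pos, sq_nonneg δ]
      rw [abs_le]
      constructor
      · linarith [neg_abs_le a, abs_nonneg b]
      · linarith [le_abs_self b, abs_nonneg a]
    have h4 : ‖N - Real.pi * r ^ 2‖ₑ ≤ ‖a‖ₑ + ‖b‖ₑ + ENNReal.ofReal (3 * Real.pi * r * δ) := by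
      rw [← ofReal_norm, ← ofReal_norm, ← ofReal_norm, ← ENNReal.ofReal_add (norm_nonneg _)
        (norm_nonneg _), ← ENNReal.ofReal_add (by positivity) (by positivity)]
      exact ENNReal.ofReal_le_ofReal h3
    rw [ENNReal.ofReal_pow (by positivity)]
    refine le_trans ?_ (sq_add_add_le _ _ _)
    gcongr
  refine (lintegral_mono_ae hpt).trans (le_of_eq ?_)
  have hAA : Measurable fun ω => ‖averagedFluctuation θ τ g δ (r - δ) ω‖ₑ ^ 2 +
      ‖averagedFluctuation θ τ g δ (r + δ) ω‖ₑ ^ 2 := (hA _).add (hA _)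
  rw [lintegral_const_mul' _ _ (by norm_num), lintegral_add_left hAA,
    lintegral_add_left (hA _), lintegral_const, measure_univ, mul_one]

/-- The rescaled number variances are summable along every lacunary sequence of radii. -/
theorem tsum_rescaledNumberVariance_lt_top [IsProbabilityMeasure P]
    (hθ : IsStationaryFlow θ P) (hτ : Measurable τ) {α : ℝ} (hα : 0 < α)
    (hm : ∫⁻ ω, ENNReal.ofReal ((1 + ‖τ ω‖) ^ (2 + α)) ∂P < ∞) {r : ℕ → ℝ} (hr0 : 1 ≤ r 0)
    (hr : ∀ j, 2 * r j ≤ r (j + 1)) :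
    ∑' j, rescaledNumberVariance (displacedLebesgue θ τ) P (r j) < ∞ := by
  obtain ⟨φ, hφ, hφ0, hφ1, hφe⟩ := exists_even_mollifier
  have hφc : HasCompactSupport φ := hasCompactSupport_of_radius hφ0
  have hφi : Integrable φ := hφ.continuous.integrable_of_hasCompactSupport hφc
  set g := smearedCharge 1 φ with hg
  have hgc : Continuous g := continuous_smearedCharge 1 hφ.continuous
  have hgR : ∀ x, (1 : ℝ) + |1| < ‖x‖ → g x = 0 := fun x hx => smearedCharge_eq_zero hφ0 hx
  have hR : (0 : ℝ) ≤ 1 + |1| := by positivity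
  have hgi : Integrable g := hgc.integrable_of_hasCompactSupport (hasCompactSupport_of_radius hgR)
  have hg1 : ∫ x, g x = 1 := by
    rw [hg, integral_smearedCharge 1 hφi hφ.continuous.measurable, hφ1]
  obtain ⟨C₁, hC₁, hsum⟩ :=
    hθ.exists_sum_lintegral_diskFluctuation_le hτ hα hm hφ hφ0 hφ1
  obtain ⟨C₂, hC₂, hbd⟩ := hθ.exists_lintegral_boundaryFluctuation_le hτ hα hm hgi hgc.measurable
    hR hgR hg1 (smearedCharge_neg 1 hφe)
  -- The area error needs `∑ δ j ^ 2 < ∞`, while the factor `δ j ^ (-4)` of the boundary term has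
  -- to be beaten by `r j ≥ 2 ^ j`: hence a geometric rate with `(10 / 9) ^ 4 < 2`.
  set δ : ℕ → ℝ := fun j => (9 / 10) ^ j / 4 with hδ
  have hδ0 : ∀ j, 0 < δ j := fun j => by positivity
  have hδ1 : ∀ j, δ j ≤ 1 / 4 := fun j => by
    simp only [hδ]
    have : (9 / 10 : ℝ) ^ j ≤ 1 := pow_le_one₀ (by norm_num) (by norm_num)
    linarith
  have hδm : ∀ j, δ (j + 1) ≤ δ j := fun j => by
    simp only [hδ, pow_succ]
    have : (0 : ℝ) ≤ (9 / 10) ^ j := by positivity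
    linarith
  have hr2 : ∀ j, 2 ^ j ≤ r j := by
    intro j
    induction j with
    | zero => simpa using hr0
    | succ j ih => rw [pow_succ]; linarith [hr j]
  have hr1 : ∀ j, 1 ≤ r j := fun j => (one_le_pow₀ (by norm_num)).trans (hr2 j)
  set σ : ℕ → ℝ≥0∞ := fun j => ENNReal.ofReal (400 * (5000 / 6561) ^ j) with hσ
  set ρ : ℕ → ℝ≥0∞ := fun j => ENNReal.ofReal (9 * Real.pi / 16 * (81 / 100) ^ j) with hρ
  have hσs : ∑' j, σ j < ∞ := by
    have h : Summable fun j : ℕ => 400 * (5000 / 6561 : ℝ) ^ j :=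
      (summable_geometric_of_lt_one (by norm_num) (by norm_num)).mul_left _
    exact (h.tsum_ofReal_lt_top)
  have hρs : ∑' j, ρ j < ∞ := by
    have h : Summable fun j : ℕ => 9 * Real.pi / 16 * (81 / 100 : ℝ) ^ j :=
      (summable_geometric_of_lt_one (by norm_num) (by norm_num)).mul_left _
    exact (h.tsum_ofReal_lt_top)
  -- The contribution of one of the two sequences of radii `r j - δ j` and `r j + δ j`.
  have hside : ∀ s : ℕ → ℝ, (∀ j, 3 / 4 * r j ≤ s j) → (∀ j, 3 / 2 * s j ≤ s (j + 1)) → ∀ n,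
      ∑ j ∈ Finset.range n, ENNReal.ofReal ((s j)⁻¹ ^ 2) *
        ∫⁻ ω, ‖averagedFluctuation θ τ g (δ j) (s j) ω‖ₑ ^ 2 ∂P ≤
      2 * (C₁ + C₂ * ∑' j, σ j) := by
    intro s hsr hs2 n
    have hs : ∀ j, 0 < s j := fun j => by linarith [hsr j, hr1 j]
    have hterm : ∀ j, ENNReal.ofReal ((s j)⁻¹ ^ 2) *
        ∫⁻ ω, ‖averagedFluctuation θ τ g (δ j) (s j) ω‖ₑ ^ 2 ∂P ≤
        2 * (ENNReal.ofReal ((s j)⁻¹ ^ 2) * ∫⁻ ω, ‖diskFluctuation θ τ g (s j) ω‖ₑ ^ 2 ∂P +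
          C₂ * σ j) := by
      intro j
      have hsj := hs j
      have hδj := hδ0 j
      have h1 : ENNReal.ofReal ((s j)⁻¹ ^ 2) * (ENNReal.ofReal ((Real.pi * δ j ^ 2)⁻¹ ^ 2) *
          (C₂ * ENNReal.ofReal (s j))) ≤ C₂ * σ j := by
        have e : ENNReal.ofReal ((s j)⁻¹ ^ 2) * (ENNReal.ofReal ((Real.pi * δ j ^ 2)⁻¹ ^ 2) *
          (C₂ * ENNReal.ofReal (s j))) = C₂ * ENNReal.ofReal ((s j)⁻¹ ^ 2 *
            (Real.pi * δ j ^ 2)⁻¹ ^ 2 * s j) := by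
          rw [ENNReal.ofReal_mul (by positivity), ENNReal.ofReal_mul (by positivity)]
          ring
        rw [e]
        gcongr
        simp only [hσ]
        refine ENNReal.ofReal_le_ofReal ?_
        have h2 : 3 / 4 * 2 ^ j ≤ s j := by linarith [hsr j, hr2 j]
        have hp : (9 / 10 : ℝ) ^ j ≠ 0 := by positivity
        calc (s j)⁻¹ ^ 2 * (Real.pi * δ j ^ 2)⁻¹ ^ 2 * s j
            = (s j)⁻¹ * ((Real.pi ^ 2)⁻¹ * (δ j ^ 4)⁻¹) := by field_simp
          _ ≤ (3 / 4 * 2 ^ j)⁻¹ * (1 * (δ j ^ 4)⁻¹) := by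
              gcongr
              rw [inv_le_one_iff₀]
              right
              nlinarith [Real.pi_gt_three]
          _ = 1024 / 3 * (5000 / 6561) ^ j := by
              have : (5000 / 6561 : ℝ) ^ j = (2 ^ j)⁻¹ * (((9 / 10 : ℝ) ^ j) ^ 4)⁻¹ := by
                rw [← pow_mul, mul_comm j 4, pow_mul, ← inv_pow, ← inv_pow, ← mul_pow]
                norm_num
              rw [this]
              simp only [hδ]
              field_simp
              norm_num
          _ ≤ _ := by gcongr; norm_num
      calc _ ≤ ENNReal.ofReal ((s j)⁻¹ ^ 2) * (2 * (∫⁻ ω, ‖diskFluctuation θ τ g (s j) ω‖ₑ ^ 2 ∂P +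
            ENNReal.ofReal ((Real.pi * δ j ^ 2)⁻¹ ^ 2) * (C₂ * ENNReal.ofReal (s j)))) := by
            gcongr
            refine (hθ.lintegral_averagedFluctuation_sq_le hτ hgc.measurable hδj (s j)).trans ?_
            gcongr
            exact hbd (s j) (δ j) hsj (by linarith [hδ1 j])
        _ = 2 * (ENNReal.ofReal ((s j)⁻¹ ^ 2) * ∫⁻ ω, ‖diskFluctuation θ τ g (s j) ω‖ₑ ^ 2 ∂P +
            ENNReal.ofReal ((s j)⁻¹ ^ 2) * (ENNReal.ofReal ((Real.pi * δ j ^ 2)⁻¹ ^ 2) *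
              (C₂ * ENNReal.ofReal (s j)))) := by ring
        _ ≤ _ := by gcongr
    refine (Finset.sum_le_sum fun j _ => hterm j).trans ?_
    rw [← Finset.mul_sum, Finset.sum_add_distrib, ← Finset.mul_sum]
    gcongr
    · exact hsum s hs hs2 n
    · exact ENNReal.sum_le_tsum _
  have hvar : ∀ j, rescaledNumberVariance (displacedLebesgue θ τ) P (r j) ≤
      3 * (ENNReal.ofReal ((r j - δ j)⁻¹ ^ 2) *
          ∫⁻ ω, ‖averagedFluctuation θ τ g (δ j) (r j - δ j) ω‖ₑ ^ 2 ∂P +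
        ENNReal.ofReal ((r j + δ j)⁻¹ ^ 2) *
          ∫⁻ ω, ‖averagedFluctuation θ τ g (δ j) (r j + δ j) ω‖ₑ ^ 2 ∂P + ρ j) := by
    intro j
    have hrj := hr1 j
    have hδj := hδ0 j
    have hδj1 := hδ1 j
    have hpi := Real.pi_gt_three
    have hpos : 0 < Real.pi * r j ^ 2 := by positivity
    have hinv : ∀ s : ℝ, 0 < s → s ≤ 5 / 4 * r j →
        ENNReal.ofReal ((Real.pi * r j ^ 2)⁻¹) ≤ ENNReal.ofReal (s⁻¹ ^ 2) := by
      intro s hs hsr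
      refine ENNReal.ofReal_le_ofReal ?_
      rw [inv_pow]
      refine inv_anti₀ (by positivity) ?_
      nlinarith
    rw [rescaledNumberVariance, volume_closedBall_plane 0 (by linarith), div_eq_mul_inv,
      ← ENNReal.ofReal_inv_of_pos hpos, mul_comm]
    calc _ ≤ ENNReal.ofReal ((Real.pi * r j ^ 2)⁻¹) *
          (3 * (∫⁻ ω, ‖averagedFluctuation θ τ g (δ j) (r j - δ j) ω‖ₑ ^ 2 ∂P +
            ∫⁻ ω, ‖averagedFluctuation θ τ g (δ j) (r j + δ j) ω‖ₑ ^ 2 ∂P +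
            ENNReal.ofReal ((3 * Real.pi * r j * δ j) ^ 2))) := by
          gcongr
          exact hθ.evariance_displacedLebesgue_le hτ hgi hgc.measurable hR hgR hδj (by linarith)
      _ = 3 * (ENNReal.ofReal ((Real.pi * r j ^ 2)⁻¹) *
            ∫⁻ ω, ‖averagedFluctuation θ τ g (δ j) (r j - δ j) ω‖ₑ ^ 2 ∂P +
          ENNReal.ofReal ((Real.pi * r j ^ 2)⁻¹) *
            ∫⁻ ω, ‖averagedFluctuation θ τ g (δ j) (r j + δ j) ω‖ₑ ^ 2 ∂P +
          ENNReal.ofReal ((Real.pi * r j ^ 2)⁻¹) *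
            ENNReal.ofReal ((3 * Real.pi * r j * δ j) ^ 2)) := by ring
      _ ≤ _ := by
          gcongr ?_ * (?_ * _ + ?_ * _ + ?_)
          · exact le_rfl
          · exact hinv _ (by linarith) (by linarith)
          · exact hinv _ (by linarith) (by linarith)
          · rw [← ENNReal.ofReal_mul (by positivity)]
            refine ENNReal.ofReal_le_ofReal (le_of_eq ?_)
            have : (81 / 100 : ℝ) ^ j = ((9 / 10) ^ j) ^ 2 := by
              rw [← pow_mul, mul_comm j 2, pow_mul]
              norm_num
            rw [this]
            simp only [hδ]
            field_simp
            norm_num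
  refine lt_of_le_of_lt (b := 3 * (2 * (C₁ + C₂ * ∑' j, σ j) + 2 * (C₁ + C₂ * ∑' j, σ j) +
    ∑' j, ρ j)) (ENNReal.tsum_le_of_sum_range_le fun n => ?_) ?_
  · refine (Finset.sum_le_sum fun j _ => hvar j).trans ?_
    rw [← Finset.mul_sum, Finset.sum_add_distrib, Finset.sum_add_distrib]
    gcongr
    · exact hside (fun j => r j - δ j) (fun j => by linarith [hr1 j, hδ1 j])
        (fun j => by linarith [hr j, hδm j, hδ0 j, hδ1 j, hr1 j]) n
    · exact hside (fun j => r j + δ j) (fun j => by linarith [hr1 j, hδ0 j])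
        (fun j => by linarith [hr j, hδ1 j, hδ0 (j + 1), hr1 j]) n
    · exact ENNReal.sum_le_tsum _
  · finiteness

theorem isStarHyperuniform_displacedLebesgue [IsProbabilityMeasure P]
    (hθ : IsStationaryFlow θ P) (hτ : Measurable τ) {α : ℝ} (hα : 0 < α)
    (hm : ∫⁻ ω, ENNReal.ofReal ((1 + ‖τ ω‖) ^ (2 + α)) ∂P < ∞) :
    IsStarHyperuniform (displacedLebesgue θ τ) P := by
  refine ⟨ENNReal.tendsto_nhds_zero.2 fun ε hε => ?_,
    hθ.tsum_rescaledNumberVariance_lt_top hτ hα hm (by simp) fun j => (pow_succ' _ _).ge⟩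
  -- Otherwise the rescaled variance is at least `ε` along a lacunary sequence of radii.
  by_contra h
  have h' : ∀ R : ℝ, ∃ r, R ≤ r ∧
      ε < rescaledNumberVariance (displacedLebesgue θ τ) P r := by
    intro R
    obtain ⟨r, hr, hr'⟩ := (frequently_atTop.1 (not_eventually.1 h)) R
    exact ⟨r, hr, not_le.1 hr'⟩
  choose f hf hfε using h'
  let r : ℕ → ℝ := fun n => Nat.rec (f 1) (fun _ x => f (2 * x)) n
  have hrε : ∀ n, ε ≤ rescaledNumberVariance (displacedLebesgue θ τ) P (r n) := by
    intro n
    cases n with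
    | zero => exact (hfε 1).le
    | succ n => exact (hfε (2 * r n)).le
  have hlt := hθ.tsum_rescaledNumberVariance_lt_top hτ hα hm (r := r) (hf 1) fun n =>
    hf (2 * r n)
  have := ENNReal.tsum_le_tsum hrε
  rw [ENNReal.tsum_const_eq_top_of_ne_zero hε.ne'] at this
  exact absurd hlt (not_lt.2 this)

end IsStationaryFlow

/-! ### The perturbed lattice as a displaced Lebesgue measure -/

section Lattice

variable (b : Module.Basis (Fin 2) ℝ Plane)

theorem fract_sub_lattice (v : Plane) (l : latticeOf b) :
    ZSpan.fract b (v - l) = ZSpan.fract b v := by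
  rw [sub_eq_add_neg]
  exact ZSpan.fract_add_ZSpan b v (neg_mem l.2)

theorem floor_sub_lattice (v : Plane) (l : latticeOf b) :
    ZSpan.floor b (v - l) = ZSpan.floor b v - l := by
  have h := fract_sub_lattice b v l
  rw [ZSpan.fract_apply, ZSpan.fract_apply] at h
  ext1
  rw [AddSubgroupClass.coe_sub]
  have h2 : ((ZSpan.floor b (v - l) : latticeOf b) : Plane) =
      v - l - (v - (ZSpan.floor b v : latticeOf b)) := by rw [← h]; abel
  rw [h2]
  abel

theorem floor_eq_iff (v : Plane) (l : latticeOf b) :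
    ZSpan.floor b v = l ↔ v - l ∈ ZSpan.fundamentalDomain b := by
  rw [← ZSpan.fract_eq_self, fract_sub_lattice, ZSpan.fract_apply, sub_right_inj, Subtype.ext_iff]

theorem floor_eq_zero {v : Plane} (hv : v ∈ ZSpan.fundamentalDomain b) : ZSpan.floor b v = 0 := by
  rw [floor_eq_iff]
  simpa using hv

theorem measurable_floor : Measurable (ZSpan.floor b) := by
  refine measurable_to_countable' fun l => ?_
  have : ZSpan.floor b ⁻¹' {l} = (fun v : Plane => v - l) ⁻¹' ZSpan.fundamentalDomain b := by
    ext v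
    exact floor_eq_iff b v l
  rw [this]
  exact measurable_sub_const _ (ZSpan.fundamentalDomain_measurableSet b)

theorem measurable_zspan_fract : Measurable (ZSpan.fract b) := by
  have h : Measurable fun v : Plane => ((ZSpan.floor b v : latticeOf b) : Plane) :=
    measurable_subtype_coe.comp (measurable_floor b)
  exact measurable_id.sub h

/-- The translation flow on the pairs formed by a position in the fundamental domain and a field of
perturbations: translations act on the lattice shifted by that position, and the labels of the
lattice points are shifted accordingly. -/
noncomputable def latticeFlow (u : Plane) (ω : Plane × (latticeOf b → Plane)) :
    Plane × (latticeOf b → Plane) :=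
  (ZSpan.fract b (ω.1 - u), fun x => ω.2 (x - ZSpan.floor b (ω.1 - u)))

theorem measurable_latticeFlow : Measurable (Function.uncurry (latticeFlow b)) := by
  have hsub : Measurable fun z : Plane × (Plane × (latticeOf b → Plane)) => z.2.1 - z.1 :=
    (measurable_fst.comp measurable_snd).sub measurable_fst
  refine ((measurable_zspan_fract b).comp hsub).prodMk (measurable_pi_lambda _ fun x => ?_)
  have h1 : Measurable fun z : latticeOf b × (latticeOf b → Plane) => z.2 (x - z.1) :=
    measurable_from_prod_countable_right fun l => measurable_pi_apply (x - l)
  exact h1.comp (((measurable_floor b).comp hsub).prodMk (measurable_snd.comp measurable_snd))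

theorem latticeFlow_add (u v : Plane) (ω : Plane × (latticeOf b → Plane)) :
    latticeFlow b u (latticeFlow b v ω) = latticeFlow b (u + v) ω := by
  have e : ZSpan.fract b (ω.1 - v) - u =
      ω.1 - (u + v) - (ZSpan.floor b (ω.1 - v) : latticeOf b) := by
    rw [ZSpan.fract_apply]
    abel
  simp only [latticeFlow, e, fract_sub_lattice, floor_sub_lattice]
  refine Prod.ext rfl (funext fun x => congrArg ω.2 ?_)
  exact (sub_sub _ _ _).trans (congrArg (x - ·) (sub_add_cancel _ _))

theorem latticeFlow_zero {ω : Plane × (latticeOf b → Plane)}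
    (hω : ω.1 ∈ ZSpan.fundamentalDomain b) : latticeFlow b 0 ω = ω := by
  simp [latticeFlow, floor_eq_zero b hω, ZSpan.fract_eq_self.2 hω]

open scoped Pointwise in
/-- The uniform law on the fundamental domain is invariant under translations modulo the lattice. -/
theorem setLIntegral_fract_sub (f : Plane → ℝ≥0∞) (u : Plane) :
    ∫⁻ v in ZSpan.fundamentalDomain b, f (ZSpan.fract b (v - u)) =
      ∫⁻ v in ZSpan.fundamentalDomain b, f v := by
  have : VAddInvariantMeasure (latticeOf b) Plane volume :=
    inferInstanceAs <| VAddInvariantMeasure (latticeOf b).toAddSubgroup Plane volume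
  have hD := ZSpan.isAddFundamentalDomain b (volume : Measure Plane)
  have hDm := ZSpan.fundamentalDomain_measurableSet b
  have hD' : IsAddFundamentalDomain (latticeOf b) ((-u) +ᵥ ZSpan.fundamentalDomain b)
      (volume : Measure Plane) := hD.vadd_of_comm (-u)
  have h := hD'.setLIntegral_eq hD (fun v => f (ZSpan.fract b v)) fun l v => by
    have : l +ᵥ v = (l : Plane) + v := rfl
    rw [this, ZSpan.fract_zSpan_add b v l.2]
  have e1 : ∫⁻ v in ZSpan.fundamentalDomain b, f (ZSpan.fract b (v - u)) =
      ∫⁻ v in ((-u) +ᵥ ZSpan.fundamentalDomain b), f (ZSpan.fract b v) := by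
    rw [← lintegral_indicator hDm, ← lintegral_indicator (hDm.const_vadd (-u)),
      ← lintegral_add_right_eq_self _ u]
    refine lintegral_congr fun v => ?_
    by_cases hv : v + u ∈ ZSpan.fundamentalDomain b
    · rw [Set.indicator_of_mem hv, Set.indicator_of_mem, add_sub_cancel_right]
      rw [Set.mem_vadd_set_iff_neg_vadd_mem, neg_neg, vadd_eq_add, add_comm]
      exact hv
    · rw [Set.indicator_of_notMem hv, Set.indicator_of_notMem]
      rw [Set.mem_vadd_set_iff_neg_vadd_mem, neg_neg, vadd_eq_add, add_comm]
      exact hv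
  rw [e1, h]
  exact setLIntegral_congr_fun hDm fun v hv => by rw [ZSpan.fract_eq_self.2 hv]

theorem measurable_shift (l : latticeOf b) :
    Measurable fun (p : latticeOf b → Plane) (x : latticeOf b) => p (x - l) :=
  measurable_pi_lambda _ fun x => measurable_pi_apply (x - l)

/-- Translating changes the shift modulo the lattice, which preserves the uniform law on the
fundamental domain, and relabels the perturbations, which preserves their law for each fixed value
of the shift. The identity `latticeFlow b 0 ω = ω` only holds for shifts in the fundamental
domain. -/
theorem isStationaryFlow_latticeFlow (μ : Measure (latticeOf b → Plane)) [IsProbabilityMeasure μ]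
    (hμ : ∀ l : latticeOf b, μ.map (fun p x => p (x - l)) = μ) :
    IsStationaryFlow (latticeFlow b)
      (((volume : Measure Plane).restrict (ZSpan.fundamentalDomain b)).prod μ) := by
  have hDm := ZSpan.fundamentalDomain_measurableSet b
  have hm : ∀ u, Measurable (latticeFlow b u) := fun u =>
    (measurable_latticeFlow b).comp (measurable_const.prodMk measurable_id)
  refine ⟨measurable_latticeFlow b, fun u => ⟨hm u, ?_⟩, latticeFlow_add b, ?_⟩
  · refine Measure.ext_of_lintegral _ fun f hf => ?_
    have hfm : Measurable fun ω => f (latticeFlow b u ω) := hf.comp (hm u)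
    rw [lintegral_map hf (hm u), lintegral_prod _ hfm.aemeasurable,
      lintegral_prod _ hf.aemeasurable]
    have e : ∀ v, ∫⁻ p, f (latticeFlow b u (v, p)) ∂μ =
        ∫⁻ p, f (ZSpan.fract b (v - u), p) ∂μ := by
      intro v
      conv_rhs => rw [← hμ (ZSpan.floor b (v - u))]
      have hfv : Measurable fun p : latticeOf b → Plane => f (ZSpan.fract b (v - u), p) :=
        hf.comp (measurable_const.prodMk measurable_id)
      rw [lintegral_map hfv (measurable_shift b _)]
      rfl
    simp_rw [e]
    exact setLIntegral_fract_sub b (fun v => ∫⁻ p, f (v, p) ∂μ) u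
  · have : ∀ᵐ v ∂((volume : Measure Plane).restrict (ZSpan.fundamentalDomain b)),
        v ∈ ZSpan.fundamentalDomain b := ae_restrict_mem hDm
    filter_upwards [(Measure.quasiMeasurePreserving_fst (ν := μ)).ae this] with ω hω
      using latticeFlow_zero b hω

/-- On the space of pairs (shift, perturbations), the perturbed lattice is an image of the counting
measure of the lattice. -/
theorem perturbedLattice_eq_map_count (ω : Plane × (latticeOf b → Plane)) :
    perturbedLattice b Prod.fst (fun x (ω : Plane × (latticeOf b → Plane)) => ω.2 x) ω =
      Measure.count.map fun x : latticeOf b => (x : Plane) + ω.1 + ω.2 x := by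
  have hm : Measurable fun x : latticeOf b => (x : Plane) + ω.1 + ω.2 x := measurable_of_countable _
  rw [perturbedLattice, Measure.count, Measure.map_sum hm.aemeasurable]
  simp_rw [Measure.map_dirac' hm]

/-- The perturbed lattice is the image of Lebesgue measure under the map that sends each cell of
area `1` to the perturbed point attached to it. -/
theorem perturbedLattice_eq_displacedLebesgue
    (hcovol : volume (ZSpan.fundamentalDomain b) = 1) (ω : Plane × (latticeOf b → Plane)) :
    perturbedLattice b Prod.fst (fun x (ω : Plane × (latticeOf b → Plane)) => ω.2 x) ω =
      displacedLebesgue (latticeFlow b)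
        (fun ω : Plane × (latticeOf b → Plane) => ω.1 + ω.2 0) ω := by
  have hm : Measurable fun x : latticeOf b => (x : Plane) + ω.1 + ω.2 x := measurable_of_countable _
  -- `F y` is the lattice point `x` such that `y` belongs to the reflected cell
  -- `ω.1 + x - fundamentalDomain`.
  set F : Plane → latticeOf b := fun y => -ZSpan.floor b (ω.1 - y) with hF
  have hFm : Measurable F :=
    (measurable_of_countable (fun x : latticeOf b => -x)).comp
      ((measurable_floor b).comp (measurable_const.sub measurable_id))
  have hcount : (volume : Measure Plane).map F = Measure.count := by
    refine Measure.ext_of_singleton fun l => ?_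
    rw [Measure.map_apply hFm (measurableSet_singleton l), Measure.count_singleton]
    have : F ⁻¹' {l} = (fun y => (ω.1 + l) - y) ⁻¹' ZSpan.fundamentalDomain b := by
      ext y
      rw [Set.mem_preimage, Set.mem_singleton_iff, Set.mem_preimage, hF, neg_eq_iff_eq_neg,
        floor_eq_iff]
      have : ω.1 - y - ((-l : latticeOf b) : Plane) = ω.1 + l - y := by
        rw [NegMemClass.coe_neg]
        abel
      rw [this]
    rw [this, (volume.measurePreserving_sub_left (ω.1 + (l : Plane))).measure_preimage
      (ZSpan.fundamentalDomain_measurableSet b).nullMeasurableSet, hcovol]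
  rw [perturbedLattice_eq_map_count, ← hcount, Measure.map_map hm hFm, displacedLebesgue]
  congr 1
  ext1 y
  simp only [Function.comp_apply, latticeFlow, hF, ZSpan.fract_apply, zero_sub]
  rw [NegMemClass.coe_neg]
  abel

theorem isPointConfiguration_perturbedLattice (ω : Plane × (latticeOf b → Plane))
    (h : IsLocallyFiniteMeasure (perturbedLattice b Prod.fst
      (fun x (ω : Plane × (latticeOf b → Plane)) => ω.2 x) ω)) :
    IsPointConfiguration (perturbedLattice b Prod.fst
      (fun x (ω : Plane × (latticeOf b → Plane)) => ω.2 x) ω) := by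
  refine ⟨h, fun B hB hBb => ?_⟩
  have hm : Measurable fun x : latticeOf b => (x : Plane) + ω.1 + ω.2 x := measurable_of_countable _
  have hfin := hBb.measure_lt_top (μ := perturbedLattice b Prod.fst
    (fun x (ω : Plane × (latticeOf b → Plane)) => ω.2 x) ω)
  rw [perturbedLattice_eq_map_count, Measure.map_apply hm hB] at hfin ⊢
  have hs := Measure.count_apply_lt_top.1 hfin
  exact ⟨hs.toFinset.card, Measure.count_apply_finite _ hs⟩

end Lattice

/-! ### Transfer between probability spaces -/

/-- The moment bound for the displacement of the origin of the shifted lattice. -/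
theorem lintegral_one_add_norm_rpow_lt_top {Ω : Type*} [MeasurableSpace Ω] {P : Measure Ω}
    [IsProbabilityMeasure P] {V p : Ω → Plane} {M : ℝ} (hM : ∀ᵐ ω ∂P, ‖V ω‖ ≤ M) {q : ℝ}
    (hq : 1 ≤ q) (hp : ∫⁻ ω, ‖p ω‖ₑ ^ q ∂P < ∞) :
    ∫⁻ ω, ENNReal.ofReal ((1 + ‖V ω + p ω‖) ^ q) ∂P < ∞ := by
  have hpt : ∀ᵐ ω ∂P, ENNReal.ofReal ((1 + ‖V ω + p ω‖) ^ q) ≤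
      2 ^ (q - 1) * (ENNReal.ofReal (1 + M) ^ q + ‖p ω‖ₑ ^ q) := by
    filter_upwards [hM] with ω hω
    refine le_trans ?_ (ENNReal.rpow_add_le_mul_rpow_add_rpow _ _ hq)
    have hM0 : 0 ≤ M := (norm_nonneg _).trans hω
    rw [← ofReal_norm, ← ENNReal.ofReal_add (by positivity) (norm_nonneg _),
      ENNReal.ofReal_rpow_of_nonneg (by positivity) (by linarith)]
    refine ENNReal.ofReal_le_ofReal (Real.rpow_le_rpow (by positivity) ?_ (by linarith))
    linarith [norm_add_le (V ω) (p ω)]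
  refine (lintegral_mono_ae hpt).trans_lt ?_
  have h2 : (2 : ℝ≥0∞) ^ (q - 1) ≠ ∞ :=
    ENNReal.rpow_ne_top_of_nonneg (by linarith) (by norm_num)
  rw [lintegral_const_mul' _ _ h2, lintegral_add_left measurable_const, lintegral_const,
    measure_univ, mul_one]
  refine ENNReal.mul_lt_top h2.lt_top (ENNReal.add_lt_top.2 ⟨?_, hp⟩)
  exact ENNReal.rpow_lt_top_of_nonneg (by linarith) ENNReal.ofReal_ne_top

theorem IsPointProcess.comp {Ω Ω' : Type*} [MeasurableSpace Ω] [MeasurableSpace Ω']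
    {X : Ω' → Measure Plane} {P : Measure Ω} {Q : Measure Ω'} (hX : IsPointProcess X Q)
    {T : Ω → Ω'} (hT : MeasurePreserving T P Q) : IsPointProcess (X ∘ T) P :=
  ⟨hX.1.comp hT.measurable, hT.quasiMeasurePreserving.ae hX.2⟩

theorem rescaledNumberVariance_comp {Ω Ω' : Type*} [MeasurableSpace Ω] [MeasurableSpace Ω']
    {X : Ω' → Measure Plane} {P : Measure Ω} {Q : Measure Ω'} (hX : Measurable X)
    {T : Ω → Ω'} (hT : MeasurePreserving T P Q) :
    rescaledNumberVariance (X ∘ T) P = rescaledNumberVariance X Q := by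
  ext1 r
  have hm : Measurable fun ω => (X ω (Metric.closedBall 0 r)).toReal :=
    ((Measure.measurable_coe measurableSet_closedBall).comp hX).ennreal_toReal
  have hI : ∫ ω, ((X ∘ T) ω (Metric.closedBall 0 r)).toReal ∂P =
      ∫ ω, (X ω (Metric.closedBall 0 r)).toReal ∂Q := by
    rw [← hT.map_eq, integral_map hT.measurable.aemeasurable hm.aestronglyMeasurable]
    rfl
  rw [rescaledNumberVariance, rescaledNumberVariance, evariance, evariance, hI,
    ← hT.lintegral_comp ((hm.sub_const _).enorm.pow_const 2)]
  rfl

theorem corollary3p8 {Ω : Type*} [MeasurableSpace Ω] (P : Measure Ω) [IsProbabilityMeasure P]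
    (b : Module.Basis (Fin 2) ℝ Plane)
    (hcovol : volume (ZSpan.fundamentalDomain b) = 1)
    (U : Ω → Plane) (hU : Measurable U)
    (hUunif : pdf.IsUniform U (ZSpan.fundamentalDomain b) P volume)
    (p : latticeOf b → Ω → Plane) (hp : ∀ x, Measurable (p x))
    (hindep : IndepFun U (fun ω x => p x ω) P)
    (hinv : IsLatticeInvariant b p P)
    (α : ℝ) (hα : 0 < α)
    (hmoment : ∫⁻ ω, ‖p 0 ω‖ₑ ^ (2 + α) ∂P < ∞) :
    IsPointProcess (perturbedLattice b U p) P ∧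
    IsStarHyperuniform (perturbedLattice b U p) P ∧
    ∀ η : ℝ, 0 < η →
      regularizedCoulombEnergy η (P.map (perturbedLattice b U p)) < ∞ := by
  have hpm : Measurable fun ω x => p x ω := measurable_pi_lambda _ hp
  set μ : Measure (latticeOf b → Plane) := P.map fun ω x => p x ω with hμ
  have : IsProbabilityMeasure μ := Measure.isProbabilityMeasure_map hpm.aemeasurable
  set lam : Measure Plane := volume.restrict (ZSpan.fundamentalDomain b) with hlam
  have : IsProbabilityMeasure lam := ⟨by rw [hlam, Measure.restrict_apply_univ, hcovol]⟩
  set Q : Measure (Plane × (latticeOf b → Plane)) := lam.prod μ with hQ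
  have hshift : ∀ l : latticeOf b, μ.map (fun q x => q (x - l)) = μ := by
    intro l
    rw [hμ, Measure.map_map (measurable_shift b l) hpm, ← (hinv (-l)).map_eq]
    simp only [sub_eq_add_neg]
    rfl
  have hT : MeasurePreserving (fun ω => (U ω, fun x => p x ω)) P Q := by
    refine ⟨hU.prodMk hpm, ?_⟩
    rw [hindep.map_prod_eq_prod_map_map hU.aemeasurable hpm.aemeasurable, hUunif,
      ProbabilityTheory.cond, hcovol, inv_one, one_smul]
  have hθ := isStationaryFlow_latticeFlow b μ hshift
  set τ : Plane × (latticeOf b → Plane) → Plane := fun ω => ω.1 + ω.2 0 with hτdef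
  have hτ : Measurable τ :=
    measurable_fst.add ((measurable_pi_apply (0 : latticeOf b)).comp measurable_snd)
  have hm : ∫⁻ ω, ENNReal.ofReal ((1 + ‖τ ω‖) ^ (2 + α)) ∂Q < ∞ := by
    obtain ⟨M, hM⟩ := (ZSpan.fundamentalDomain_isBounded b).exists_norm_le
    have hD : ∀ᵐ v ∂lam, v ∈ ZSpan.fundamentalDomain b :=
      ae_restrict_mem (ZSpan.fundamentalDomain_measurableSet b)
    refine lintegral_one_add_norm_rpow_lt_top (M := M) ?_ (by linarith) ?_
    · filter_upwards [(Measure.quasiMeasurePreserving_fst (ν := μ)).ae hD] with ω hω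
        using hM _ hω
    · have hn : Measurable fun ω : Plane × (latticeOf b → Plane) => ‖ω.2 0‖ₑ ^ (2 + α) :=
        (((measurable_pi_apply (0 : latticeOf b)).comp measurable_snd).enorm).pow_const _
      rw [← hT.lintegral_comp hn]
      exact hmoment
  set Y := displacedLebesgue (latticeFlow b) τ with hY
  have hYm : Measurable Y := hθ.measurable_displacedLebesgue hτ
  have heq : ∀ ω, perturbedLattice b Prod.fst
      (fun x (ω : Plane × (latticeOf b → Plane)) => ω.2 x) ω = Y ω :=
    perturbedLattice_eq_displacedLebesgue b hcovol
  have hcomp : perturbedLattice b U p = Y ∘ fun ω => (U ω, fun x => p x ω) := by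
    ext1 ω
    exact heq (U ω, fun x => p x ω)
  have hpp : IsPointProcess Y Q := by
    refine ⟨hYm, ?_⟩
    filter_upwards [hθ.ae_isLocallyFiniteMeasure_displacedLebesgue hτ] with ω hω
    rw [← hY] at hω
    rw [← heq] at hω ⊢
    exact isPointConfiguration_perturbedLattice b ω hω
  have hstar := hθ.isStarHyperuniform_displacedLebesgue hτ hα hm
  rw [hcomp]
  refine ⟨hpp.comp hT, ?_, fun η hη => ?_⟩
  · rw [IsStarHyperuniform, IsHyperuniform, rescaledNumberVariance_comp hYm hT]
    exact hstar
  · rw [← Measure.map_map hYm hT.measurable, hT.map_eq]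
    exact hθ.regularizedCoulombEnergy_displacedLebesgue_lt_top hτ hα hm hη hpp
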